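/- Let $n,m\ge 0$ be integers, let $E$ be a smooth Hausdorff manifold of dimension $n+m$ and let $M$ be a smooth Hausdorff manifold of dimension $n$ (both without boundary). Let $\Gamma$ be a smooth torsion-free linear connection on $TE\to E$ and $\Theta$ a smooth torsion-free linear connection on $TM\to M$. **Jets.** For a manifold $F$, let $J^r(F,n)$ be the manifold of $r$-jets $[L]^r_p$ of $n$-dimensional submanifolds $L\subset F$ at points $p\in L$, with projections $\pi_{r,k}\colon J^r(F,n)\to J^k(F,n)$, and $J^0(F,n)=F$. For $L\subset F$ let $L^{(r)}=\{[L]^r_p : p\in L\}\subset J^r(F,n)$. The $R$-plane of $\theta=[L]^{r+1}_p$ is $R_\theta=T_{[L]^r_p}L^{(r)}\subset T J^r(F,n)$, and the Cartan distribution $\mathcal C^r$ on $J^r(F,n)$ is given at each $\bar\theta$ by the span of the planes $T_{\bar\theta}L^{(r)}$ for all $L$ with $[L]^r_p=\bar\theta$. Let $\mathrm{pr}_M\colon M\times E\to M$ be the projection. $J^r\mathrm{pr}_M\subset J^r(M\times E,n)$ is the set of $r$-jets of images of local sections of $\mathrm{pr}_M$, that is, of graphs of local maps $M\to E$, and $\operatorname{Imm}J^r\mathrm{pr}_M\subset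 J^r\mathrm{pr}_M$ is the set of $r$-jets of (graphs of) local immersions $M\to E$. **Prolongations.** An equation is a subset $\mathcal E\subset J^r(F,n)$. Write $T\mathcal E$ for the set of velocities of smooth curves lying in $\mathcal E$. The prolongation of $\mathcal E$ is $\mathcal E^1=\{\theta\in J^{r+1}(F,n) : \pi_{r+1,r}(\theta)\in\mathcal E,\ R_\theta\subset T\mathcal E\}$, and $\mathcal E^0=\mathcal E$, $\mathcal E^{l+1}=(\mathcal E^l)^1$. The induced Cartan distribution of $\mathcal E\subset J^r(F,n)$ is $\mathcal C(\mathcal E)=\mathcal C^r\cap T\mathcal E$. **Totally geodesic submanifolds.** Let $\nabla$ be a smooth torsion-free linear connection on $F$. The second fundamental form of $L\subset F$ is $\mathrm{II}(X,Y)=\nabla_XY \bmod TL$ for $X,Y$ tangent to $L$, and $\mathcal S(\nabla)\subset J^2(F,n)$ is the set of 2-jets at which $\mathrm{II}=0$. The connection $\nabla$ induces a connection on $\pi_{1,0}\colon J^1(F,n)\to F$: the horizontal lift of $v\in T_pF$ at $\theta\in J^1(F,n)$ over $p$ is $T\sigma(v)$, where $\sigma$ is any field of $n$-planes near $p$ with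 $\sigma(p)=\theta$ that is parallel along $v$, i.e. $\nabla_vY\in\sigma(p)$ for every local vector field $Y$ contained in $\sigma$. Define the section $\ddot\nabla$ of $\pi_{2,1}$ by letting $\ddot\nabla(\theta)$ be the point over $\theta$ whose $R$-plane is the horizontal lift at $\theta$ of the plane $\theta\subset T_pF$, and let $R\circ\ddot\nabla$ be the distribution $\theta\mapsto R_{\ddot\nabla(\theta)}$ of $n$-planes on $J^1(F,n)$. It is called integrable on an open set $U\subset J^1(F,n)$ if through each point of $U$ there is an $n$-dimensional integral submanifold. For $F=E$, $\nabla=\Gamma$ put $\mathcal S=\mathcal S(\Gamma)$ and $\ddot\Gamma=\ddot\nabla$. For $F=M\times E$, $\nabla=\Theta\oplus\Gamma$ put $\mathcal S_{\mathrm{pr}_M}=\mathcal S(\Theta\oplus\Gamma)\cap J^2\mathrm{pr}_M$ and let $\ddot\Gamma_{\mathrm{pr}_M}$ be the restriction of $\ddot\nabla$ to the open set $J^1\mathrm{pr}_M$. **Theorem.** 1. If $R\circ\ddot\Gamma$ is integrable on $J^1(E,n)$, then for every $l\ge 0$ the prolongation $\mathcal S^l\subset J^{2+l}(E,n)$ is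 an embedded submanifold and there is a diffeomorphism $J^1(E,n)\to\mathcal S^l$ whose differential maps $R\circ\ddot\Gamma$ onto the induced Cartan distribution $\mathcal C(\mathcal S^l)$. 2. If $R\circ\ddot\Gamma_{\mathrm{pr}_M}$ is integrable on $J^1\mathrm{pr}_M$, then for every $l\ge 0$ the prolongation $\mathcal S_{\mathrm{pr}_M}^l$ is an embedded submanifold of $J^{2+l}(M\times E,n)$ and there is a diffeomorphism $J^1\mathrm{pr}_M\to\mathcal S_{\mathrm{pr}_M}^l$ whose differential maps $R\circ\ddot\Gamma_{\mathrm{pr}_M}$ onto $\mathcal C(\mathcal S_{\mathrm{pr}_M}^l)$. 3. The same as 2 holds with $J^1\mathrm{pr}_M$ replaced by $\operatorname{Imm}J^1\mathrm{pr}_M$ and $\mathcal S_{\mathrm{pr}_M}$ replaced by $\mathcal S(\Theta\oplus\Gamma)\cap\operatorname{Imm}J^2\mathrm{pr}_M$. -/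

import Mathlib

open Set Filter Topology Function
open scoped Manifold ContDiff

namespace GrassmannJet

noncomputable section

section Calculus

variable {A B C : Type*} [NormedAddCommGroup A] [NormedSpace ℝ A]
  [NormedAddCommGroup B] [NormedSpace ℝ B] [NormedAddCommGroup C] [NormedSpace ℝ C]

/-- `f` is of class `C^∞` on a neighbourhood of `x`. -/
def SmoothNear (f : A → B) (x : A) : Prop := ∀ᶠ y in 𝓝 x, ContDiffAt ℝ ∞ f y

/-- `f` and `g` have the same derivatives at `x` up to order `r`. -/
def JetEqAt (r : ℕ) (f g : A → B) (x : A) : Prop :=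
  ∀ k ≤ r, iteratedFDeriv ℝ k f x = iteratedFDeriv ℝ k g x

lemma SmoothNear.self {f : A → B} {x : A} (h : SmoothNear f x) : ContDiffAt ℝ ∞ f x :=
  Filter.Eventually.self_of_nhds h

lemma ContDiff.smoothNear {f : A → B} (h : ContDiff ℝ ∞ f) (x : A) : SmoothNear f x :=
  Eventually.of_forall fun _ => h.contDiffAt

lemma SmoothNear.comp {g : B → C} {f : A → B} {x : A} {y : B} (hy : f x = y)
    (hg : SmoothNear g y) (hf : SmoothNear f x) : SmoothNear (g ∘ f) x := by
  subst hy
  filter_upwards [hf, hf.self.continuousAt.eventually hg] with z h1 h2 using h2.comp z h1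

lemma SmoothNear.congr {f g : A → B} {x : A} (hf : SmoothNear f x) (h : f =ᶠ[𝓝 x] g) :
    SmoothNear g x := by
  filter_upwards [hf, eventually_eventuallyEq_nhds.2 h] with z h1 h2
  exact h1.congr_of_eventuallyEq (show g =ᶠ[𝓝 z] f from h2.symm)

lemma SmoothNear.prodMk {f : A → B} {g : A → C} {x : A} (hf : SmoothNear f x)
    (hg : SmoothNear g x) : SmoothNear (fun y => (f y, g y)) x := by
  filter_upwards [hf, hg] with z h1 h2 using h1.prodMk h2

lemma SmoothNear.add {f g : A → B} {x : A} (hf : SmoothNear f x)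
    (hg : SmoothNear g x) : SmoothNear (fun y => f y + g y) x := by
  filter_upwards [hf, hg] with z h1 h2 using h1.add h2

lemma JetEqAt.refl (r : ℕ) (f : A → B) (x : A) : JetEqAt r f f x := fun _ _ => rfl

lemma JetEqAt.symm {r : ℕ} {f g : A → B} {x : A} (h : JetEqAt r f g x) : JetEqAt r g f x :=
  fun k hk => (h k hk).symm

lemma JetEqAt.trans {r : ℕ} {f g h : A → B} {x : A} (h1 : JetEqAt r f g x)
    (h2 : JetEqAt r g h x) : JetEqAt r f h x :=
  fun k hk => (h1 k hk).trans (h2 k hk)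

lemma JetEqAt.of_eventuallyEq {r : ℕ} {f g : A → B} {x : A} (h : f =ᶠ[𝓝 x] g) :
    JetEqAt r f g x := fun k _ => (h.iteratedFDeriv ℝ k).self_of_nhds

lemma JetEqAt.eq {r : ℕ} {f g : A → B} {x : A} (h : JetEqAt r f g x) : f x = g x := by
  have := congrArg (fun m => m 0) (h 0 (Nat.zero_le _))
  simpa using this

lemma JetEqAt.mono {r k : ℕ} (hk : k ≤ r) {f g : A → B} {x : A} (h : JetEqAt r f g x) :
    JetEqAt k f g x := fun j hj => h j (hj.trans hk)

lemma JetEqAt.fderiv_eq {r : ℕ} (hr : r ≠ 0) {f g : A → B} {x : A} (h : JetEqAt r f g x) :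
    fderiv ℝ f x = fderiv ℝ g x := by
  have := h 1 (Nat.one_le_iff_ne_zero.2 hr)
  ext v
  have := congrArg (fun m => m (fun _ => v)) this
  simpa [iteratedFDeriv_one_apply] using this

lemma JetEqAt.comp {r : ℕ} {f f' : A → B} {g g' : B → C} {x : A} {y : B} (hy : f x = y)
    (hf : ContDiffAt ℝ ∞ f x) (hf' : ContDiffAt ℝ ∞ f' x)
    (hg : ContDiffAt ℝ ∞ g y) (hg' : ContDiffAt ℝ ∞ g' y)
    (h1 : JetEqAt r f f' x) (h2 : JetEqAt r g g' y) : JetEqAt r (g ∘ f) (g' ∘ f') x := by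
  subst hy
  intro k hk
  have hk' : (k : WithTop ℕ∞) ≤ ∞ := by exact_mod_cast le_top
  rw [iteratedFDeriv_comp hg hf hk', iteratedFDeriv_comp (h1.eq ▸ hg') hf' hk']
  unfold FormalMultilinearSeries.taylorComp
  refine Finset.sum_congr rfl fun c _ => ?_
  ext v
  simp only [FormalMultilinearSeries.compAlongOrderedFinpartition_apply]
  have e1 : ftaylorSeries ℝ g (f x) c.length = ftaylorSeries ℝ g' (f' x) c.length := by
    rw [← h1.eq]; exact h2 _ (c.length_le.trans hk)
  rw [e1]
  congr 1
  ext m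
  simp only [OrderedFinpartition.applyOrderedFinpartition]
  have e2 : ftaylorSeries ℝ f x (c.partSize m) = ftaylorSeries ℝ f' x (c.partSize m) :=
    h1 _ ((c.partSize_le m).trans hk)
  rw [e2]

lemma JetEqAt.prodMk {r : ℕ} {f f' : A → B} {g g' : A → C} {x : A}
    (hf : ContDiffAt ℝ ∞ f x) (hf' : ContDiffAt ℝ ∞ f' x)
    (hg : ContDiffAt ℝ ∞ g x) (hg' : ContDiffAt ℝ ∞ g' x)
    (h1 : JetEqAt r f f' x) (h2 : JetEqAt r g g' x) :
    JetEqAt r (fun y => (f y, g y)) (fun y => (f' y, g' y)) x := by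
  intro k hk
  have hk' : (k : WithTop ℕ∞) ≤ ∞ := by exact_mod_cast le_top
  have e (f : A → B) (g : A → C) (hf : ContDiffAt ℝ ∞ f x) (hg : ContDiffAt ℝ ∞ g x) :
      iteratedFDeriv ℝ k (fun y => (f y, g y)) x
        = (iteratedFDeriv ℝ k f x).prod (iteratedFDeriv ℝ k g x) := by
    have a1 := (ContinuousLinearMap.fst ℝ B C).iteratedFDeriv_comp_left (hf.prodMk hg) hk'
    have a2 := (ContinuousLinearMap.snd ℝ B C).iteratedFDeriv_comp_left (hf.prodMk hg) hk'
    ext v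
    · have := congrArg (fun m => m v) a1
      simpa [Function.comp_def] using this.symm
    · have := congrArg (fun m => m v) a2
      simpa [Function.comp_def] using this.symm
  rw [e f g hf hg, e f' g' hf' hg', h1 k hk, h2 k hk]

/-- Inverse function theorem, for maps that are smooth near a point. -/
lemma SmoothNear.exists_inverse [FiniteDimensional ℝ A] {f : A → A} {a b : A}
    (hf : SmoothNear f a) (hb : f a = b) (hi : Injective (fderiv ℝ f a)) :
    ∃ g : A → A, SmoothNear g b ∧ g b = a ∧ (∀ᶠ y in 𝓝 b, f (g y) = y) ∧
      (∀ᶠ x in 𝓝 a, g (f x) = x) ∧ Injective (fderiv ℝ g b) := by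
  subst hb
  have : CompleteSpace A := FiniteDimensional.complete ℝ A
  have mk (x : A) (h : Injective (fderiv ℝ f x)) :
      ∃ e : A ≃L[ℝ] A, (e : A →L[ℝ] A) = fderiv ℝ f x :=
    ⟨(LinearEquiv.ofInjectiveEndo (fderiv ℝ f x : A →ₗ[ℝ] A) h).toContinuousLinearEquiv,
      by ext; rfl⟩
  obtain ⟨e, he⟩ := mk a hi
  have hd : HasFDerivAt f (e : A →L[ℝ] A) a := by
    rw [he]; exact (hf.self.differentiableAt (by simp)).hasFDerivAt
  have hn : (∞ : WithTop ℕ∞) ≠ 0 := by simp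
  let P := hf.self.toOpenPartialHomeomorph f hd hn
  have ha : a ∈ P.source := hf.self.mem_toOpenPartialHomeomorph_source hd hn
  have hPa : P a = f a := rfl
  have hfa : f a ∈ P.target := hf.self.image_mem_toOpenPartialHomeomorph_target hd hn
  have hs : P.symm (f a) = a := P.left_inv ha
  have r1 : ∀ᶠ y in 𝓝 (f a), f (P.symm y) = y := by
    filter_upwards [P.open_target.mem_nhds hfa] with y hy using P.right_inv hy
  have c0 : ContinuousAt P.symm (f a) := P.continuousAt_symm hfa
  have inj : ∀ᶠ x in 𝓝 a, Injective (fderiv ℝ f x) := by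
    have c : ContinuousAt (fderiv ℝ f) a := hf.self.continuousAt_fderiv (by simp)
    have := c.eventually (f := fderiv ℝ f) (p := fun L => L ∈ range ((↑) : (A ≃L[ℝ] A) → A →L[ℝ] A))
      (he ▸ ContinuousLinearEquiv.nhds e)
    filter_upwards [this] with x hx
    obtain ⟨e', he'⟩ := hx
    rw [← he']; exact e'.injective
  have sm : SmoothNear P.symm (f a) := by
    rw [ContinuousAt, hs] at c0
    filter_upwards [c0.eventually inj, c0.eventually hf, P.open_target.mem_nhds hfa]
      with y h1 h2 h3
    obtain ⟨e', he'⟩ := mk _ h1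
    refine P.contDiffAt_symm h3 (f₀' := e') ?_ h2
    rw [he']; exact (h2.differentiableAt (by simp)).hasFDerivAt
  refine ⟨P.symm, sm, hs, r1, ?_, ?_⟩
  · filter_upwards [P.open_source.mem_nhds ha] with x hx using P.left_inv hx
  · have d1 : HasFDerivAt P.symm (fderiv ℝ P.symm (f a)) (f a) :=
      (sm.self.differentiableAt (by simp)).hasFDerivAt
    have d2 : HasFDerivAt (f ∘ P.symm) ((e : A →L[ℝ] A).comp (fderiv ℝ P.symm (f a))) (f a) :=
      HasFDerivAt.comp (f a) (by rw [hs]; exact hd) d1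
    have d3 : HasFDerivAt (f ∘ P.symm) (ContinuousLinearMap.id ℝ A) (f a) :=
      (hasFDerivAt_id (f a)).congr_of_eventuallyEq r1
    have := d2.unique d3
    intro u v huv
    have hu := congrArg (fun L => L u) this
    have hv := congrArg (fun L => L v) this
    simp only [ContinuousLinearMap.comp_apply, ContinuousLinearMap.id_apply] at hu hv
    rw [← hu, ← hv, huv]

/-- The derivatives of a family of maps, as functions of the parameter. -/
lemma SmoothNear.iteratedFDeriv_param {P : Type*} [NormedAddCommGroup P] [NormedSpace ℝ P]
    {H : P × A → B} {p : P} {x : A} (hH : SmoothNear H (p, x)) (k : ℕ) :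
    SmoothNear (fun q => iteratedFDeriv ℝ k (fun y => H (q, y)) x) p := by
  have main : SmoothNear (fun w : P × A => iteratedFDeriv ℝ k (fun y => H (w.1, y)) w.2) (p, x) := by
    induction k with
    | zero =>
      filter_upwards [hH] with w hw
      exact (continuousMultilinearCurryFin0 ℝ A B).symm.contDiff.contDiffAt.comp w hw
    | succ k ih =>
      have step : ∀ᶠ w in 𝓝 (p, x), iteratedFDeriv ℝ (k + 1) (fun y => H (w.1, y)) w.2 =
          (continuousMultilinearCurryLeftEquiv ℝ (fun _ : Fin (k + 1) => A) B).symm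
            ((fderiv ℝ (fun w : P × A => iteratedFDeriv ℝ k (fun y => H (w.1, y)) w.2) w).comp
              (ContinuousLinearMap.inr ℝ P A)) := by
        filter_upwards [ih] with w hw
        rw [iteratedFDeriv_succ_eq_comp_left]
        simp only [comp_apply]
        congr 1
        have h1 := (hw.differentiableAt (by simp)).hasFDerivAt
        have h2 : HasFDerivAt (fun y : A => (w.1, y)) (ContinuousLinearMap.inr ℝ P A) w.2 :=
          hasFDerivAt_prodMk_right w.1 w.2
        exact (HasFDerivAt.comp (f := fun y : A => (w.1, y)) w.2 h1 h2).fderiv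
      refine SmoothNear.congr ?_ (step.mono fun _ h => h.symm)
      filter_upwards [ih] with w hw
      have h1 : ContDiffAt ℝ ∞ (fderiv ℝ
          (fun w : P × A => iteratedFDeriv ℝ k (fun y => H (w.1, y)) w.2)) w :=
        hw.fderiv_right (by simp)
      exact (LinearIsometryEquiv.contDiff _).contDiffAt.comp w
        (h1.clm_comp contDiffAt_const)
  have c : ContDiff ℝ ∞ (fun q : P => (q, x)) := contDiff_id.prodMk contDiff_const
  exact SmoothNear.comp (f := fun q : P => (q, x)) rfl main (ContDiff.smoothNear c p)

end Calculus

/-- The coordinate space `ℝⁿ`. -/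
abbrev Vec (n : ℕ) := EuclideanSpace ℝ (Fin n)

set_option linter.unusedSectionVars false

section Taylor

/-- Families of multilinear maps of order at most `r`. -/
def DerivFamily (n c r : ℕ) : Type :=
  (k : Fin (r + 1)) → ContinuousMultilinearMap ℝ (fun _ : Fin k => Vec n) (Vec c)

instance (n c r : ℕ) : NormedAddCommGroup (DerivFamily n c r) :=
  inferInstanceAs (NormedAddCommGroup
    ((k : Fin (r + 1)) → ContinuousMultilinearMap ℝ (fun _ : Fin k => Vec n) (Vec c)))

instance (n c r : ℕ) : NormedSpace ℝ (DerivFamily n c r) :=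
  inferInstanceAs (NormedSpace ℝ
    ((k : Fin (r + 1)) → ContinuousMultilinearMap ℝ (fun _ : Fin k => Vec n) (Vec c)))

/-- The member of order `k` of a family. -/
def DerivFamily.coeff {n c r : ℕ} (k : Fin (r + 1)) :
    DerivFamily n c r →ₗ[ℝ] ContinuousMultilinearMap ℝ (fun _ : Fin k => Vec n) (Vec c) where
  toFun a := a k
  map_add' _ _ := rfl
  map_smul' _ _ := rfl

lemma DerivFamily.ext {n c r : ℕ} {a b : DerivFamily n c r} (h : ∀ k, coeff k a = coeff k b) :
    a = b := funext h

/-- The space of `r`-jets at `0` of smooth maps `ℝⁿ → ℝᶜ`, a jet being recorded as the family of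
its derivatives of order at most `r`. -/
def TaylorSpace (n c r : ℕ) :
    Submodule ℝ (DerivFamily n c r) where
  carrier := {a | ∃ f : Vec n → Vec c, SmoothNear f 0 ∧ ∀ k, DerivFamily.coeff k a = iteratedFDeriv ℝ k f 0}
  zero_mem' := ⟨fun _ => 0, ContDiff.smoothNear contDiff_const 0, fun k => by
    rw [show (fun _ : Vec n => (0 : Vec c)) = 0 from rfl, map_zero]; simp⟩
  add_mem' := by
    rintro a b ⟨f, hf, haf⟩ ⟨g, hg, hbg⟩
    refine ⟨f + g, hf.add hg, fun k => ?_⟩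
    have hk : ((k : ℕ) : WithTop ℕ∞) ≤ ∞ := by exact_mod_cast le_top
    rw [iteratedFDeriv_add_apply (hf.self.of_le hk) (hg.self.of_le hk), map_add, haf, hbg]
  smul_mem' := by
    rintro t a ⟨f, hf, haf⟩
    refine ⟨t • f, hf.mono fun y hy => hy.const_smul t, fun k => ?_⟩
    have hk : ((k : ℕ) : WithTop ℕ∞) ≤ ∞ := by exact_mod_cast le_top
    rw [iteratedFDeriv_const_smul_apply (hf.self.of_le hk), map_smul, haf]

instance (n c r : ℕ) : FiniteDimensional ℝ (DerivFamily n c r) := by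
  have (k : Fin (r + 1)) :
      FiniteDimensional ℝ (ContinuousMultilinearMap ℝ (fun _ : Fin k => Vec n) (Vec c)) :=
    Module.Finite.of_injective
      (ContinuousMultilinearMap.toMultilinearMapLinear (R' := ℝ) (A := ℝ)
        (M₁ := fun _ : Fin k => Vec n) (M₂ := Vec c))
      ContinuousMultilinearMap.toMultilinearMap_injective
  exact inferInstanceAs (FiniteDimensional ℝ
    ((k : Fin (r + 1)) → ContinuousMultilinearMap ℝ (fun _ : Fin k => Vec n) (Vec c)))

/-- Every jet is the jet of a map, which can be chosen to depend smoothly on the jet. -/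
lemma exists_taylorMap (n c r : ℕ) : ∃ Φ : TaylorSpace n c r × Vec n → Vec c,
    (∀ a, SmoothNear Φ (a, 0)) ∧
      ∀ (a : TaylorSpace n c r) (k : Fin (r + 1)),
        iteratedFDeriv ℝ k (fun x => Φ (a, x)) 0 = DerivFamily.coeff k a.1 := by
  let b := Module.finBasis ℝ (TaylorSpace n c r)
  have hb (i) : ∃ f : Vec n → Vec c, SmoothNear f 0 ∧
      ∀ k, DerivFamily.coeff k (b i).1 = iteratedFDeriv ℝ k f 0 := (b i).2
  choose f hf hbf using hb
  refine ⟨fun w => ∑ i, b.repr w.1 i • f i w.2, ?_, ?_⟩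
  · intro a
    have h1 : ∀ᶠ x in 𝓝 (0 : Vec n), ∀ i, ContDiffAt ℝ ∞ (f i) x := eventually_all.2 hf
    have h2 : ∀ᶠ w in 𝓝 (a, (0 : Vec n)), ∀ i, ContDiffAt ℝ ∞ (f i) w.2 :=
      (continuous_snd.tendsto (a, (0 : Vec n))).eventually h1
    filter_upwards [h2] with w hw
    refine ContDiffAt.sum fun i _ => ContDiffAt.smul (f := fun w : TaylorSpace n c r × Vec n =>
      b.repr w.1 i) (g := fun w => f i w.2) ?_ ((hw i).comp w contDiffAt_snd)
    have : ContDiff ℝ ∞ (b.coord i).toContinuousLinearMap := ContinuousLinearMap.contDiff _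
    exact (this.comp contDiff_fst).contDiffAt
  · intro a k
    have hk : ((k : ℕ) : WithTop ℕ∞) ≤ ∞ := by exact_mod_cast le_top
    have e : (fun x => ∑ i, b.repr a i • f i x) = ∑ i, b.repr a i • f i := by
      ext x; simp
    simp only
    rw [e, iteratedFDeriv_sum_apply (f := fun i => b.repr a i • f i)
      fun i _ => ((hf i).self.of_le hk).const_smul (b.repr a i)]
    have : DerivFamily.coeff k a.1 = ∑ i, b.repr a i • DerivFamily.coeff k (b i).1 := by
      let L := (DerivFamily.coeff k).comp (TaylorSpace n c r).subtype
      have h : L a = ∑ i, b.repr a i • L (b i) := by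
        conv_lhs => rw [← b.sum_repr a]
        rw [map_sum]
        exact Finset.sum_congr rfl fun i _ => map_smul _ _ _
      exact h
    rw [this]
    refine Finset.sum_congr rfl fun i _ => ?_
    rw [hbf, iteratedFDeriv_const_smul_apply ((hf i).self.of_le hk)]

/-- A family of maps with prescribed jets at `0`. -/
def taylorMap (n c r : ℕ) : TaylorSpace n c r × Vec n → Vec c := (exists_taylorMap n c r).choose

variable {n c r : ℕ}

lemma smoothNear_taylorMap (a : TaylorSpace n c r) : SmoothNear (taylorMap n c r) (a, 0) :=
  (exists_taylorMap n c r).choose_spec.1 a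

lemma smoothNear_taylorMap_right (a : TaylorSpace n c r) :
    SmoothNear (fun x => taylorMap n c r (a, x)) 0 :=
  SmoothNear.comp (f := fun x : Vec n => (a, x)) rfl (smoothNear_taylorMap a)
    (ContDiff.smoothNear (contDiff_const.prodMk contDiff_id) 0)

lemma iteratedFDeriv_taylorMap (a : TaylorSpace n c r) (k : Fin (r + 1)) :
    iteratedFDeriv ℝ k (fun x => taylorMap n c r (a, x)) 0 = DerivFamily.coeff k a.1 :=
  (exists_taylorMap n c r).choose_spec.2 a k

/-- The `r`-jet of a map at `0`. -/
def taylorOf (r : ℕ) (f : Vec n → Vec c) (hf : SmoothNear f 0) : TaylorSpace n c r :=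
  ⟨fun k => iteratedFDeriv ℝ (k : ℕ) f 0, f, hf, fun _ => rfl⟩

lemma jetEqAt_taylorMap (f : Vec n → Vec c) (hf : SmoothNear f 0) :
    JetEqAt r (fun x => taylorMap n c r (taylorOf r f hf, x)) f 0 := fun k hk =>
  iteratedFDeriv_taylorMap (taylorOf r f hf) ⟨k, Nat.lt_succ_of_le hk⟩

lemma eq_of_jetEqAt {a b : TaylorSpace n c r}
    (h : JetEqAt r (fun x => taylorMap n c r (a, x)) (fun x => taylorMap n c r (b, x)) 0) :
    a = b := by
  ext1
  refine DerivFamily.ext fun k => ?_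
  rw [← iteratedFDeriv_taylorMap a k, ← iteratedFDeriv_taylorMap b k]
  exact h k (Nat.le_of_lt_succ k.2)

end Taylor

section Jets

variable {V : Type*} [NormedAddCommGroup V] [NormedSpace ℝ V]
  {H : Type*} [TopologicalSpace H] (I : ModelWithCorners ℝ V H)
  (F : Type*) [TopologicalSpace F] [ChartedSpace H F] (n : ℕ)

/-- A parametrized germ of an `n`-dimensional embedded submanifold of `F`: a map `ℝⁿ → F` that is
smooth near `0` and an immersion at `0`. Its values near `0` run through a submanifold; only its
germ at `0` matters. -/
structure ImmGerm where
  toFun : Vec n → F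
  smooth : ∀ᶠ x in 𝓝 (0 : Vec n), ContMDiffAt 𝓘(ℝ, Vec n) I ∞ toFun x
  immersion : Injective (mfderiv 𝓘(ℝ, Vec n) I toFun 0)

instance : CoeFun (ImmGerm I F n) (fun _ => Vec n → F) := ⟨ImmGerm.toFun⟩

variable {I F n}

/-- A local diffeomorphism of `ℝⁿ` at `0` that fixes `0`. -/
structure IsReparam (φ : Vec n → Vec n) : Prop where
  smooth : SmoothNear φ 0
  map_zero : φ 0 = 0
  injective : Injective (fderiv ℝ φ 0)

/-- Contact of order `r`: after a change of parameters, the two maps have the same value and the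
same derivatives up to order `r` at `0`, read in a chart around the common value. -/
def ImmGerm.Contact (r : ℕ) (s s' : ImmGerm I F n) : Prop :=
  s 0 = s' 0 ∧ ∃ φ : Vec n → Vec n, IsReparam φ ∧
    JetEqAt r (extChartAt I (s 0) ∘ s ∘ φ) (extChartAt I (s 0) ∘ s') 0

lemma IsReparam.id : IsReparam (id : Vec n → Vec n) where
  smooth := ContDiff.smoothNear contDiff_id 0
  map_zero := rfl
  injective := by rw [fderiv_id]; exact injective_id

lemma IsReparam.comp {φ ψ : Vec n → Vec n} (hφ : IsReparam φ) (hψ : IsReparam ψ) :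
    IsReparam (φ ∘ ψ) where
  smooth := SmoothNear.comp hψ.map_zero hφ.smooth hψ.smooth
  map_zero := by simp [hφ.map_zero, hψ.map_zero]
  injective := by
    have h1 := hφ.smooth.self.differentiableAt (by simp)
    have h2 := hψ.smooth.self.differentiableAt (by simp)
    rw [← hψ.map_zero] at h1
    rw [fderiv_comp 0 h1 h2, hψ.map_zero]
    exact hφ.injective.comp hψ.injective

lemma IsReparam.exists_inverse {φ : Vec n → Vec n} (hφ : IsReparam φ) :
    ∃ χ, IsReparam χ ∧ (∀ᶠ y in 𝓝 0, φ (χ y) = y) ∧ (∀ᶠ x in 𝓝 0, χ (φ x) = x) := by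
  obtain ⟨χ, h1, h2, h3, h4, h5⟩ := hφ.smooth.exists_inverse hφ.map_zero hφ.injective
  exact ⟨χ, ⟨h1, h2, h5⟩, h3, h4⟩

section
variable [IsManifold I ∞ F] [I.Boundaryless]

lemma ImmGerm.smoothNear_comp {W : Type*} [NormedAddCommGroup W] [NormedSpace ℝ W]
    (s : ImmGerm I F n) {G : F → W} (hG : ∀ᶠ p in 𝓝 (s 0), ContMDiffAt I 𝓘(ℝ, W) ∞ G p) :
    SmoothNear (G ∘ s) 0 := by
  filter_upwards [s.smooth, s.smooth.self_of_nhds.continuousAt.eventually hG] with x h1 h2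
  exact (h2.comp x h1).contDiffAt

lemma eventually_contMDiffAt_extChartAt {c p : F} (h : p ∈ (extChartAt I c).source) :
    ∀ᶠ q in 𝓝 p, ContMDiffAt I 𝓘(ℝ, V) ∞ (extChartAt I c) q := by
  filter_upwards [(isOpen_extChartAt_source c).mem_nhds h] with q hq
  exact contMDiffAt_extChartAt' (by simpa using hq)

lemma contMDiffAt_extChartAt_symm {c : F} {y : V} (h : y ∈ (extChartAt I c).target) :
    ContMDiffAt 𝓘(ℝ, V) I ∞ (extChartAt I c).symm y :=
  (contMDiffOn_extChartAt_symm c).contMDiffAt ((isOpen_extChartAt_target c).mem_nhds h)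

/-- Contact read through an arbitrary smooth map. -/
lemma ImmGerm.jetEqAt_comp {W : Type*} [NormedAddCommGroup W] [NormedSpace ℝ W] {r : ℕ}
    {s s' : ImmGerm I F n} (h0 : s 0 = s' 0) {φ : Vec n → Vec n} (hφ : IsReparam φ)
    (h : JetEqAt r (extChartAt I (s 0) ∘ s ∘ φ) (extChartAt I (s 0) ∘ s') 0)
    {G : F → W} (hG : ∀ᶠ p in 𝓝 (s 0), ContMDiffAt I 𝓘(ℝ, W) ∞ G p) :
    JetEqAt r (G ∘ s ∘ φ) (G ∘ s') 0 := by
  set e := extChartAt I (s 0) with he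
  have hs : SmoothNear (e ∘ s) 0 :=
    s.smoothNear_comp (eventually_contMDiffAt_extChartAt (mem_extChartAt_source _))
  have hs' : SmoothNear (e ∘ s') 0 :=
    s'.smoothNear_comp (h0 ▸ eventually_contMDiffAt_extChartAt (mem_extChartAt_source _))
  have hK : ContDiffAt ℝ ∞ (G ∘ e.symm) (e (s 0)) := by
    apply ContMDiffAt.contDiffAt
    refine ContMDiffAt.comp (I' := I) _ ?_ (contMDiffAt_extChartAt_symm (mem_extChartAt_target _))
    rw [extChartAt_to_inv]; exact hG.self_of_nhds
  have hsφ : ContDiffAt ℝ ∞ (e ∘ s ∘ φ) 0 :=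
    (SmoothNear.comp (g := e ∘ s) hφ.map_zero hs hφ.smooth).self
  have k1 : JetEqAt r ((G ∘ e.symm) ∘ (e ∘ s ∘ φ)) ((G ∘ e.symm) ∘ (e ∘ s')) 0 :=
    JetEqAt.comp (y := e (s 0)) (by simp [hφ.map_zero]) hsφ hs'.self hK hK h (JetEqAt.refl _ _ _)
  have src : ∀ᶠ p in 𝓝 (s 0), e.symm (e p) = p := by
    filter_upwards [(isOpen_extChartAt_source (I := I) (s 0)).mem_nhds (mem_extChartAt_source _)]
      with p hp using e.left_inv hp
  have c1 : Tendsto (s ∘ φ) (𝓝 0) (𝓝 (s 0)) := by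
    have a := s.smooth.self_of_nhds.continuousAt
    have b := hφ.smooth.self.continuousAt
    have := ContinuousAt.comp (g := s) (f := φ) (x := 0) (by rw [hφ.map_zero]; exact a) b
    simpa [ContinuousAt, hφ.map_zero] using this
  have c2 : Tendsto s' (𝓝 0) (𝓝 (s 0)) := by
    rw [h0]; exact s'.smooth.self_of_nhds.continuousAt
  refine ((JetEqAt.of_eventuallyEq ?_).trans k1).trans (JetEqAt.of_eventuallyEq ?_)
  · filter_upwards [c1.eventually src] with x hx
    simp only [comp_apply] at hx ⊢
    rw [hx]
  · filter_upwards [c2.eventually src] with x hx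
    simp only [comp_apply] at hx ⊢
    rw [hx]

lemma ImmGerm.contact_refl (r : ℕ) (s : ImmGerm I F n) : s.Contact r s :=
  ⟨rfl, _root_.id, IsReparam.id, JetEqAt.refl _ _ _⟩

lemma ImmGerm.Contact.symm {r : ℕ} {s s' : ImmGerm I F n} (h : s.Contact r s') :
    s'.Contact r s := by
  obtain ⟨h0, φ, hφ, h⟩ := h
  obtain ⟨χ, hχ, h1, h2⟩ := hφ.exists_inverse
  refine ⟨h0.symm, χ, hχ, ?_⟩
  rw [← h0]
  have hs : SmoothNear (extChartAt I (s 0) ∘ s) 0 :=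
    s.smoothNear_comp (eventually_contMDiffAt_extChartAt (mem_extChartAt_source _))
  have hs' : SmoothNear (extChartAt I (s 0) ∘ s') 0 :=
    s'.smoothNear_comp (h0 ▸ eventually_contMDiffAt_extChartAt (mem_extChartAt_source _))
  have hsφ : SmoothNear (extChartAt I (s 0) ∘ s ∘ φ) 0 :=
    SmoothNear.comp (g := extChartAt I (s 0) ∘ s) hφ.map_zero hs hφ.smooth
  have := JetEqAt.comp (f := χ) (f' := χ) (x := 0) hχ.map_zero hχ.smooth.self hχ.smooth.self
    hs'.self hsφ.self (JetEqAt.refl _ _ _) h.symm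
  refine this.trans (JetEqAt.of_eventuallyEq ?_)
  filter_upwards [h1] with y hy
  simp [hy]

lemma ImmGerm.Contact.trans {r : ℕ} {s s' s'' : ImmGerm I F n} (h : s.Contact r s')
    (h' : s'.Contact r s'') : s.Contact r s'' := by
  obtain ⟨h0, φ, hφ, h⟩ := h
  obtain ⟨h0', φ', hφ', h'⟩ := h'
  refine ⟨h0.trans h0', φ ∘ φ', hφ.comp hφ', ?_⟩
  have hs : SmoothNear (extChartAt I (s 0) ∘ s) 0 :=
    s.smoothNear_comp (eventually_contMDiffAt_extChartAt (mem_extChartAt_source _))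
  have hs' : SmoothNear (extChartAt I (s 0) ∘ s') 0 :=
    s'.smoothNear_comp (h0 ▸ eventually_contMDiffAt_extChartAt (mem_extChartAt_source _))
  have hsφ : SmoothNear (extChartAt I (s 0) ∘ s ∘ φ) 0 :=
    SmoothNear.comp (g := extChartAt I (s 0) ∘ s) hφ.map_zero hs hφ.smooth
  have := JetEqAt.comp (f := φ') (f' := φ') (x := 0) hφ'.map_zero hφ'.smooth.self hφ'.smooth.self
    hsφ.self hs'.self (JetEqAt.refl _ _ _) h
  rw [h0] at this ⊢
  exact this.trans h'

variable (I F n) in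
/-- Contact of order `r` as an equivalence relation. -/
def contactSetoid (r : ℕ) : Setoid (ImmGerm I F n) where
  r := ImmGerm.Contact r
  iseqv := ⟨ImmGerm.contact_refl r, ImmGerm.Contact.symm, ImmGerm.Contact.trans⟩

variable (I F n) in
/-- The space `Jʳ(F, n)` of `r`-jets of `n`-dimensional submanifolds of `F`. -/
def Jet (r : ℕ) : Type _ := Quotient (contactSetoid I F n r)

/-- The `r`-jet at `s 0` of the submanifold parametrized by `s`. -/
def Jet.mk (r : ℕ) (s : ImmGerm I F n) : Jet I F n r := Quotient.mk (contactSetoid I F n r) s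

lemma Jet.mk_eq_iff {r : ℕ} {s s' : ImmGerm I F n} :
    Jet.mk r s = Jet.mk r s' ↔ s.Contact r s' := Quotient.eq (r := contactSetoid I F n r)

/-! ### Coordinates on jet spaces -/

/-- Divided coordinates: a chart of `F` followed by a linear splitting of the model space. -/
def dividedChart {q : ℕ} (c : F) (A : V ≃L[ℝ] Vec n × Vec q) : PartialEquiv F (Vec n × Vec q) :=
  (extChartAt I c).transEquiv A.toEquiv

section
variable {q : ℕ} {c : F} {A : V ≃L[ℝ] Vec n × Vec q}

lemma dividedChart_apply (p : F) : dividedChart (I := I) c A p = A (extChartAt I c p) := rfl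

lemma dividedChart_source : (dividedChart (I := I) c A).source = (extChartAt I c).source := rfl

lemma isOpen_dividedChart_source : IsOpen (dividedChart (I := I) c A).source :=
  isOpen_extChartAt_source c

lemma isOpen_dividedChart_target : IsOpen (dividedChart (I := I) c A).target :=
  (isOpen_extChartAt_target (I := I) c).preimage A.symm.continuous

lemma eventually_contMDiffAt_dividedChart {p : F} (h : p ∈ (dividedChart (I := I) c A).source) :
    ∀ᶠ q' in 𝓝 p, ContMDiffAt I 𝓘(ℝ, Vec n × Vec q) ∞ (dividedChart (I := I) c A) q' := by
  filter_upwards [eventually_contMDiffAt_extChartAt (I := I) (c := c) h] with q' hq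
  exact (A.contDiff.contMDiff.contMDiffAt (x := extChartAt I c q')).comp q' hq

lemma contMDiffAt_dividedChart_symm {y : Vec n × Vec q}
    (h : y ∈ (dividedChart (I := I) c A).target) :
    ContMDiffAt 𝓘(ℝ, Vec n × Vec q) I ∞ (dividedChart (I := I) c A).symm y :=
  ContMDiffAt.comp (I' := 𝓘(ℝ, V)) (g := (extChartAt I c).symm) (f := A.symm) y
    (contMDiffAt_extChartAt_symm h) (A.symm.contDiff.contMDiff.contMDiffAt (x := y))

/-- Contact can be tested in divided coordinates. -/
lemma ImmGerm.Contact.dividedChart {r : ℕ} {s s' : ImmGerm I F n} (h : s.Contact r s')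
    (hs : s 0 ∈ (dividedChart (I := I) c A).source) :
    ∃ φ, IsReparam φ ∧
      JetEqAt r (GrassmannJet.dividedChart (I := I) c A ∘ s ∘ φ)
        (GrassmannJet.dividedChart (I := I) c A ∘ s') 0 := by
  obtain ⟨h0, φ, hφ, h⟩ := h
  exact ⟨φ, hφ, ImmGerm.jetEqAt_comp h0 hφ h (eventually_contMDiffAt_dividedChart hs)⟩

lemma ImmGerm.contact_of_dividedChart {r : ℕ} {s s' : ImmGerm I F n}
    (hs : s 0 ∈ (GrassmannJet.dividedChart (I := I) c A).source)
    (hs' : s' 0 ∈ (GrassmannJet.dividedChart (I := I) c A).source)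
    {φ : Vec n → Vec n} (hφ : IsReparam φ)
    (h : JetEqAt r (GrassmannJet.dividedChart (I := I) c A ∘ s ∘ φ)
      (GrassmannJet.dividedChart (I := I) c A ∘ s') 0) : s.Contact r s' := by
  set e := GrassmannJet.dividedChart (I := I) c A with he
  have h0 : s 0 = s' 0 := by
    have := h.eq
    simp only [comp_apply, hφ.map_zero] at this
    exact e.injOn hs hs' this
  refine ⟨h0, φ, hφ, ?_⟩
  have t1 : SmoothNear (e ∘ s) 0 := s.smoothNear_comp (eventually_contMDiffAt_dividedChart hs)
  have t2 : SmoothNear (e ∘ s') 0 := s'.smoothNear_comp (eventually_contMDiffAt_dividedChart hs')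
  have t3 : SmoothNear (e ∘ s ∘ φ) 0 := SmoothNear.comp (g := e ∘ s) hφ.map_zero t1 hφ.smooth
  have hK : ContDiffAt ℝ ∞ (extChartAt I (s 0) ∘ e.symm) (e (s 0)) := by
    apply ContMDiffAt.contDiffAt
    refine ContMDiffAt.comp (I' := I) _ ?_ (contMDiffAt_dividedChart_symm (e.map_source hs))
    rw [show (GrassmannJet.dividedChart (I := I) c A).symm (e (s 0)) = s 0 from e.left_inv hs]
    exact contMDiffAt_extChartAt
  have k1 := JetEqAt.comp (y := e (s 0)) (by simp [hφ.map_zero]) t3.self t2.self hK hK h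
    (JetEqAt.refl _ _ _)
  have src : ∀ᶠ p in 𝓝 (s 0), e.symm (e p) = p := by
    filter_upwards [(isOpen_dividedChart_source (I := I)).mem_nhds hs] with p hp
      using e.left_inv hp
  have c1 : Tendsto (s ∘ φ) (𝓝 0) (𝓝 (s 0)) := by
    have a := s.smooth.self_of_nhds.continuousAt
    have b := hφ.smooth.self.continuousAt
    have := ContinuousAt.comp (g := s) (f := φ) (x := 0) (by rw [hφ.map_zero]; exact a) b
    simpa [ContinuousAt, hφ.map_zero] using this
  have c2 : Tendsto s' (𝓝 0) (𝓝 (s 0)) := by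
    rw [h0]; exact s'.smooth.self_of_nhds.continuousAt
  refine ((JetEqAt.of_eventuallyEq ?_).trans k1).trans (JetEqAt.of_eventuallyEq ?_)
  · filter_upwards [c1.eventually src] with x hx
    simp only [comp_apply] at hx ⊢
    rw [hx]
  · filter_upwards [c2.eventually src] with x hx
    simp only [comp_apply] at hx ⊢
    rw [hx]

/-- The graph, in divided coordinates, of a map `f` near the point `x₀ ∈ ℝⁿ`. -/
def graphMap (c : F) (A : V ≃L[ℝ] Vec n × Vec q) (x₀ : Vec n) (f : Vec n → Vec q) : Vec n → F :=
  fun x => (dividedChart (I := I) c A).symm (x₀ + x, f x)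

lemma dividedChart_graphMap {x₀ : Vec n} {f : Vec n → Vec q} (hf : SmoothNear f 0)
    (h : (x₀, f 0) ∈ (dividedChart (I := I) c A).target) :
    ∀ᶠ x in 𝓝 (0 : Vec n), (x₀ + x, f x) ∈ (dividedChart (I := I) c A).target ∧
      dividedChart (I := I) c A (graphMap (I := I) c A x₀ f x) = (x₀ + x, f x) := by
  have hc : ContinuousAt (fun x => (x₀ + x, f x)) (0 : Vec n) :=
    (continuousAt_const.add continuousAt_id).prodMk hf.self.continuousAt
  have : ∀ᶠ x in 𝓝 (0 : Vec n), (x₀ + x, f x) ∈ (dividedChart (I := I) c A).target :=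
    hc.eventually (isOpen_dividedChart_target.mem_nhds (by simpa using h))
  filter_upwards [this] with x hx
  exact ⟨hx, (dividedChart (I := I) c A).right_inv hx⟩

/-- The graph of a smooth map, as a germ of a submanifold. -/
def graphGerm (c : F) (A : V ≃L[ℝ] Vec n × Vec q) (x₀ : Vec n) (f : Vec n → Vec q)
    (hf : SmoothNear f 0) (h : (x₀, f 0) ∈ (dividedChart (I := I) c A).target) :
    ImmGerm I F n where
  toFun := graphMap (I := I) c A x₀ f
  smooth := by
    filter_upwards [dividedChart_graphMap hf h, hf] with x h1 h2
    have : ContDiffAt ℝ ∞ (fun x => (x₀ + x, f x)) x :=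
      (contDiffAt_const.add contDiffAt_id).prodMk h2
    exact ContMDiffAt.comp x (contMDiffAt_dividedChart_symm h1.1) this.contMDiffAt
  immersion := by
    have hx : ContDiffAt ℝ ∞ (fun x => (x₀ + x, f x)) 0 :=
      (contDiffAt_const.add contDiffAt_id).prodMk hf.self
    have h' : (x₀ + 0, f 0) ∈ (dividedChart (I := I) c A).target := by simpa using h
    have m1 : ContMDiffAt 𝓘(ℝ, Vec n) I ∞ (graphMap (I := I) c A x₀ f) 0 :=
      ContMDiffAt.comp (0 : Vec n) (contMDiffAt_dividedChart_symm h') hx.contMDiffAt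
    have hsrc : graphMap (I := I) c A x₀ f 0 ∈ (dividedChart (I := I) c A).source :=
      (dividedChart (I := I) c A).map_target h'
    have m2 := (eventually_contMDiffAt_dividedChart hsrc).self_of_nhds
    have d1 := (m1.mdifferentiableAt (by simp)).hasMFDerivAt
    have d2 := (m2.mdifferentiableAt (by simp)).hasMFDerivAt
    have d3 := (d2.comp 0 d1).hasFDerivAt
    have e : (fun x => (x₀ + x, f x)) =ᶠ[𝓝 0]
        (dividedChart (I := I) c A ∘ graphMap (I := I) c A x₀ f) :=
      (dividedChart_graphMap hf h).mono fun x hx => hx.2.symm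
    have d4 := d3.congr_of_eventuallyEq e
    have d5 := d4.fst
    have d6 : HasFDerivAt (fun x : Vec n => x₀ + x) (ContinuousLinearMap.id ℝ (Vec n)) 0 :=
      (hasFDerivAt_id (0 : Vec n)).const_add x₀
    have d7 := d5.unique d6
    intro u v huv
    have hu := congrArg (fun L => L u) d7
    have hv := congrArg (fun L => L v) d7
    have : ∀ w : Vec n, ((mfderiv I 𝓘(ℝ, Vec n × Vec q) (dividedChart (I := I) c A)
      (graphMap (I := I) c A x₀ f 0)) (mfderiv 𝓘(ℝ, Vec n) I (graphMap (I := I) c A x₀ f) 0 w)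
        : Vec n × Vec q).1 = w := fun w => congrArg (fun L => L w) d7
    rw [← this u, ← this v]
    exact congrArg _ (congrArg _ huv)

end

/-- The coordinate space of `Jʳ` with fibre coordinates in codimension `q`: the independent
variables, and the derivatives of order at most `r` of the dependent ones. -/
abbrev JetModel (n q r : ℕ) := Vec n × TaylorSpace n q r

section
variable {q r : ℕ} {c c' : F} {A A' : V ≃L[ℝ] Vec n × Vec q}

/-- The map with derivatives prescribed by the coordinates `z`. -/
def JetModel.map (z : JetModel n q r) : Vec n → Vec q := fun x => taylorMap n q r (z.2, x)

lemma JetModel.smoothNear_map (z : JetModel n q r) : SmoothNear z.map 0 :=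
  smoothNear_taylorMap_right z.2

/-- The derivatives at `0` of a map, as a point of `TaylorSpace`. -/
def taylorOf' (r : ℕ) (f : Vec n → Vec q) : TaylorSpace n q r :=
  open Classical in if h : SmoothNear f 0 then taylorOf r f h else 0

lemma jetEqAt_taylorOf' {f : Vec n → Vec q} (hf : SmoothNear f 0) (x₀ : Vec n) :
    JetEqAt r (JetModel.map (x₀, taylorOf' r f)) f 0 := by
  unfold taylorOf'
  rw [dif_pos hf]
  exact jetEqAt_taylorMap f hf

lemma smoothNear_taylorOf' {P : Type*} [NormedAddCommGroup P] [NormedSpace ℝ P]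
    {K : P × Vec n → Vec q} {p : P} (hK : SmoothNear K (p, 0)) :
    SmoothNear (fun p => taylorOf' r (fun x => K (p, x))) p := by
  obtain ⟨L, hL⟩ := LinearMap.exists_leftInverse_of_injective (TaylorSpace n q r).subtype
    (Submodule.ker_subtype _)
  have h1 : SmoothNear (fun p => ((fun k => iteratedFDeriv ℝ (k : ℕ) (fun x => K (p, x)) 0 :
      DerivFamily n q r))) p := by
    have : ∀ k : Fin (r + 1), SmoothNear (fun p => iteratedFDeriv ℝ (k : ℕ) (fun x => K (p, x)) 0) p :=
      fun k => hK.iteratedFDeriv_param k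
    filter_upwards [eventually_all.2 this] with p hp
    exact contDiffAt_pi.2 hp
  have h2 : SmoothNear (fun p => L ((fun k => iteratedFDeriv ℝ (k : ℕ) (fun x => K (p, x)) 0 :
      DerivFamily n q r))) p := by
    filter_upwards [h1] with p hp
    exact (LinearMap.toContinuousLinearMap L).contDiff.contDiffAt.comp p hp
  refine h2.congr ?_
  have c : ContinuousAt (fun p : P => (p, (0 : Vec n))) p := by fun_prop
  filter_upwards [c.eventually (eventually_eventually_nhds.2 hK)] with p hp
  have hs : SmoothNear (fun x => K (p, x)) 0 :=
    SmoothNear.comp (f := fun x : Vec n => (p, x)) rfl hp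
      (ContDiff.smoothNear (contDiff_const.prodMk contDiff_id) 0)
  unfold taylorOf'
  rw [dif_pos hs]
  exact congrArg (fun f => f (taylorOf r _ hs)) hL

/-- The range of the coordinates on jet space given by divided coordinates. -/
def jetTarget (r : ℕ) (c : F) (A : V ≃L[ℝ] Vec n × Vec q) : Set (JetModel n q r) :=
  {z | (z.1, z.map 0) ∈ (dividedChart (I := I) c A).target}

lemma isOpen_jetTarget : IsOpen (jetTarget (I := I) r c A) := by
  have : Continuous fun z : JetModel n q r => (z.1, z.map 0) := by
    refine continuous_fst.prodMk (continuous_iff_continuousAt.2 fun z => ?_)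
    have h := (smoothNear_taylorMap (n := n) (c := q) (r := r) z.2).self.continuousAt
    exact ContinuousAt.comp (f := fun z : JetModel n q r => (z.2, (0 : Vec n))) h (by fun_prop)
  exact isOpen_dividedChart_target.preimage this

/-- The jet with given coordinates. -/
def graphJet (r : ℕ) (c : F) (A : V ≃L[ℝ] Vec n × Vec q) (z : JetModel n q r) : Jet I F n r :=
  open Classical in
  if h : z ∈ jetTarget (I := I) r c A then
    Jet.mk r (graphGerm c A z.1 z.map z.smoothNear_map h)
  else
    Jet.mk r (graphGerm c A (dividedChart (I := I) c A c).1 (fun _ => (dividedChart (I := I) c A c).2)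
      (ContDiff.smoothNear contDiff_const 0)
      ((dividedChart (I := I) c A).map_source (mem_extChartAt_source c)))

lemma graphGerm_zero_mem {x₀ : Vec n} {f : Vec n → Vec q} (hf : SmoothNear f 0)
    (h : (x₀, f 0) ∈ (dividedChart (I := I) c A).target) :
    graphGerm c A x₀ f hf h 0 ∈ (dividedChart (I := I) c A).source := by
  apply (dividedChart (I := I) c A).map_target
  simpa using h

lemma mk_graphGerm {x₀ : Vec n} {f : Vec n → Vec q} (hf : SmoothNear f 0)
    (h : (x₀, f 0) ∈ (dividedChart (I := I) c A).target) :
    (x₀, taylorOf' r f) ∈ jetTarget (I := I) r c A ∧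
      Jet.mk r (graphGerm c A x₀ f hf h) = graphJet r c A (x₀, taylorOf' r f) := by
  have hj := jetEqAt_taylorOf' (r := r) hf x₀
  have hm : (x₀, taylorOf' r f) ∈ jetTarget (I := I) r c A := by
    show (x₀, JetModel.map (x₀, taylorOf' r f) 0) ∈ (dividedChart (I := I) c A).target
    rw [hj.eq]; exact h
  refine ⟨hm, ?_⟩
  unfold graphJet
  rw [dif_pos hm, Jet.mk_eq_iff]
  refine ImmGerm.contact_of_dividedChart (graphGerm_zero_mem hf h) (graphGerm_zero_mem _ hm)
    IsReparam.id ?_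
  refine (JetEqAt.of_eventuallyEq (g := fun x => (x₀ + x, f x)) ?_).trans
    (JetEqAt.trans ?_ (JetEqAt.of_eventuallyEq
      (f := fun x => (x₀ + x, JetModel.map (x₀, taylorOf' r f) x)) ?_))
  · exact (dividedChart_graphMap hf h).mono fun x hx => hx.2
  · exact JetEqAt.prodMk (contDiffAt_const.add contDiffAt_id) (contDiffAt_const.add contDiffAt_id)
      hf.self (JetModel.smoothNear_map _).self (JetEqAt.refl _ _ _) hj.symm
  · exact (dividedChart_graphMap (JetModel.smoothNear_map _) hm).mono fun x hx => hx.2.symm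

lemma contact_graphGerm {z : JetModel n q r} (hz : z ∈ jetTarget (I := I) r c A)
    {φ : Vec n → Vec n} (hφ : IsReparam φ) :
    (dividedChart (I := I) c A ∘ graphGerm c A z.1 z.map z.smoothNear_map hz ∘ φ)
      =ᶠ[𝓝 0] fun x => (z.1 + φ x, z.map (φ x)) := by
  have t : Tendsto φ (𝓝 0) (𝓝 0) := by
    have := hφ.smooth.self.continuousAt
    rwa [ContinuousAt, hφ.map_zero] at this
  filter_upwards [t.eventually (dividedChart_graphMap z.smoothNear_map hz)] with x hx using hx.2

lemma injOn_graphJet : InjOn (graphJet (I := I) r c A) (jetTarget (I := I) r c A) := by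
  intro z hz z' hz' h
  unfold graphJet at h
  rw [dif_pos hz, dif_pos hz', Jet.mk_eq_iff] at h
  obtain ⟨φ, hφ, h⟩ := h.dividedChart (c := c) (A := A) (graphGerm_zero_mem _ hz)
  have h := ((JetEqAt.of_eventuallyEq (contact_graphGerm hz hφ)).symm.trans h).trans
    (JetEqAt.of_eventuallyEq (contact_graphGerm hz' IsReparam.id))
  have s1 : SmoothNear (fun x => z.1 + φ x) 0 :=
    hφ.smooth.mono fun x hx => contDiffAt_const.add hx
  have s2 : SmoothNear (z.map ∘ φ) 0 := SmoothNear.comp hφ.map_zero z.smoothNear_map hφ.smooth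
  have s3 : SmoothNear (fun x : Vec n => z'.1 + x) 0 :=
    ContDiff.smoothNear (contDiff_const.add contDiff_id) 0
  have a1 : JetEqAt r (fun x => z.1 + φ x) (fun x => z'.1 + x) 0 :=
    JetEqAt.comp (g := Prod.fst) (g' := Prod.fst) rfl (s1.prodMk s2).self
      (s3.prodMk z'.smoothNear_map).self contDiffAt_fst contDiffAt_fst h (JetEqAt.refl _ _ _)
  have a2 : JetEqAt r (z.map ∘ φ) z'.map 0 :=
    JetEqAt.comp (g := Prod.snd) (g' := Prod.snd) rfl (s1.prodMk s2).self
      (s3.prodMk z'.smoothNear_map).self contDiffAt_snd contDiffAt_snd h (JetEqAt.refl _ _ _)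
  have e1 : z.1 = z'.1 := by simpa [hφ.map_zero] using a1.eq
  have a3 : JetEqAt r φ id 0 := by
    have := JetEqAt.comp (g := fun y => y - z.1) (g' := fun y => y - z.1) (y := z.1 + φ 0)
      (f := fun x => z.1 + φ x) rfl
      s1.self s3.self (contDiffAt_id.sub contDiffAt_const) (contDiffAt_id.sub contDiffAt_const)
      a1 (JetEqAt.refl _ _ _)
    have : JetEqAt r (fun x => φ x) (fun x => x) 0 := by simpa [comp_def, e1] using this
    exact this
  have a4 : JetEqAt r (z.map ∘ φ) (z.map ∘ id) 0 :=
    JetEqAt.comp hφ.map_zero hφ.smooth.self contDiffAt_id z.smoothNear_map.self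
      z.smoothNear_map.self a3 (JetEqAt.refl _ _ _)
  exact Prod.ext e1 (eq_of_jetEqAt (a4.symm.trans a2))

/-- A submanifold that is transverse to the fibres of divided coordinates is a graph. -/
lemma exists_graphJet {s : ImmGerm I F n} (hs : s 0 ∈ (dividedChart (I := I) c A).source)
    (hi : Injective (fderiv ℝ (fun x => (dividedChart (I := I) c A (s x)).1) 0)) :
    ∃ z ∈ jetTarget (I := I) r c A, graphJet r c A z = Jet.mk r s := by
  set e := dividedChart (I := I) c A with he
  have hG : SmoothNear (e ∘ s) 0 := s.smoothNear_comp (eventually_contMDiffAt_dividedChart hs)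
  have h1 : SmoothNear (fun x => (e (s x)).1) 0 := hG.mono fun x hx => hx.fst
  have h2 : SmoothNear (fun x => (e (s x)).2) 0 := hG.mono fun x hx => hx.snd
  set x₀ := (e (s 0)).1 with hx₀
  have hψ : IsReparam fun x => (e (s x)).1 - x₀ :=
    { smooth := h1.mono fun x hx => hx.sub contDiffAt_const
      map_zero := by simp [hx₀]
      injective := by rw [fderiv_sub_const]; exact hi }
  obtain ⟨χ, hχ, i1, -⟩ := hψ.exists_inverse
  have hf : SmoothNear (fun x => (e (s (χ x))).2) 0 :=
    SmoothNear.comp (g := fun x => (e (s x)).2) hχ.map_zero h2 hχ.smooth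
  have ht : (x₀, (e (s (χ 0))).2) ∈ e.target := by
    rw [hχ.map_zero]; exact e.map_source hs
  obtain ⟨m1, m2⟩ := mk_graphGerm (r := r) hf ht
  refine ⟨_, m1, m2.symm.trans ?_⟩
  rw [Jet.mk_eq_iff]
  refine ImmGerm.Contact.symm (ImmGerm.contact_of_dividedChart hs (graphGerm_zero_mem hf ht) hχ ?_)
  refine (JetEqAt.of_eventuallyEq (g := fun x => (x₀ + x, (e (s (χ x))).2)) ?_).trans
    (JetEqAt.of_eventuallyEq ((dividedChart_graphMap hf ht).mono fun x hx => hx.2.symm))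
  filter_upwards [i1] with x hx
  exact Prod.ext (sub_eq_iff_eq_add'.1 hx) rfl

end

section
variable {q r : ℕ} {c c' : F} {A A' : V ≃L[ℝ] Vec n × Vec q}

/-- The change of divided coordinates. -/
lemma contDiffAt_dividedChart_comp_symm {y : Vec n × Vec q}
    (hy : y ∈ (dividedChart (I := I) c A).target)
    (hy' : (dividedChart (I := I) c A).symm y ∈ (dividedChart (I := I) c' A').source) :
    ContDiffAt ℝ ∞ (dividedChart (I := I) c' A' ∘ (dividedChart (I := I) c A).symm) y :=
  ((eventually_contMDiffAt_dividedChart hy').self_of_nhds.comp y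
    (contMDiffAt_dividedChart_symm hy)).contDiffAt

lemma smoothNear_dividedChart_comp_symm {y : Vec n × Vec q}
    (hy : y ∈ (dividedChart (I := I) c A).target)
    (hy' : (dividedChart (I := I) c A).symm y ∈ (dividedChart (I := I) c' A').source) :
    SmoothNear (dividedChart (I := I) c' A' ∘ (dividedChart (I := I) c A).symm) y := by
  have h1 := isOpen_dividedChart_target.mem_nhds hy
  have h2 := (contMDiffAt_dividedChart_symm hy).continuousAt.preimage_mem_nhds
    (isOpen_dividedChart_source.mem_nhds hy')
  filter_upwards [h1, h2] with z hz hz'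
  exact contDiffAt_dividedChart_comp_symm hz hz'

/-- Changes of coordinates on jet space are smooth. -/
lemma exists_transition {z₀ z₁ : JetModel n q r} (h₀ : z₀ ∈ jetTarget (I := I) r c A)
    (h₁ : z₁ ∈ jetTarget (I := I) r c' A')
    (heq : graphJet (I := I) r c A z₀ = graphJet r c' A' z₁) :
    ∃ T : JetModel n q r → JetModel n q r, SmoothNear T z₀ ∧
      ∀ᶠ z in 𝓝 z₀, T z ∈ jetTarget (I := I) r c' A' ∧
        graphJet (I := I) r c' A' (T z) = graphJet r c A z := by
  set D := dividedChart (I := I) c A with hD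
  set D' := dividedChart (I := I) c' A' with hD'
  unfold graphJet at heq
  rw [dif_pos h₀, dif_pos h₁, Jet.mk_eq_iff] at heq
  have hbase := heq.1
  have hsrc : D.symm (z₀.1, z₀.map 0) ∈ D'.source := by
    have : graphGerm c A z₀.1 z₀.map z₀.smoothNear_map h₀ 0 ∈ D'.source := by
      rw [hbase]; exact graphGerm_zero_mem _ h₁
    simpa [graphGerm, graphMap] using this
  have hΨ : SmoothNear (D' ∘ D.symm) (z₀.1, z₀.map 0) := smoothNear_dividedChart_comp_symm h₀ hsrc
  have hin : ∀ᶠ z in 𝓝 z₀, z ∈ jetTarget (I := I) r c A := isOpen_jetTarget.mem_nhds h₀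
  have hmap : SmoothNear (fun w : JetModel n q r × Vec n => w.1.map w.2) (z₀, 0) :=
    SmoothNear.comp (g := taylorMap n q r) (f := fun w : JetModel n q r × Vec n => (w.1.2, w.2)) rfl
      (smoothNear_taylorMap z₀.2) (ContDiff.smoothNear (by fun_prop) _)
  have hc0 : ContinuousAt (fun z : JetModel n q r => (z, (0 : Vec n))) z₀ := by fun_prop
  have hin' : ∀ᶠ z in 𝓝 z₀, D.symm (z.1, z.map 0) ∈ D'.source := by
    have k1 : ContinuousAt (fun z : JetModel n q r => (z.1, z.map 0)) z₀ :=
      continuousAt_fst.prodMk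
        (ContinuousAt.comp (f := fun z : JetModel n q r => (z, (0 : Vec n)))
          (g := fun w : JetModel n q r × Vec n => w.1.map w.2) hmap.self.continuousAt hc0)
    have k2 := ContinuousAt.comp (f := fun z : JetModel n q r => (z.1, z.map 0)) (g := D.symm)
      (contMDiffAt_dividedChart_symm h₀).continuousAt k1
    exact k2.preimage_mem_nhds (isOpen_dividedChart_source.mem_nhds hsrc)
  let G : JetModel n q r × Vec n → Vec n × Vec q := fun w => D' (D.symm (w.1.1 + w.2, w.1.map w.2))
  have hG : SmoothNear G (z₀, 0) :=
    SmoothNear.comp (g := D' ∘ D.symm)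
      (f := fun w : JetModel n q r × Vec n => (w.1.1 + w.2, w.1.map w.2)) (by simp) hΨ
      (SmoothNear.prodMk (ContDiff.smoothNear (by fun_prop) _) hmap)
  have hG1 : SmoothNear (fun w => (G w).1) (z₀, 0) := hG.mono fun x hx => hx.fst
  have hG2 : SmoothNear (fun w => (G w).2) (z₀, 0) := hG.mono fun x hx => hx.snd
  have hmem (z : JetModel n q r) (hz' : D.symm (z.1, z.map 0) ∈ D'.source) : G (z, 0) ∈ D'.target := by
    have := D'.map_source hz'
    simpa [G] using this
  rcases Nat.eq_zero_or_pos r with rfl | hr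
  · -- jets of order zero
    refine ⟨fun z => ((G (z, 0)).1, taylorOf' 0 (fun _ => (G (z, 0)).2)), ?_, ?_⟩
    · have e1 : SmoothNear (fun z => (G (z, 0)).1) z₀ :=
        SmoothNear.comp (g := fun w => (G w).1) rfl hG1
          (ContDiff.smoothNear (contDiff_id.prodMk contDiff_const) _)
      have e2 : SmoothNear (fun w : JetModel n q 0 × Vec n => (G (w.1, 0)).2) (z₀, 0) :=
        SmoothNear.comp (g := fun w => (G w).2)
          (f := fun w : JetModel n q 0 × Vec n => (w.1, (0 : Vec n))) rfl hG2
          (ContDiff.smoothNear (contDiff_fst.prodMk contDiff_const) _)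
      exact e1.prodMk (smoothNear_taylorOf' e2)
    · filter_upwards [hin, hin'] with z hz hz'
      have hf : SmoothNear (fun _ : Vec n => (G (z, 0)).2) 0 := ContDiff.smoothNear contDiff_const 0
      obtain ⟨m1, m2⟩ := mk_graphGerm (I := I) (c := c') (A := A') (r := 0) (x₀ := (G (z, 0)).1)
        hf (hmem z hz')
      refine ⟨m1, m2.symm.trans ?_⟩
      unfold graphJet
      rw [dif_pos hz, Jet.mk_eq_iff]
      refine ImmGerm.contact_of_dividedChart (c := c') (A := A') (graphGerm_zero_mem _ (hmem z hz'))
        (by simpa [graphGerm, graphMap] using hz') IsReparam.id ?_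
      intro k hk
      obtain rfl : k = 0 := by omega
      have v1 := (dividedChart_graphMap hf (hmem z hz')).self_of_nhds.2
      refine ContinuousMultilinearMap.ext fun v => ?_
      rw [iteratedFDeriv_zero_apply, iteratedFDeriv_zero_apply]
      exact v1.trans (by simp [G, graphGerm, graphMap]; rfl)
  · -- jets of positive order
    obtain ⟨φ, hφ, h⟩ := heq.dividedChart (c := c') (A := A')
      (by simpa [graphGerm, graphMap] using hsrc)
    have h := h.trans (JetEqAt.of_eventuallyEq (contact_graphGerm h₁ IsReparam.id))
    have hGx : SmoothNear (fun x => G (z₀, x)) 0 :=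
      SmoothNear.comp (f := fun x : Vec n => (z₀, x)) rfl hG
        (ContDiff.smoothNear (contDiff_const.prodMk contDiff_id) 0)
    have hGφ : SmoothNear (fun x => G (z₀, φ x)) 0 :=
      SmoothNear.comp (g := fun x => G (z₀, x)) hφ.map_zero hGx hφ.smooth
    have s3 : SmoothNear (fun x : Vec n => z₁.1 + x) 0 :=
      ContDiff.smoothNear (contDiff_const.add contDiff_id) 0
    have a1 : JetEqAt r (fun x => (G (z₀, φ x)).1) (fun x => z₁.1 + x) 0 :=
      JetEqAt.comp (f := fun x => G (z₀, φ x)) (g := Prod.fst) (g' := Prod.fst) rfl hGφ.self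
        (s3.prodMk z₁.smoothNear_map).self contDiffAt_fst contDiffAt_fst h (JetEqAt.refl _ _ _)
    have a2 := a1.fderiv_eq hr.ne'
    have hd1 : HasFDerivAt (fun w => (G w).1) (fderiv ℝ (fun w => (G w).1) (z₀, 0)) (z₀, 0) :=
      (hG1.self.differentiableAt (by simp)).hasFDerivAt
    have hdx : HasFDerivAt (fun x => (G (z₀, x)).1)
        ((fderiv ℝ (fun w => (G w).1) (z₀, 0)).comp (ContinuousLinearMap.inr ℝ _ _)) 0 :=
      HasFDerivAt.comp (f := fun x : Vec n => (z₀, x)) 0 hd1 (hasFDerivAt_prodMk_right z₀ 0)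
    set L := (fderiv ℝ (fun w => (G w).1) (z₀, 0)).comp
      (ContinuousLinearMap.inr ℝ (JetModel n q r) (Vec n)) with hL
    have hinj : Injective L := by
      have b1 : HasFDerivAt (fun x => (G (z₀, φ x)).1) (L.comp (fderiv ℝ φ 0)) 0 :=
        HasFDerivAt.comp (f := φ) (g := fun x => (G (z₀, x)).1) 0 (by rw [hφ.map_zero]; exact hdx)
          (hφ.smooth.self.differentiableAt (by simp)).hasFDerivAt
      have b2 : HasFDerivAt (fun x : Vec n => z₁.1 + x) (ContinuousLinearMap.id ℝ (Vec n)) 0 :=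
        (hasFDerivAt_id (0 : Vec n)).const_add _
      rw [b1.fderiv, b2.fderiv] at a2
      have : Surjective (L : Vec n →ₗ[ℝ] Vec n) := fun v =>
        ⟨fderiv ℝ φ 0 v, congrArg (fun M => M v) a2⟩
      exact LinearMap.injective_iff_surjective.2 this
    have hG0 : SmoothNear (fun z => (G (z, 0)).1) z₀ :=
      SmoothNear.comp (g := fun w => (G w).1) rfl hG1
        (ContDiff.smoothNear (contDiff_id.prodMk contDiff_const) _)
    let Φ : JetModel n q r × Vec n → JetModel n q r × Vec n :=
      fun w => (w.1, (G w).1 - (G (w.1, 0)).1)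
    have hΦ : SmoothNear Φ (z₀, 0) := by
      refine SmoothNear.prodMk (ContDiff.smoothNear contDiff_fst _) ?_
      have e : SmoothNear (fun w : JetModel n q r × Vec n => (G (w.1, 0)).1) (z₀, 0) :=
        SmoothNear.comp (g := fun z => (G (z, 0)).1) (f := Prod.fst) rfl hG0
          (ContDiff.smoothNear contDiff_fst _)
      filter_upwards [hG1, e] with w h1 h2 using h1.sub h2
    have hΦ0 (z : JetModel n q r) : Φ (z, 0) = (z, 0) := by simp [Φ]
    have hΦinj : Injective (fderiv ℝ Φ (z₀, 0)) := by
      have d : HasFDerivAt Φ (fderiv ℝ Φ (z₀, 0)) (z₀, 0) :=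
        (hΦ.self.differentiableAt (by simp)).hasFDerivAt
      have d1 : ∀ w, (fderiv ℝ Φ (z₀, 0) w).1 = w.1 := fun w =>
        congrArg (fun M => M w) (d.fst.unique hasFDerivAt_fst)
      have d2 : HasFDerivAt (fun x => (Φ (z₀, x)).2)
          ((ContinuousLinearMap.snd ℝ _ _).comp ((fderiv ℝ Φ (z₀, 0)).comp
            (ContinuousLinearMap.inr ℝ (JetModel n q r) (Vec n)))) 0 :=
        (HasFDerivAt.comp (f := fun x : Vec n => (z₀, x)) 0 d
          (hasFDerivAt_prodMk_right z₀ 0)).snd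
      have d3 := d2.unique (hdx.sub_const (G (z₀, 0)).1)
      rw [injective_iff_map_eq_zero]
      rintro ⟨u, v⟩ huv
      have hu : u = 0 := (d1 (u, v)).symm.trans (by rw [huv]; rfl)
      subst hu
      have hv : L v = 0 := by
        rw [← d3]
        show (fderiv ℝ Φ (z₀, 0) (0, v)).2 = 0
        rw [huv]; rfl
      rw [show v = 0 from hinj (hv.trans (map_zero L).symm)]
      rfl
    obtain ⟨Θ, hΘ, hΘ0, hr1, hr2, -⟩ := hΦ.exists_inverse (hΦ0 z₀) hΦinj
    let K : JetModel n q r × Vec n → Vec q := fun w => (G (Θ w)).2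
    have hK : SmoothNear K (z₀, 0) := SmoothNear.comp (g := fun w => (G w).2) hΘ0 hG2 hΘ
    refine ⟨fun z => ((G (z, 0)).1, taylorOf' r (fun x => K (z, x))),
      hG0.prodMk (smoothNear_taylorOf' hK), ?_⟩
    filter_upwards [hin, hin', hc0.eventually (eventually_eventually_nhds.2 hK),
      hc0.eventually (eventually_eventually_nhds.2 hΘ),
      hc0.eventually (eventually_eventually_nhds.2 hr1), hc0.eventually hr2,
      hc0.eventually hG1] with z hz hz' k1 k2 k3 k4 k5
    have hΘz : Θ (z, 0) = (z, 0) := by rw [hΦ0] at k4; exact k4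
    have cz : ContinuousAt (fun x : Vec n => (z, x)) 0 := by fun_prop
    have hf : SmoothNear (fun x => K (z, x)) 0 :=
      SmoothNear.comp (f := fun x : Vec n => (z, x)) rfl k1
        (ContDiff.smoothNear (contDiff_const.prodMk contDiff_id) 0)
    have hχs : SmoothNear (fun x => (Θ (z, x)).2) 0 :=
      (SmoothNear.comp (f := fun x : Vec n => (z, x)) rfl k2
        (ContDiff.smoothNear (contDiff_const.prodMk contDiff_id) 0)).mono fun x hx => hx.snd
    have hfst : ∀ᶠ x in 𝓝 (0 : Vec n), Θ (z, x) = (z, (Θ (z, x)).2) ∧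
        (G (z, (Θ (z, x)).2)).1 = (G (z, 0)).1 + x := by
      filter_upwards [cz.eventually k3] with x hx
      have p1 : (Θ (z, x)).1 = z := congrArg Prod.fst hx
      have p2 : (G (Θ (z, x))).1 - (G ((Θ (z, x)).1, 0)).1 = x := congrArg Prod.snd hx
      have p3 : Θ (z, x) = (z, (Θ (z, x)).2) := Prod.ext p1 rfl
      refine ⟨p3, ?_⟩
      rw [p1] at p2
      rw [← p3]
      exact sub_eq_iff_eq_add'.1 p2
    have hGz : (G (z, (Θ (z, 0)).2)) = G (z, 0) := by rw [hΘz]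
    have hgt : ((G (z, 0)).1, K (z, 0)) ∈ D'.target := by
      have : K (z, 0) = (G (z, 0)).2 := by simp only [K]; rw [hΘz]
      rw [this]; exact hmem z hz'
    have hχ : IsReparam fun x => (Θ (z, x)).2 :=
      { smooth := hχs
        map_zero := by rw [hΘz]
        injective := by
          have q0 : DifferentiableAt ℝ (fun y => (G (z, y)).1) ((Θ (z, 0)).2) := by
            rw [hΘz]
            exact (ContDiffAt.comp (f := fun y : Vec n => (z, y)) (0 : Vec n) k5
              (contDiffAt_const.prodMk contDiffAt_id)).differentiableAt (by simp)
          have q1 : HasFDerivAt (fun x => (G (z, (Θ (z, x)).2)).1) _ 0 :=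
            HasFDerivAt.comp (f := fun x : Vec n => (Θ (z, x)).2) (g := fun y => (G (z, y)).1) 0
              q0.hasFDerivAt (hχs.self.differentiableAt (by simp)).hasFDerivAt
          have q2 : HasFDerivAt (fun x => (G (z, (Θ (z, x)).2)).1) (ContinuousLinearMap.id ℝ _) 0 :=
            ((hasFDerivAt_id (0 : Vec n)).const_add (G (z, 0)).1).congr_of_eventuallyEq
              (hfst.mono fun x hx => hx.2)
          have q3 := q1.unique q2
          intro u v huv
          have hu := congrArg (fun M => M u) q3
          have hv := congrArg (fun M => M v) q3
          simp only [ContinuousLinearMap.comp_apply, ContinuousLinearMap.id_apply] at hu hv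
          rw [← hu, ← hv, huv] }
    obtain ⟨m1, m2⟩ := mk_graphGerm (I := I) (c := c') (A := A') (r := r) (x₀ := (G (z, 0)).1)
      hf hgt
    refine ⟨m1, m2.symm.trans ?_⟩
    unfold graphJet
    rw [dif_pos hz, Jet.mk_eq_iff]
    refine ImmGerm.Contact.symm (ImmGerm.contact_of_dividedChart (c := c') (A := A')
      (by simpa [graphGerm, graphMap] using hz') (graphGerm_zero_mem hf hgt) hχ ?_)
    refine (JetEqAt.of_eventuallyEq (g := fun x => ((G (z, 0)).1 + x, K (z, x))) ?_).trans
      (JetEqAt.of_eventuallyEq ((dividedChart_graphMap hf hgt).mono fun x hx => hx.2.symm))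
    filter_upwards [hfst] with x hx
    have : K (z, x) = (G (z, (Θ (z, x)).2)).2 := by simp only [K]; rw [← hx.1]
    rw [this, ← hx.2]
    rfl

end

/-- The coordinates on jet space induced by divided coordinates. -/
def jetChart {q : ℕ} (r : ℕ) (c : F) (A : V ≃L[ℝ] Vec n × Vec q) :
    PartialEquiv (Jet I F n r) (JetModel n q r) :=
  ((injOn_graphJet (I := I) (r := r) (c := c) (A := A)).toPartialEquiv
    (graphJet (I := I) r c A) (jetTarget (I := I) r c A)).symm

section
variable {q r : ℕ} {c c' : F} {A A' : V ≃L[ℝ] Vec n × Vec q}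

lemma jetChart_symm (z : JetModel n q r) : (jetChart (I := I) r c A).symm z = graphJet (I := I) r c A z := rfl

lemma jetChart_target : (jetChart (I := I) r c A).target = jetTarget (I := I) r c A := rfl

lemma jetChart_source :
    (jetChart (I := I) r c A).source = graphJet (I := I) r c A '' jetTarget (I := I) r c A := rfl

lemma jetChart_graphJet {z : JetModel n q r} (hz : z ∈ jetTarget (I := I) r c A) :
    jetChart (I := I) r c A (graphJet r c A z) = z :=
  (jetChart (I := I) r c A).right_inv hz

/-- Near each point of its domain, a change of jet coordinates is a smooth map. -/
lemma jetChart_transition {z₀ : JetModel n q r}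
    (h : z₀ ∈ ((jetChart (I := I) r c A).symm.trans (jetChart r c' A')).source) :
    ∃ T : JetModel n q r → JetModel n q r, ContDiffAt ℝ ∞ T z₀ ∧
      ∀ᶠ z in 𝓝 z₀, z ∈ ((jetChart (I := I) r c A).symm.trans (jetChart r c' A')).source ∧
        ((jetChart (I := I) r c A).symm.trans (jetChart r c' A')) z = T z := by
  obtain ⟨h₀, z₁, h₁, he⟩ := h
  obtain ⟨T, hT, hT'⟩ := exists_transition (I := I) h₀ h₁ he.symm
  refine ⟨T, hT.self, ?_⟩
  filter_upwards [hT', (isOpen_jetTarget (I := I)).mem_nhds h₀] with z hz hz'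
  refine ⟨⟨hz', T z, hz.1, hz.2⟩, ?_⟩
  show jetChart r c' A' (graphJet r c A z) = T z
  rw [← hz.2, jetChart_graphJet hz.1]

lemma isOpen_jetChart_trans :
    IsOpen ((jetChart (I := I) r c A).symm.trans (jetChart r c' A')).source := by
  rw [isOpen_iff_mem_nhds]
  intro z hz
  obtain ⟨T, -, h⟩ := jetChart_transition hz
  exact h.mono fun _ h => h.1

lemma contDiffOn_jetChart_trans :
    ContDiffOn ℝ ∞ ((jetChart (I := I) r c A).symm.trans (jetChart r c' A'))
      ((jetChart (I := I) r c A).symm.trans (jetChart r c' A')).source := by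
  intro z hz
  obtain ⟨T, hT, h⟩ := jetChart_transition hz
  exact (hT.congr_of_eventuallyEq (h.mono fun _ h => h.2)).contDiffWithinAt

end

variable [FiniteDimensional ℝ V]

/-- Every jet lies in the domain of some chart. -/
lemma exists_mem_jetChart_source {r : ℕ} (θ : Jet I F n r) :
    ∃ w : F × (V ≃L[ℝ] Vec n × Vec (Module.finrank ℝ V - n)),
      θ ∈ (jetChart (I := I) r w.1 w.2).source := by
  obtain ⟨s, rfl⟩ : ∃ s, Jet.mk r s = θ := Quotient.exists_rep θ
  have hs : SmoothNear (extChartAt I (s 0) ∘ s) 0 :=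
    s.smoothNear_comp (eventually_contMDiffAt_extChartAt (mem_extChartAt_source _))
  set L := fderiv ℝ (extChartAt I (s 0) ∘ s) 0 with hL
  have hLd : HasFDerivAt (extChartAt I (s 0) ∘ s) L 0 :=
    (hs.self.differentiableAt (by simp)).hasFDerivAt
  have hLinj : Injective L := by
    have m1 : MDifferentiableAt 𝓘(ℝ, Vec n) I s 0 :=
      s.smooth.self_of_nhds.mdifferentiableAt (by simp)
    have k1 : HasFDerivAt (extChartAt I (s 0) ∘ s) (mfderiv 𝓘(ℝ, Vec n) I s 0) 0 := by
      have := m1.hasMFDerivAt.2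
      rw [modelWithCornersSelf_coe, range_id] at this
      exact this.hasFDerivAt univ_mem
    rw [hLd.unique k1]
    exact s.immersion
  let Lₗ : Vec n →ₗ[ℝ] V := L
  obtain ⟨W, hW⟩ := Submodule.exists_isCompl (LinearMap.range Lₗ)
  let e₁ : Vec n ≃ₗ[ℝ] LinearMap.range Lₗ := LinearEquiv.ofInjective Lₗ hLinj
  have hdim : Module.finrank ℝ W = Module.finrank ℝ (Vec (Module.finrank ℝ V - n)) := by
    have k1 := Submodule.finrank_add_eq_of_isCompl hW
    have k2 := e₁.finrank_eq
    rw [finrank_euclideanSpace_fin] at k2 ⊢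
    omega
  let e₂ : W ≃ₗ[ℝ] Vec (Module.finrank ℝ V - n) := LinearEquiv.ofFinrankEq _ _ hdim
  let A : V ≃L[ℝ] Vec n × Vec (Module.finrank ℝ V - n) :=
    ((Submodule.prodEquivOfIsCompl _ _ hW).symm.trans
      (e₁.symm.prodCongr e₂)).toContinuousLinearEquiv
  have hA : ∀ v, (A (L v)).1 = v := by
    intro v
    have k1 : (Submodule.prodEquivOfIsCompl _ _ hW).symm (L v) = (e₁ v, 0) :=
      Submodule.prodEquivOfIsCompl_symm_apply_left _ _ hW (e₁ v)
    show e₁.symm ((Submodule.prodEquivOfIsCompl _ _ hW).symm (L v)).1 = v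
    rw [k1]
    simp
  refine ⟨(s 0, A), ?_⟩
  obtain ⟨z, hz, h⟩ := exists_graphJet (I := I) (r := r) (c := s 0) (A := A) (s := s)
    (mem_extChartAt_source _) (by
      have k : HasFDerivAt (fun x => (dividedChart (I := I) (s 0) A (s x)).1)
          ((ContinuousLinearMap.fst ℝ (Vec n) (Vec (Module.finrank ℝ V - n))).comp
            ((A : V →L[ℝ] Vec n × Vec (Module.finrank ℝ V - n)).comp L)) 0 :=
        (A.hasFDerivAt.comp 0 hLd).fst
      rw [k.fderiv]
      intro u v huv
      exact (hA u).symm.trans (huv.trans (hA v)))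
  exact ⟨z, hz, h⟩

variable (I F n) in
/-- The atlas of `Jʳ(F, n)`. -/
def jetSpaceCore (r : ℕ) :
    ChartedSpaceCore (JetModel n (Module.finrank ℝ V - n) r) (Jet I F n r) where
  atlas := range fun w : F × (V ≃L[ℝ] Vec n × Vec (Module.finrank ℝ V - n)) =>
    jetChart r w.1 w.2
  chartAt θ := jetChart r (exists_mem_jetChart_source θ).choose.1
    (exists_mem_jetChart_source θ).choose.2
  mem_chart_source θ := (exists_mem_jetChart_source θ).choose_spec
  chart_mem_atlas θ := ⟨_, rfl⟩
  open_source := by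
    rintro _ _ ⟨w, rfl⟩ ⟨w', rfl⟩
    exact isOpen_jetChart_trans
  continuousOn_toFun := by
    rintro _ _ ⟨w, rfl⟩ ⟨w', rfl⟩
    exact contDiffOn_jetChart_trans.continuousOn

instance (r : ℕ) : TopologicalSpace (Jet I F n r) := (jetSpaceCore I F n r).toTopologicalSpace

instance (r : ℕ) : ChartedSpace (JetModel n (Module.finrank ℝ V - n) r) (Jet I F n r) :=
  (jetSpaceCore I F n r).toChartedSpace

instance (r : ℕ) :
    IsManifold 𝓘(ℝ, JetModel n (Module.finrank ℝ V - n) r) ∞ (Jet I F n r) := by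
  refine isManifold_of_contDiffOn _ _ _ ?_
  rintro e e' he he'
  simp only [atlas, ChartedSpace.atlas, mem_iUnion, mem_singleton_iff] at he he'
  obtain ⟨_, ⟨w, rfl⟩, rfl⟩ := he
  obtain ⟨_, ⟨w', rfl⟩, rfl⟩ := he'
  have := contDiffOn_jetChart_trans (I := I) (r := r) (c := w.1) (A := w.2) (c' := w'.1)
    (A' := w'.2)
  simp only [modelWithCornersSelf_coe, modelWithCornersSelf_coe_symm, range_id, inter_univ,
    preimage_id, CompTriple.comp_eq]
  exact this

/-! ### The geometry of jet spaces -/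

variable (V n) in
/-- The model of the manifold `Jʳ(F, n)`. -/
abbrev jetI (r : ℕ) := 𝓘(ℝ, JetModel n (Module.finrank ℝ V - n) r)

/-- The projection `π_{r,k} : Jʳ(F, n) → Jᵏ(F, n)`, `[L]ʳ ↦ [L]ᵏ`. -/
def Jet.proj {r k : ℕ} (h : k ≤ r) : Jet I F n r → Jet I F n k :=
  Quotient.map' id fun _ _ ⟨h0, φ, hφ, hj⟩ => ⟨h0, φ, hφ, hj.mono h⟩

/-- The projection `π_{r,0} : Jʳ(F, n) → F`, `[L]ʳ_p ↦ p`. -/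
def Jet.base {r : ℕ} : Jet I F n r → F := Quotient.lift (fun s => s 0) fun _ _ h => h.1

/-- The map `x ↦ [L]ʳ_{s x}`, where `L` is the submanifold parametrized by `s`. It has this
meaning for `x` near `0`. -/
def ImmGerm.prolong (s : ImmGerm I F n) (r : ℕ) (x : Vec n) : Jet I F n r :=
  open Classical in
  if h : (∀ᶠ y in 𝓝 (0 : Vec n), ContMDiffAt 𝓘(ℝ, Vec n) I ∞ (fun y => s (x + y)) y) ∧
      Injective (mfderiv 𝓘(ℝ, Vec n) I (fun y => s (x + y)) 0) then
    Jet.mk r ⟨fun y => s (x + y), h.1, h.2⟩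
  else Jet.mk r s

/-- The tangent plane at `f x` of the submanifold parametrized by `f`. -/
def tangentPlane {W : Type*} [NormedAddCommGroup W] [NormedSpace ℝ W] {K : Type*}
    [TopologicalSpace K] (J : ModelWithCorners ℝ W K) {N : Type*} [TopologicalSpace N]
    [ChartedSpace K N] (f : Vec n → N) (x : Vec n) : Set (TangentBundle J N) :=
  range fun v : Vec n => ⟨f x, mfderiv 𝓘(ℝ, Vec n) J f x v⟩

/-- The plane `T_p L` of a first order jet `[L]¹_p`. -/
def Jet.plane (θ : Jet I F n 1) : Set (TangentBundle I F) :=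
  {v | ∃ s : ImmGerm I F n, Jet.mk 1 s = θ ∧ v ∈ tangentPlane I s 0}

/-- The `R`-plane `R_θ = T L⁽ʳ⁾ ⊆ T Jʳ(F, n)` of a jet `θ = [L]ʳ⁺¹_p`. -/
def Jet.RPlane {r : ℕ} (θ : Jet I F n (r + 1)) :
    Set (TangentBundle (jetI V n r) (Jet I F n r)) :=
  {v | ∃ s : ImmGerm I F n, Jet.mk (r + 1) s = θ ∧ v ∈ tangentPlane (jetI V n r) (s.prolong r) 0}

variable (I F n) in
/-- The Cartan distribution of `Jʳ(F, n)`: at each `θ`, the span of the planes `T L⁽ʳ⁾` at `θ` of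
all submanifolds `L` with `[L]ʳ = θ`. -/
def cartan (r : ℕ) : Set (TangentBundle (jetI V n r) (Jet I F n r)) :=
  {v | v.snd ∈ Submodule.span ℝ {w : TangentSpace (jetI V n r) v.proj |
    ∃ s : ImmGerm I F n, Jet.mk r s = v.proj ∧
      (⟨v.proj, w⟩ : TangentBundle (jetI V n r) (Jet I F n r)) ∈
        tangentPlane (jetI V n r) (s.prolong r) 0}}

section General
variable {W : Type*} [NormedAddCommGroup W] [NormedSpace ℝ W] {K : Type*}
    [TopologicalSpace K] (J : ModelWithCorners ℝ W K) {N : Type*} [TopologicalSpace N]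
    [ChartedSpace K N]

/-- The tangent vectors of a subset: the velocities of the smooth curves running in it. For an
embedded submanifold `S` this is its tangent bundle `T S`. -/
def tangentVectors (S : Set N) : Set (TangentBundle J N) :=
  {v | ∃ γ : ℝ → N, (∀ᶠ t in 𝓝 (0 : ℝ), ContMDiffAt 𝓘(ℝ, ℝ) J ∞ γ t) ∧
    (∀ᶠ t in 𝓝 (0 : ℝ), γ t ∈ S) ∧ v = ⟨γ 0, mfderiv 𝓘(ℝ, ℝ) J γ 0 (1 : ℝ)⟩}

/-- Integrability on `U` of a distribution `D` of `n`-dimensional planes, given as a subset of the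
tangent bundle: through each point of `U` there is an `n`-dimensional integral submanifold. -/
def IntegrableOn (n : ℕ) (D : Set (TangentBundle J N)) (U : Set N) : Prop :=
  ∀ p ∈ U, ∃ f : Vec n → N, f 0 = p ∧ (∀ᶠ x in 𝓝 (0 : Vec n), ContMDiffAt 𝓘(ℝ, Vec n) J ∞ f x) ∧
    Injective (mfderiv 𝓘(ℝ, Vec n) J f 0) ∧
    ∀ᶠ x in 𝓝 (0 : Vec n), tangentPlane J f x = {v ∈ D | v.proj = f x}

/-- `g` is a diffeomorphism of the open set `U` onto the subset `S`, with a smooth inverse in the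
sense of subsets: one that extends smoothly to a neighbourhood of `S`. In particular `S` is an
embedded submanifold. -/
structure IsDiffeoOnto {W' : Type*} [NormedAddCommGroup W'] [NormedSpace ℝ W'] {K' : Type*}
    [TopologicalSpace K'] (J' : ModelWithCorners ℝ W' K') {N' : Type*} [TopologicalSpace N']
    [ChartedSpace K' N'] (g : N → N') (U : Set N) (S : Set N') : Prop where
  isOpen : IsOpen U
  smooth : ContMDiffOn J J' ∞ g U
  bijOn : BijOn g U S
  smooth_inverse : ∃ (O : Set N') (h : N' → N), IsOpen O ∧ S ⊆ O ∧ ContMDiffOn J' J ∞ h O ∧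
    ∀ p ∈ U, h (g p) = p

end General

/-- The prolongation `𝓔¹ ⊆ Jʳ⁺¹(F, n)` of an equation `𝓔 ⊆ Jʳ(F, n)`: the jets over `𝓔` whose
`R`-plane is tangent to `𝓔`. -/
def prolongation {r : ℕ} (S : Set (Jet I F n r)) : Set (Jet I F n (r + 1)) :=
  {θ | θ.proj (Nat.le_succ r) ∈ S ∧ θ.RPlane ⊆ tangentVectors (jetI V n r) S}

/-- The `l`-th prolongation of an equation. -/
def iterProlongation {r : ℕ} (S : Set (Jet I F n r)) : (l : ℕ) → Set (Jet I F n (r + l))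
  | 0 => S
  | l + 1 => prolongation (iterProlongation S l)

/-- The induced Cartan distribution `𝓒(𝓔) = 𝓒ʳ ∩ T𝓔` of an equation. -/
def inducedCartan {r : ℕ} (S : Set (Jet I F n r)) : Set (TangentBundle (jetI V n r) (Jet I F n r)) :=
  cartan I F n r ∩ tangentVectors (jetI V n r) S

/-! ### Totally geodesic submanifolds -/

/-- A vector field that is smooth near `p`. -/
def SmoothFieldNear (Y : (q : F) → TangentSpace I q) (p : F) : Prop :=
  ∀ᶠ q in 𝓝 p, ContMDiffAt I I.tangent ∞ (fun q => (⟨q, Y q⟩ : TangentBundle I F)) q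

/-- A linear connection on the tangent bundle of `F`. -/
abbrev Connection (I : ModelWithCorners ℝ V H) (F : Type*) [TopologicalSpace F]
    [ChartedSpace H F] [IsManifold I ∞ F] :=
  CovariantDerivative I V (TangentSpace I : F → Type _)

/-- The second fundamental form at `s 0` of the submanifold parametrized by `s`:
`II (v, Y) = ω (∇_v Y)`, where `ω` is the projection of the tangent space of `F` onto its quotient
by the tangent space of the submanifold. -/
def secondFundamentalForm (cov : Connection I F) (s : ImmGerm I F n) (v : TangentSpace I (s 0))
    (Y : (q : F) → TangentSpace I q) :
    TangentSpace I (s 0) ⧸ LinearMap.range (mfderiv 𝓘(ℝ, Vec n) I s 0).toLinearMap :=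
  Submodule.Quotient.mk (cov Y (s 0) v)

variable (n) in
/-- The equation `𝓢 ⊆ J²(F, n)` of totally geodesic submanifolds, `II = 0`. Here `v` runs through
the tangent vectors of the submanifold at `s 0`, and `Y` through the vector fields of `F` that are
tangent to the submanifold along the submanifold. -/
def geodesicEquation (cov : Connection I F) : Set (Jet I F n 2) :=
  {θ | ∀ s : ImmGerm I F n, Jet.mk 2 s = θ → ∀ (v : TangentSpace I (s 0))
    (Y : (q : F) → TangentSpace I q),
    v ∈ LinearMap.range (mfderiv 𝓘(ℝ, Vec n) I s 0).toLinearMap → SmoothFieldNear Y (s 0) →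
    (∀ᶠ x in 𝓝 (0 : Vec n), Y (s x) ∈ LinearMap.range (mfderiv 𝓘(ℝ, Vec n) I s x).toLinearMap) →
    secondFundamentalForm cov s v Y = 0}

/-- A field of `n`-planes near `p`: a local section of `π_{1,0} : J¹(F, n) → F`. -/
def IsPlaneField (σ : F → Jet I F n 1) (p : F) : Prop :=
  (∀ᶠ q in 𝓝 p, ContMDiffAt I (jetI V n 1) ∞ σ q) ∧ ∀ᶠ q in 𝓝 p, (σ q).base = q

/-- The covariant derivative at `p` in the direction `v` of the plane field `σ` vanishes: sections
`Y` of `σ` satisfy `ω (∇_v Y) = 0`, where `ω` is the projection onto the quotient by `σ`. -/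
def IsParallelAlong (cov : Connection I F) (σ : F → Jet I F n 1) (p : F) (v : TangentSpace I p) :
    Prop :=
  ∀ Y : (q : F) → TangentSpace I q, SmoothFieldNear Y p →
    (∀ᶠ q in 𝓝 p, (⟨q, Y q⟩ : TangentBundle I F) ∈ (σ q).plane) →
    (⟨p, cov Y p v⟩ : TangentBundle I F) ∈ (σ p).plane

variable (n) in
/-- The connection `Γ̇` on `π_{1,0} : J¹(F, n) → F` induced by a linear connection on `F`, given by
its horizontal vectors: the vectors `Tσ v`, where the plane field `σ` is parallel along `v`. -/
def horizontalVectors (cov : Connection I F) : Set (TangentBundle (jetI V n 1) (Jet I F n 1)) :=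
  {ξ | ∃ (σ : F → Jet I F n 1) (p : F) (v : TangentSpace I p), IsPlaneField σ p ∧
    IsParallelAlong cov σ p v ∧ ξ = ⟨σ p, mfderiv I (jetI V n 1) σ p v⟩}

/-- The horizontal lift, at a point `θ` of `J¹(F, n)`, of the plane `θ` itself. -/
def liftedPlane (cov : Connection I F) (θ : Jet I F n 1) :
    Set (TangentBundle (jetI V n 1) (Jet I F n 1)) :=
  {ξ ∈ horizontalVectors n cov | ξ.proj = θ ∧ tangentMap (jetI V n 1) I Jet.base ξ ∈ θ.plane}

/-- The section `Γ̈` of `π_{2,1} : J²(F, n) → J¹(F, n)`: the point `Γ̈(θ)` is the jet over `θ` whose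
`R`-plane is the horizontal lift of the plane `θ`. -/
def grassmannStructure (cov : Connection I F) (θ : Jet I F n 1) : Jet I F n 2 :=
  open Classical in
  if h : ∃ θ₂ : Jet I F n 2, θ₂.proj (by norm_num) = θ ∧ θ₂.RPlane = liftedPlane cov θ then h.choose
  else Jet.mk 2 (Quotient.out (s := contactSetoid I F n 1) θ)

variable (n) in
/-- The distribution `R ∘ Γ̈` on `J¹(F, n)`. -/
def geodesicDistribution (cov : Connection I F) :
    Set (TangentBundle (jetI V n 1) (Jet I F n 1)) :=
  {ξ | ξ ∈ (grassmannStructure cov ξ.proj).RPlane}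

/-- All prolongations of the equation `S ⊆ J²(F, n)` are diffeomorphic to the open subset `U` of
`J¹(F, n)`, by diffeomorphisms that carry the distribution `D` on `U` to the induced Cartan
distribution. -/
def ProlongationsIsomorphicTo (S : Set (Jet I F n 2)) (U : Set (Jet I F n 1))
    (D : Set (TangentBundle (jetI V n 1) (Jet I F n 1))) : Prop :=
  ∀ l : ℕ, ∃ g : Jet I F n 1 → Jet I F n (2 + l),
    IsDiffeoOnto (jetI V n 1) (jetI V n (2 + l)) g U (iterProlongation S l) ∧
    tangentMap (jetI V n 1) (jetI V n (2 + l)) g '' {ξ ∈ D | ξ.proj ∈ U} =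
      inducedCartan (iterProlongation S l)

end

end Jets

/-! ### The fibred case -/

section Product
variable {V : Type*} [NormedAddCommGroup V] [NormedSpace ℝ V] 
  {H : Type*} [TopologicalSpace H] {I : ModelWithCorners ℝ V H}
  {M : Type*} [TopologicalSpace M] [ChartedSpace H M] [IsManifold I ∞ M]
  {V' : Type*} [NormedAddCommGroup V'] [NormedSpace ℝ V'] 
  {H' : Type*} [TopologicalSpace H'] {I' : ModelWithCorners ℝ V' H'}
  {E : Type*} [TopologicalSpace E] [ChartedSpace H' E] [IsManifold I' ∞ E]

theorem smul_add_smul_aux {W : Type*} [AddCommGroup W] [Module ℝ W] (a : ℝ) (p q y : W)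
    {c d e : ℝ} (h : c + d = e) : (a • p + c • y) + (a • q + d • y) = a • (p + q) + e • y := by
  rw [← h, smul_add, add_smul, add_add_add_comm]

theorem two_le : (1 + 1 : WithTop ℕ∞) ≤ ∞ := by
  rw [one_add_one_eq_two]; exact WithTop.coe_le_coe.2 le_top

theorem mdifferentiableAt_comp_equivTangentBundleProd
    {Y : (z : M × E) → TangentSpace (I.prod I') z} {z : M × E}
    (h : MDifferentiableAt (I.prod I') (I.prod I').tangent
      (fun z => (⟨z, Y z⟩ : TangentBundle (I.prod I') (M × E))) z) :
    MDifferentiableAt (I.prod I') (I.tangent.prod I'.tangent) (fun z =>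
      ((⟨z.1, (Y z).1⟩, ⟨z.2, (Y z).2⟩) : TangentBundle I M × TangentBundle I' E)) z := by
  have : IsManifold I (1 + 1) M := IsManifold.of_le (n := ∞) two_le
  have : IsManifold I' (1 + 1) E := IsManifold.of_le (n := ∞) two_le
  have := (contMDiff_equivTangentBundleProd (n := 1) (I := I) (M := M) (I' := I') (M' := E)
    |>.mdifferentiable one_ne_zero ⟨z, Y z⟩).comp z h
  exact this

theorem mdifferentiableAt_prodMk_left (z : M × E) :
    MDifferentiableAt I (I.prod I') (fun x : M => (x, z.2)) z.1 :=
  mdifferentiableAt_id.prodMk mdifferentiableAt_const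

theorem mdifferentiableAt_prodMk_right (z : M × E) :
    MDifferentiableAt I' (I.prod I') (fun e : E => (z.1, e)) z.2 :=
  mdifferentiableAt_const.prodMk mdifferentiableAt_id

/-- A map into the tangent bundle that stays over one point. -/
theorem mdifferentiableAt_of_const_proj {x : M} {e : E} {w : E → V}
    (h : MDifferentiableAt I' I.tangent (fun e => (⟨x, w e⟩ : TangentBundle I M)) e) :
    MDifferentiableAt I' 𝓘(ℝ, V) w e := by
  have : IsManifold I 1 M := IsManifold.of_le (n := ∞) (by exact_mod_cast le_top)
  have := ((mdifferentiableAt_totalSpace I _).1 h).2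
  refine this.congr_of_eventuallyEq (Eventually.of_forall fun e' => ?_)
  have h2 := (tangentBundleCore I M).coordChange_self (achart H x) x (mem_chart_source H x) (w e')
  exact h2.symm

variable (I I') in
/-- The product connection `Θ ⊕ Γ` on `M × E`: the derivative of a vector field `Y = (Y₁, Y₂)` along
`(v₁, v₂)` has the components `∇_{v₁} Y₁ + d_{v₂} Y₁` and `∇_{v₂} Y₂ + d_{v₁} Y₂`, where
`Y₁ (x, ·)` is a map into the vector space `T_x M`, and `Y₂ (·, e)` a map into `T_e E`. -/
def prodDerivative (Θ : Connection I M) (Γ : Connection I' E)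
    (Y : (z : M × E) → TangentSpace (I.prod I') z) (z : M × E) : V × V' →L[ℝ] V × V' :=
  let D₁₁ : V →L[ℝ] V := Θ (fun x => (Y (x, z.2)).1) z.1
  let D₁₂ : V' →L[ℝ] V := mvfderiv I' (fun e : E => ((Y (z.1, e)).1 : V)) z.2
  let D₂₁ : V →L[ℝ] V' := mvfderiv I (fun x : M => ((Y (x, z.2)).2 : V')) z.1
  let D₂₂ : V' →L[ℝ] V' := Γ (fun e => (Y (z.1, e)).2) z.2
  (D₁₁.coprod D₁₂).prod (D₂₁.coprod D₂₂)

theorem isCovariantDerivativeOn_prodDerivative (Θ : Connection I M) (Γ : Connection I' E) :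
    IsCovariantDerivativeOn (I := I.prod I') (V × V')
      (V := (TangentSpace (I.prod I') : M × E → Type _)) (prodDerivative I I' Θ Γ) univ := by
  have key : ∀ {Y : (z : M × E) → TangentSpace (I.prod I') z} {z : M × E},
    MDifferentiableAt (I.prod I') (I.prod I').tangent
      (fun z => (⟨z, Y z⟩ : TangentBundle (I.prod I') (M × E))) z →
    MDifferentiableAt I I.tangent (fun x => (⟨x, (Y (x, z.2)).1⟩ : TangentBundle I M)) z.1 ∧
    MDifferentiableAt I' 𝓘(ℝ, V) (fun e : E => ((Y (z.1, e)).1 : V)) z.2 ∧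
    MDifferentiableAt I 𝓘(ℝ, V') (fun x : M => ((Y (x, z.2)).2 : V')) z.1 ∧
    MDifferentiableAt I' I'.tangent (fun e => (⟨e, (Y (z.1, e)).2⟩ : TangentBundle I' E)) z.2 := by
    intro Y z h
    have h' := mdifferentiableAt_comp_equivTangentBundleProd h
    have hl := MDifferentiableAt.comp z.1 (f := fun x : M => (x, z.2)) h'
      (mdifferentiableAt_prodMk_left z)
    have hr := MDifferentiableAt.comp z.2 (f := fun e : E => (z.1, e)) h'
      (mdifferentiableAt_prodMk_right z)
    exact ⟨hl.fst, mdifferentiableAt_of_const_proj hr.fst,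
      mdifferentiableAt_of_const_proj hl.snd, hr.snd⟩
  refine ⟨fun {Y Y' z} hY hY' _ => ?_, fun {Y g z} hY hg _ => ?_⟩
  · obtain ⟨h1, h2, h3, h4⟩ := key hY
    obtain ⟨h1', h2', h3', h4'⟩ := key hY'
    have e1 := Θ.isCovariantDerivativeOn.add (s := univ) h1 h1'
    have e4 := Γ.isCovariantDerivativeOn.add (s := univ) h4 h4'
    have e2 := mvfderiv_add h2 h2'
    have e3 := mvfderiv_add h3 h3'
    ext1 v
    have a1 := DFunLike.congr_fun e1 v.1
    have a2 := DFunLike.congr_fun e2 v.2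
    have a3 := DFunLike.congr_fun e3 v.1
    have a4 := DFunLike.congr_fun e4 v.2
    refine Prod.ext ?_ ?_
    · refine (congrArg₂ (fun a b : V => a + b) a1 a2).trans ?_
      exact add_add_add_comm _ _ _ _
    · refine (congrArg₂ (fun a b : V' => a + b) a3 a4).trans ?_
      exact add_add_add_comm _ _ _ _
  · obtain ⟨h1, h2, h3, h4⟩ := key hY
    have gl := MDifferentiableAt.comp z.1 (f := fun x : M => (x, z.2)) hg
      (mdifferentiableAt_prodMk_left z)
    have gr := MDifferentiableAt.comp z.2 (f := fun e : E => (z.1, e)) hg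
      (mdifferentiableAt_prodMk_right z)
    have e1 := Θ.isCovariantDerivativeOn.leibniz (s := univ) h1 gl
    have e4 := Γ.isCovariantDerivativeOn.leibniz (s := univ) h4 gr
    have e2 := mvfderiv_smul gr h2
    have e3 := mvfderiv_smul gl h3
    have g1 : mvfderiv I (g ∘ fun x : M => (x, z.2)) z.1 = (mvfderiv (I.prod I') g z).comp
        (ContinuousLinearMap.inl ℝ V V') := by
      rw [mvfderiv_comp z.1 hg (mdifferentiableAt_prodMk_left z), mfderiv_prod_left]
      rfl
    have g2 : mvfderiv I' (g ∘ fun e : E => (z.1, e)) z.2 = (mvfderiv (I.prod I') g z).comp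
        (ContinuousLinearMap.inr ℝ V V') := by
      rw [mvfderiv_comp z.2 hg (mdifferentiableAt_prodMk_right z), mfderiv_prod_right]
      rfl
    rw [g1] at e1 e3
    rw [g2] at e2 e4
    ext1 v
    have a1 := DFunLike.congr_fun e1 v.1
    have a2 := DFunLike.congr_fun e2 v.2
    have a3 := DFunLike.congr_fun e3 v.1
    have a4 := DFunLike.congr_fun e4 v.2
    have hs : (mvfderiv (I.prod I') g z).comp (ContinuousLinearMap.inl ℝ V V') v.1 +
        (mvfderiv (I.prod I') g z).comp (ContinuousLinearMap.inr ℝ V V') v.2 =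
        mvfderiv (I.prod I') g z v := by
      refine ((mvfderiv (I.prod I') g z).map_add _ _).symm.trans ?_
      congr 1
      exact Prod.ext (add_zero _) (zero_add _)
    refine Prod.ext ?_ ?_
    · refine (congrArg₂ (fun a b : V => a + b) a1 a2).trans ?_
      exact smul_add_smul_aux _ _ _ _ hs
    · refine (congrArg₂ (fun a b : V' => a + b) a3 a4).trans ?_
      exact smul_add_smul_aux _ _ _ _ hs

variable (I I') in
/-- The product connection `Θ ⊕ Γ` on `M × E`. -/
def prodConnection (Θ : Connection I M) (Γ : Connection I' E) : Connection (I.prod I') (M × E) :=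
  ⟨prodDerivative I I' Θ Γ, isCovariantDerivativeOn_prodDerivative Θ Γ⟩

variable [I.Boundaryless] [I'.Boundaryless] (n : ℕ)

/-- The submanifold of `M × E` parametrized by `s` is, near `s 0`, the image of the local section
`x ↦ (x, f x)` of the trivial bundle `M × E → M`. -/
def IsGraphOf (s : ImmGerm (I.prod I') (M × E) n) (f : M → E) : Prop :=
  (∀ᶠ x in 𝓝 (s 0).1, ContMDiffAt I I' ∞ f x) ∧ ∀ᶠ x in 𝓝 (0 : Vec n), (s x).2 = f (s x).1

variable (I I' M E) in
/-- For `n = dim M`, the space `Jʳ pr` of jets of local sections of `pr : M × E → M`, as an open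
subset of `Jʳ(M × E, n)`. -/
def sectionJets (r : ℕ) : Set (Jet (I.prod I') (M × E) n r) :=
  {θ | ∃ (s : ImmGerm (I.prod I') (M × E) n) (f : M → E), Jet.mk r s = θ ∧ IsGraphOf n s f}

variable (I I' M E) in
/-- For `n = dim M`, the space `Imm Jʳ pr` of jets of local immersions `M → E`, seen as local
sections of `pr : M × E → M`. -/
def immersiveSectionJets (r : ℕ) : Set (Jet (I.prod I') (M × E) n r) :=
  {θ | ∃ (s : ImmGerm (I.prod I') (M × E) n) (f : M → E), Jet.mk r s = θ ∧ IsGraphOf n s f ∧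
    Injective (mfderiv I I' f (s 0).1)}

end Product
end

end GrassmannJet

open GrassmannJet

set_option linter.unusedSectionVars false

namespace GrassmannJet

noncomputable section

/-! ### Tangent maps -/

section TangentMap

variable {W₁ : Type*} [NormedAddCommGroup W₁] [NormedSpace ℝ W₁] {K₁ : Type*} [TopologicalSpace K₁]
  {J₁ : ModelWithCorners ℝ W₁ K₁} {N₁ : Type*} [TopologicalSpace N₁] [ChartedSpace K₁ N₁]
  {W₂ : Type*} [NormedAddCommGroup W₂] [NormedSpace ℝ W₂] {K₂ : Type*} [TopologicalSpace K₂]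
  {J₂ : ModelWithCorners ℝ W₂ K₂} {N₂ : Type*} [TopologicalSpace N₂] [ChartedSpace K₂ N₂]
  {W₃ : Type*} [NormedAddCommGroup W₃] [NormedSpace ℝ W₃] {K₃ : Type*} [TopologicalSpace K₃]
  {J₃ : ModelWithCorners ℝ W₃ K₃} {N₃ : Type*} [TopologicalSpace N₃] [ChartedSpace K₃ N₃]

/-! Vanishing torsion turns total geodesy into a system in solved form. In a chart, write an
`n`-dimensional submanifold as a graph `u = f(x)` and let `B` be the Christoffel symbols, symmetric
because the connection is torsion-free. Then `II = 0` says `D²f(e,η) = P b₁ - b₂`, where `P = Df`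
and `(b₁,b₂) = B((e,Pe),(η,Pη))`. The right side is a symmetric bilinear map that depends smoothly
on the first jet, so over each first jet lies exactly one second jet satisfying the equation: `𝓢` is
the image of a smooth section `κ` of `π_{2,1}`. The horizontal lift of the plane `θ` is described by
the same formula, so `κ = Γ̈` (`mem_liftedPlane_iff`, `mem_geodesicEquation_iff`,
`contMDiff_grassmannStructure`).

What remains holds for any smooth section `κ` over an open set `U`
(`prolongationsIsomorphicTo_of_isSolution`). It rests on the fact that a jet of order `r + 1` and
its `R`-plane determine each other (`tangentPlane_prolong_congr`, `mk_succ_eq_of_tangentPlane`).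
Therefore an integral submanifold of `R ∘ κ` is the first prolongation of a solution, a submanifold
whose second jets are `κ` of its first jets (`exists_isSolution`). Integrability gives a solution
through each `θ` in `U`, and `θ` determines all its jets: if the `r`-jets of solutions are a
function `G` of the first jets, the plane tangent to the `r`-th prolongation is `dG(R_{κ(θ)})`, and
this plane determines the `(r + 1)`-jet. In coordinates the `(r + 1)`-jet is a linear function of
the `r`-jet and the derivative of the curve of `r`-jets, and that derivative is `DG` after a map
prescribed by `κ`. So smoothness passes from order `r` to order `r + 1`
(`contMDiffAt_of_prolong_eq`), without any smooth choice of integral submanifolds.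

The resulting maps `G_l : U → J^{2+l}` have the projection `π` to `J¹` as left inverse, so they are
diffeomorphisms onto their images. A vector `η` tangent to the image satisfies `η = dG_l(dπ η)`. If
`η` also lies in the Cartan distribution, then `dπ η` lies in `R_{κ(θ)}`; this identifies the
induced distribution. If the whole `R`-plane of a jet over the image is tangent to the image, then
it is `dG_l(R_{κ(θ)})`, so the jet is `G_{l+1}(θ)`; this identifies the next prolongation.

For the fibred cases, the Christoffel symbols of `Θ ⊕ Γ` are direct sums, and being a jet of a
section, or of an immersion, is an open condition on the first jet alone. -/

theorem tangentBundle_mk_eq {p p' : N₁} (h : p = p') {v v' : W₁} (hv : v = v') :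
    (⟨p, v⟩ : TangentBundle J₁ N₁) = ⟨p', v'⟩ := by
  subst h hv; rfl

theorem tangentBundle_mk_inj {p : N₁} {v v' : TangentSpace J₁ p}
    (h : (⟨p, v⟩ : TangentBundle J₁ N₁) = ⟨p, v'⟩) : v = v' := by
  cases h; rfl

theorem tangentMap_congr {f g : N₁ → N₂} {ξ : TangentBundle J₁ N₁} (h : f =ᶠ[𝓝 ξ.proj] g) :
    tangentMap J₁ J₂ f ξ = tangentMap J₁ J₂ g ξ :=
  tangentBundle_mk_eq (J₁ := J₂) h.self_of_nhds
    (congrArg (fun L : W₁ →L[ℝ] W₂ => L ξ.snd) (h.mfderiv_eq (I := J₁) (I' := J₂)))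

theorem tangentPlane_eq_range {f : Vec n → N₁} {x : Vec n} :
    tangentPlane J₁ f x = range fun v : Vec n =>
      tangentMap 𝓘(ℝ, Vec n) J₁ f (⟨x, v⟩ : TangentBundle 𝓘(ℝ, Vec n) (Vec n)) := rfl

theorem tangentPlane_congr {f g : Vec n → N₁} {x : Vec n} (h : f =ᶠ[𝓝 x] g) :
    tangentPlane J₁ f x = tangentPlane J₁ g x := by
  rw [tangentPlane_eq_range, tangentPlane_eq_range]
  congr 1
  funext v
  exact tangentMap_congr h

theorem tangentPlane_comp {f : Vec n → N₁} {g : N₁ → N₂} {x : Vec n}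
    (hg : MDifferentiableAt J₁ J₂ g (f x)) (hf : MDifferentiableAt 𝓘(ℝ, Vec n) J₁ f x) :
    tangentPlane J₂ (g ∘ f) x = tangentMap J₁ J₂ g '' tangentPlane J₁ f x := by
  rw [tangentPlane_eq_range, tangentPlane_eq_range, ← range_comp]
  congr 1
  funext v
  exact tangentMap_comp_at _ hg hf

theorem surjective_of_injective_endo {L : Vec n →L[ℝ] Vec n} (h : Injective L) : Surjective L :=
  (LinearMap.injective_iff_surjective (f := (L : Vec n →ₗ[ℝ] Vec n))).1 h

/-- An injective endomorphism of `ℝⁿ` is onto, so the two derivatives have the same range: planes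
belong to submanifolds, not to parametrizations. -/
theorem tangentPlane_comp_reparam {f : Vec n → N₁} {φ : Vec n → Vec n} {x y : Vec n}
    (hy : φ x = y) (hf : MDifferentiableAt 𝓘(ℝ, Vec n) J₁ f y)
    (hφ : DifferentiableAt ℝ φ x) (hi : Injective (fderiv ℝ φ x)) :
    tangentPlane J₁ (f ∘ φ) x = tangentPlane J₁ f y := by
  subst hy
  have e (v : Vec n) : tangentMap 𝓘(ℝ, Vec n) J₁ (f ∘ φ)
      (⟨x, v⟩ : TangentBundle 𝓘(ℝ, Vec n) (Vec n)) = tangentMap 𝓘(ℝ, Vec n) J₁ f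
      (⟨φ x, fderiv ℝ φ x v⟩ : TangentBundle 𝓘(ℝ, Vec n) (Vec n)) := by
    rw [tangentMap_comp_at _ hf hφ.mdifferentiableAt]
    congr 1
    exact tangentBundle_mk_eq (J₁ := 𝓘(ℝ, Vec n)) rfl (by rw [mfderiv_eq_fderiv]; rfl)
  rw [tangentPlane_eq_range, tangentPlane_eq_range]
  ext ξ
  constructor
  · rintro ⟨v, rfl⟩
    exact ⟨_, (e v).symm⟩
  · rintro ⟨v, rfl⟩
    obtain ⟨u, rfl⟩ := surjective_of_injective_endo hi v
    exact ⟨u, e u⟩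

end TangentMap

variable {V : Type*} [NormedAddCommGroup V] [NormedSpace ℝ V] [FiniteDimensional ℝ V]
  {H : Type*} [TopologicalSpace H] {I : ModelWithCorners ℝ V H}
  {F : Type*} [TopologicalSpace F] [ChartedSpace H F] {n : ℕ} [IsManifold I ∞ F] [I.Boundaryless]

variable (V n) in
/-- Linear splittings of the model space into independent and dependent variables. -/
abbrev Splitting := V ≃L[ℝ] Vec n × Vec (Module.finrank ℝ V - n)

/-! ### Jet charts as smooth charts. -/

section Charts
variable {r : ℕ} {c : F} {A : Splitting V n}

variable (r c A) in
theorem jetChart_mem_atlas :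
    jetChart (I := I) r c A ∈ (jetSpaceCore I F n r).atlas := ⟨(c, A), rfl⟩

variable (I r c A) in
/-- A jet chart as an open partial homeomorphism. -/
def jetHomeo : OpenPartialHomeomorph (Jet I F n r) (JetModel n (Module.finrank ℝ V - n) r) :=
  (jetSpaceCore I F n r).openPartialHomeomorph (jetChart r c A) (jetChart_mem_atlas r c A)

theorem jetHomeo_mem_maximalAtlas :
    jetHomeo I r c A ∈ IsManifold.maximalAtlas (jetI V n r) ∞ (Jet I F n r) := by
  apply IsManifold.subset_maximalAtlas
  simp only [atlas, ChartedSpace.atlas, mem_iUnion, mem_singleton_iff]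
  exact ⟨_, jetChart_mem_atlas r c A, rfl⟩

theorem isOpen_jetChart_source : IsOpen (jetChart (I := I) r c A).source :=
  (jetHomeo I r c A).open_source

theorem contMDiffAt_jetChart {θ : Jet I F n r} (h : θ ∈ (jetChart (I := I) r c A).source) :
    ContMDiffAt (jetI V n r) (jetI V n r) ∞ (jetChart (I := I) r c A) θ :=
  (contMDiffOn_of_mem_maximalAtlas (jetHomeo_mem_maximalAtlas (I := I) (r := r) (c := c) (A := A)))
    |>.contMDiffAt (isOpen_jetChart_source.mem_nhds h)

theorem contMDiffAt_graphJet {z : JetModel n (Module.finrank ℝ V - n) r}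
    (h : z ∈ jetTarget (I := I) r c A) :
    ContMDiffAt (jetI V n r) (jetI V n r) ∞ (graphJet (I := I) r c A) z :=
  (contMDiffOn_symm_of_mem_maximalAtlas
    (jetHomeo_mem_maximalAtlas (I := I) (r := r) (c := c) (A := A)))
    |>.contMDiffAt (isOpen_jetTarget.mem_nhds h)

theorem graphJet_mem_source {z : JetModel n (Module.finrank ℝ V - n) r}
    (h : z ∈ jetTarget (I := I) r c A) : graphJet r c A z ∈ (jetChart (I := I) r c A).source :=
  ⟨z, h, rfl⟩

theorem jetChart_mem_target {θ : Jet I F n r} (h : θ ∈ (jetChart (I := I) r c A).source) :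
    jetChart r c A θ ∈ jetTarget (I := I) r c A := (jetChart (I := I) r c A).map_source h

theorem graphJet_jetChart {θ : Jet I F n r} (h : θ ∈ (jetChart (I := I) r c A).source) :
    graphJet r c A (jetChart r c A θ) = θ := (jetChart (I := I) r c A).left_inv h

/-- Used to turn equalities between planes in jet space into equalities between coordinate vectors.
-/
theorem tangentMap_jetChart_graphJet {z : JetModel n (Module.finrank ℝ V - n) r}
    (h : z ∈ jetTarget (I := I) r c A) (ζ : JetModel n (Module.finrank ℝ V - n) r) :
    tangentMap (jetI V n r) (jetI V n r) (jetChart (I := I) r c A)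
      (tangentMap (jetI V n r) (jetI V n r) (graphJet (I := I) r c A)
        (⟨z, ζ⟩ : TangentBundle (jetI V n r) (JetModel n (Module.finrank ℝ V - n) r))) =
    (⟨z, ζ⟩ : TangentBundle (jetI V n r) (JetModel n (Module.finrank ℝ V - n) r)) := by
  rw [← tangentMap_comp_at _
    ((contMDiffAt_jetChart (graphJet_mem_source h)).mdifferentiableAt (by simp))
    ((contMDiffAt_graphJet h).mdifferentiableAt (by simp))]
  have e : jetChart (I := I) r c A ∘ graphJet r c A =ᶠ[𝓝 z] id := by
    filter_upwards [(isOpen_jetTarget (I := I)).mem_nhds h] with y hy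
    exact jetChart_graphJet hy
  rw [tangentMap_congr (g := id) e, tangentMap_id]
  rfl

end Charts

/-! ### Prolongation of germs -/

/-- Points near which a germ can be translated to `0`. -/
def ImmGerm.IsRegularAt (s : ImmGerm I F n) (x : Vec n) : Prop :=
  (∀ᶠ y in 𝓝 (0 : Vec n), ContMDiffAt 𝓘(ℝ, Vec n) I ∞ (fun y => s (x + y)) y) ∧
    Injective (mfderiv 𝓘(ℝ, Vec n) I (fun y => s (x + y)) 0)

/-- The germ at `x` of a parametrized submanifold. -/
def ImmGerm.translate (s : ImmGerm I F n) (x : Vec n) (h : s.IsRegularAt x) : ImmGerm I F n :=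
  ⟨fun y => s (x + y), h.1, h.2⟩

theorem ImmGerm.translate_apply (s : ImmGerm I F n) (x : Vec n) (h : s.IsRegularAt x) (y : Vec n) :
    s.translate x h y = s (x + y) := rfl

theorem ImmGerm.prolong_eq {s : ImmGerm I F n} {x : Vec n} (h : s.IsRegularAt x) (r : ℕ) :
    s.prolong r x = Jet.mk r (s.translate x h) := dif_pos h

theorem ImmGerm.isRegularAt_zero (s : ImmGerm I F n) : s.IsRegularAt 0 := by
  have e : (fun y => s (0 + y)) = s := by funext y; rw [zero_add]
  unfold IsRegularAt
  rw [e]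
  exact ⟨s.smooth, s.immersion⟩

theorem ImmGerm.prolong_zero (s : ImmGerm I F n) (r : ℕ) : s.prolong r 0 = Jet.mk r s := by
  rw [prolong_eq s.isRegularAt_zero]
  congr 1
  unfold translate
  cases s
  congr 1
  funext y
  simp

theorem mfderiv_comp_add_left {W : Type*} [NormedAddCommGroup W] [NormedSpace ℝ W] {K : Type*}
    [TopologicalSpace K] {J : ModelWithCorners ℝ W K} {N : Type*} [TopologicalSpace N]
    [ChartedSpace K N] {f : Vec n → N} {x : Vec n} {y : Vec n}
    (hf : MDifferentiableAt 𝓘(ℝ, Vec n) J f (x + y)) :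
    mfderiv 𝓘(ℝ, Vec n) J (fun y => f (x + y)) y = mfderiv 𝓘(ℝ, Vec n) J f (x + y) := by
  have h : HasFDerivAt (fun y : Vec n => x + y) (ContinuousLinearMap.id ℝ (Vec n)) y :=
    (hasFDerivAt_id y).const_add x
  exact (HasMFDerivAt.comp y hf.hasMFDerivAt h.hasMFDerivAt).mfderiv

theorem ImmGerm.isRegularAt_iff {s : ImmGerm I F n} {x : Vec n}
    (h : ∀ᶠ y in 𝓝 x, ContMDiffAt 𝓘(ℝ, Vec n) I ∞ s y) :
    s.IsRegularAt x ↔ Injective (mfderiv 𝓘(ℝ, Vec n) I s x) := by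
  have hx := h.self_of_nhds.mdifferentiableAt (by simp)
  have e : mfderiv 𝓘(ℝ, Vec n) I (fun y => s (x + y)) 0 = mfderiv 𝓘(ℝ, Vec n) I s (x + 0) :=
    mfderiv_comp_add_left (by simpa using hx)
  have e2 : Injective (mfderiv 𝓘(ℝ, Vec n) I s (x + 0)) ↔
      Injective (mfderiv 𝓘(ℝ, Vec n) I s x) := by rw [add_zero]
  have e3 : Injective (mfderiv 𝓘(ℝ, Vec n) I (fun y => s (x + y)) 0) ↔
      Injective (mfderiv 𝓘(ℝ, Vec n) I s (x + 0)) :=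
    iff_of_eq (congrArg (fun L : Vec n →L[ℝ] V => Injective L) e)
  unfold IsRegularAt
  refine (and_congr_right fun _ => e3.trans e2).trans (and_iff_right_iff_imp.2 fun _ => ?_)
  have c : ContinuousAt (fun y : Vec n => x + y) 0 := by fun_prop
  rw [ContinuousAt, add_zero] at c
  filter_upwards [c.eventually h] with y hy
  have : ContDiffAt ℝ ∞ (fun y : Vec n => x + y) y := by fun_prop
  exact ContMDiffAt.comp y hy this.contMDiffAt

theorem injective_mfderiv_of_comp {s : Vec n → F} {W : Type*} [NormedAddCommGroup W]
    [NormedSpace ℝ W] {G : F → W} {x : Vec n} (hG : MDifferentiableAt I 𝓘(ℝ, W) G (s x))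
    (hs : MDifferentiableAt 𝓘(ℝ, Vec n) I s x) (h : Injective (fderiv ℝ (G ∘ s) x)) :
    Injective (mfderiv 𝓘(ℝ, Vec n) I s x) := by
  rw [← mfderiv_eq_fderiv, mfderiv_comp x hG hs] at h
  exact Injective.of_comp h

theorem injective_fderiv_chart_comp {s : Vec n → F} {x : Vec n} {c : F}
    (hc : s x ∈ (extChartAt I c).source) (hs : MDifferentiableAt 𝓘(ℝ, Vec n) I s x)
    (h : Injective (mfderiv 𝓘(ℝ, Vec n) I s x)) :
    Injective (fderiv ℝ (extChartAt I c ∘ s) x) := by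
  have h1 : MDifferentiableAt I 𝓘(ℝ, V) (extChartAt I c) (s x) :=
    (eventually_contMDiffAt_extChartAt hc).self_of_nhds.mdifferentiableAt (by simp)
  rw [← mfderiv_eq_fderiv, mfderiv_comp x h1 hs]
  have := (isInvertible_mfderiv_extChartAt (I := I) hc).injective
  exact this.comp h

/-- Injectivity is an open condition on linear maps, and the derivative of `s`, read in one fixed
chart, is continuous. -/
theorem ImmGerm.eventually_isRegularAt (s : ImmGerm I F n) :
    ∀ᶠ x in 𝓝 (0 : Vec n), s.IsRegularAt x := by
  have hs : SmoothNear (extChartAt I (s 0) ∘ s) 0 :=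
    s.smoothNear_comp (eventually_contMDiffAt_extChartAt (mem_extChartAt_source _))
  have hi := injective_fderiv_chart_comp (mem_extChartAt_source (s 0))
    (s.smooth.self_of_nhds.mdifferentiableAt (by simp)) s.immersion
  have hc : ContinuousAt (fderiv ℝ (extChartAt I (s 0) ∘ s)) 0 :=
    hs.self.continuousAt_fderiv (by simp)
  have hsrc := s.smooth.self_of_nhds.continuousAt.eventually
    (eventually_contMDiffAt_extChartAt (I := I) (mem_extChartAt_source (s 0)))
  filter_upwards [hc.eventually (ContinuousLinearMap.isOpen_injective.mem_nhds hi),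
    eventually_eventually_nhds.2 s.smooth, hsrc] with x h1 h2 h3
  rw [isRegularAt_iff h2]
  exact injective_mfderiv_of_comp (h3.mdifferentiableAt (by simp))
    (h2.self_of_nhds.mdifferentiableAt (by simp)) h1

theorem ImmGerm.proj_prolong (s : ImmGerm I F n) {r k : ℕ} (h : k ≤ r) (x : Vec n) :
    (s.prolong r x).proj h = s.prolong k x := by
  by_cases hx : s.IsRegularAt x
  · rw [prolong_eq hx, prolong_eq hx]; rfl
  -- At points that are not regular `prolong` takes its default value, the jet of `s` itself, and
  -- this too is compatible with projection.
  · rw [show s.prolong r x = Jet.mk r s from dif_neg hx,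
      show s.prolong k x = Jet.mk k s from dif_neg hx]
    rfl

theorem Jet.proj_mk {r k : ℕ} (h : k ≤ r) (s : ImmGerm I F n) :
    (Jet.mk r s).proj h = Jet.mk k s := rfl

theorem Jet.base_mk {r : ℕ} (s : ImmGerm I F n) : (Jet.mk r s).base = s 0 := rfl

theorem Jet.exists_mk {r : ℕ} (θ : Jet I F n r) : ∃ s, Jet.mk r s = θ := Quotient.exists_rep θ

theorem Jet.proj_self {r : ℕ} (h : r ≤ r) (θ : Jet I F n r) : θ.proj h = θ := by
  obtain ⟨s, rfl⟩ := θ.exists_mk; rfl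

theorem Jet.base_proj {r k : ℕ} (h : k ≤ r) (θ : Jet I F n r) : (θ.proj h).base = θ.base := by
  obtain ⟨s, rfl⟩ := θ.exists_mk; rfl

theorem ImmGerm.base_prolong {s : ImmGerm I F n} {x : Vec n} (hx : s.IsRegularAt x) (r : ℕ) :
    (s.prolong r x).base = s x := by
  rw [prolong_eq hx, Jet.base_mk, translate_apply, add_zero]

theorem Jet.mk_zero_eq_iff {s s' : ImmGerm I F n} : Jet.mk 0 s = Jet.mk 0 s' ↔ s 0 = s' 0 := by
  refine ⟨fun h => congrArg Jet.base h, fun h => ?_⟩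
  rw [Jet.mk_eq_iff]
  refine ⟨h, id, IsReparam.id, fun k hk => ?_⟩
  obtain rfl : k = 0 := by omega
  ext v
  simp [h]

theorem Jet.base_injective : Injective (Jet.base : Jet I F n 0 → F) := by
  intro θ θ' h
  obtain ⟨s, rfl⟩ := θ.exists_mk
  obtain ⟨s', rfl⟩ := θ'.exists_mk
  exact Jet.mk_zero_eq_iff.2 h

/-- Jets do not depend on the parametrization. -/
theorem Jet.mk_eq_of_eventuallyEq {r : ℕ} {s s' : ImmGerm I F n} {ψ : Vec n → Vec n}
    (hψ : IsReparam ψ) (h : s =ᶠ[𝓝 0] s' ∘ ψ) : Jet.mk r s = Jet.mk r s' := by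
  symm
  rw [Jet.mk_eq_iff]
  refine ⟨by simpa [hψ.map_zero] using h.self_of_nhds.symm, ψ, hψ, JetEqAt.of_eventuallyEq ?_⟩
  filter_upwards [h] with x hx
  simp [hx]

/-- Needed to compare prolongations away from the center: the germs at `x` and at `ψ x` differ by
`ψ`, moved so as to fix `0`. -/
theorem IsReparam.translate {ψ : Vec n → Vec n} {x : Vec n} (h : SmoothNear ψ x)
    (hi : Injective (fderiv ℝ ψ x)) : IsReparam fun y => ψ (x + y) - ψ x where
  smooth := by
    have h1 : SmoothNear (fun y => ψ (x + y)) 0 :=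
      SmoothNear.comp (g := ψ) (f := fun y : Vec n => x + y) (by simp) h
        (ContDiff.smoothNear (by fun_prop) 0)
    exact h1.mono fun y hy => hy.sub contDiffAt_const
  map_zero := by simp
  injective := by
    rw [fderiv_sub_const, fderiv_comp_add_left, add_zero]
    exact hi

theorem SmoothNear.eventually {A B : Type*} [NormedAddCommGroup A] [NormedSpace ℝ A]
    [NormedAddCommGroup B] [NormedSpace ℝ B] {f : A → B} {x : A} (h : SmoothNear f x) :
    ∀ᶠ y in 𝓝 x, SmoothNear f y := eventually_eventually_nhds.2 h

theorem IsReparam.tendsto {ψ : Vec n → Vec n} (h : IsReparam ψ) : Tendsto ψ (𝓝 0) (𝓝 0) := by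
  have := h.smooth.self.continuousAt
  rwa [ContinuousAt, h.map_zero] at this

theorem IsReparam.eventually_injective {ψ : Vec n → Vec n} (h : IsReparam ψ) :
    ∀ᶠ x in 𝓝 (0 : Vec n), Injective (fderiv ℝ ψ x) :=
  (h.smooth.self.continuousAt_fderiv (by simp)).eventually
    (ContinuousLinearMap.isOpen_injective.mem_nhds h.injective)

/-- Jets do not see the parametrization at `0`; translating `ψ` gives the same at each nearby point.
-/
theorem ImmGerm.prolong_eventuallyEq {s s' : ImmGerm I F n} {ψ : Vec n → Vec n}
    (hψ : IsReparam ψ) (h : s =ᶠ[𝓝 0] s' ∘ ψ) (r : ℕ) :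
    s.prolong r =ᶠ[𝓝 0] s'.prolong r ∘ ψ := by
  filter_upwards [s.eventually_isRegularAt, hψ.tendsto.eventually s'.eventually_isRegularAt,
    eventually_eventually_nhds.2 h, hψ.smooth.eventually, hψ.eventually_injective]
    with x h1 h2 h3 h4 h5
  rw [comp_apply, prolong_eq h1, prolong_eq h2]
  refine Jet.mk_eq_of_eventuallyEq (IsReparam.translate h4 h5) ?_
  have c : ContinuousAt (fun y : Vec n => x + y) 0 := by fun_prop
  rw [ContinuousAt, add_zero] at c
  filter_upwards [c.eventually h3] with y hy
  simpa [translate_apply] using hy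

/-- Statements proved at the center of a germ are carried to its nearby points through this
identity. -/
theorem ImmGerm.prolong_translate {s : ImmGerm I F n} {x : Vec n} (h : s.IsRegularAt x) (r : ℕ) :
    (s.translate x h).prolong r =ᶠ[𝓝 0] fun y => s.prolong r (x + y) := by
  filter_upwards [(s.translate x h).eventually_isRegularAt] with y hy
  have e : (fun y' => s.translate x h (y + y')) = fun y' => s (x + y + y') := by
    funext y'; rw [translate_apply, add_assoc]
  have hy' : s.IsRegularAt (x + y) := by
    unfold IsRegularAt at hy ⊢
    rwa [e] at hy
  rw [prolong_eq hy, prolong_eq hy']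
  congr 1
  unfold ImmGerm.translate
  congr 1

/-! ### Germs as graphs -/

/-- The `r`-jets of a map, as a curve in the coordinate space. -/
def jetCurve {q : ℕ} (r : ℕ) (x₀ : Vec n) (f : Vec n → Vec q) (x : Vec n) : JetModel n q r :=
  (x₀ + x, taylorOf' r fun y => f (x + y))

theorem smoothNear_comp_add {A B : Type*} [NormedAddCommGroup A] [NormedSpace ℝ A]
    [NormedAddCommGroup B] [NormedSpace ℝ B] {f : A → B} {x : A} (h : SmoothNear f x) :
    SmoothNear (fun w : A × A => f (w.1 + w.2)) (x, 0) :=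
  SmoothNear.comp (g := f) (f := fun w : A × A => w.1 + w.2) (by simp) h
    (ContDiff.smoothNear (by fun_prop) _)

theorem SmoothNear.comp_const_add {A B : Type*} [NormedAddCommGroup A] [NormedSpace ℝ A]
    [NormedAddCommGroup B] [NormedSpace ℝ B] {f : A → B} {x : A} (h : SmoothNear f x) :
    SmoothNear (fun y : A => f (x + y)) 0 :=
  SmoothNear.comp (g := f) (f := fun w : A => x + w) (by simp) h
    (ContDiff.smoothNear (by fun_prop) _)

/-! ### Taylor coefficients along the curve of jets of a map. -/

section JetCurve
variable {q r : ℕ} {x₀ : Vec n} {f : Vec n → Vec q}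

theorem smoothNear_jetCurve {x : Vec n} (hf : SmoothNear f x) : SmoothNear (jetCurve r x₀ f) x :=
  (ContDiff.smoothNear (by fun_prop) _).prodMk (smoothNear_taylorOf' (smoothNear_comp_add hf))

theorem coeff_taylorOf' (hf : SmoothNear f 0) (k : Fin (r + 1)) :
    DerivFamily.coeff k (taylorOf' r f).1 = iteratedFDeriv ℝ k f 0 := by
  unfold taylorOf'
  rw [dif_pos hf]
  rfl

theorem taylorOf'_eq_iff {g : Vec n → Vec q} (hf : SmoothNear f 0) (hg : SmoothNear g 0) :
    taylorOf' r f = taylorOf' r g ↔ JetEqAt r f g 0 := by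
  constructor
  · intro h k hk
    have := congrArg (fun a : TaylorSpace n q r =>
      DerivFamily.coeff ⟨k, Nat.lt_succ_of_le hk⟩ a.1) h
    simpa [coeff_taylorOf' hf, coeff_taylorOf' hg] using this
  · intro h
    ext1
    refine DerivFamily.ext fun k => ?_
    rw [coeff_taylorOf' hf, coeff_taylorOf' hg]
    exact h k (Nat.le_of_lt_succ k.2)

theorem coeff_jetCurve {x : Vec n} (hf : SmoothNear f x) (k : Fin (r + 1)) :
    DerivFamily.coeff k (jetCurve r x₀ f x).2.1 = iteratedFDeriv ℝ k f x := by
  unfold jetCurve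
  rw [coeff_taylorOf' hf.comp_const_add, iteratedFDeriv_comp_add_left, add_zero]

theorem jetCurve_zero : jetCurve r x₀ f 0 = (x₀, taylorOf' r f) := by simp [jetCurve]

theorem taylorOf'_map (z : JetModel n q r) : taylorOf' r z.map = z.2 := by
  ext1
  refine DerivFamily.ext fun k => ?_
  rw [coeff_taylorOf' z.smoothNear_map]
  exact iteratedFDeriv_taylorMap z.2 k

variable (n q r) in
/-- The truncation of Taylor polynomials. -/
def truncate : TaylorSpace n q (r + 1) →ₗ[ℝ] DerivFamily n q r where
  toFun a k := DerivFamily.coeff k.castSucc a.1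
  map_add' _ _ := rfl
  map_smul' _ _ := rfl

/-- Currying of a multilinear map in the first variable. -/
def curryFirst (k : ℕ) :
    ContinuousMultilinearMap ℝ (fun _ : Fin (k + 1) => Vec n) (Vec q) →ₗ[ℝ]
      (Vec n →L[ℝ] ContinuousMultilinearMap ℝ (fun _ : Fin k => Vec n) (Vec q)) :=
  (continuousMultilinearCurryLeftEquiv ℝ (fun _ : Fin (k + 1) => Vec n) (Vec q)).toLinearEquiv

theorem hasFDerivAt_iteratedFDeriv {x : Vec n} (hf : SmoothNear f x) (k : ℕ) :
    HasFDerivAt (iteratedFDeriv ℝ k f) (curryFirst k (iteratedFDeriv ℝ (k + 1) f x)) x := by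
  have h : DifferentiableAt ℝ (iteratedFDeriv ℝ k f) x :=
    hf.self.differentiableAt_iteratedFDeriv (by exact_mod_cast ENat.natCast_lt_top k)
  have := h.hasFDerivAt
  rw [fderiv_iteratedFDeriv] at this
  exact this

end JetCurve
end

end GrassmannJet

namespace GrassmannJet

noncomputable section

/-! ### Recovering the next jet from the derivative of the curve of jets. -/

section JetCurve
variable {n q r : ℕ} {x₀ : Vec n} {f : Vec n → Vec q}

variable (n q r) in
/-- The first derivatives of a Taylor polynomial, as a family of Taylor polynomials of lower
order. -/
def jetDerivative : TaylorSpace n q (r + 1) →ₗ[ℝ] Vec n →L[ℝ] DerivFamily n q r where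
  toFun a := ContinuousLinearMap.pi (φ := fun k : Fin (r + 1) =>
    ContinuousMultilinearMap ℝ (fun _ : Fin k => Vec n) (Vec q)) fun k =>
      curryFirst (k : ℕ) (DerivFamily.coeff k.succ a.1)
  map_add' _ _ := by
    ext1 v
    funext k
    exact congrArg (fun L => L v) (map_add (curryFirst (k : ℕ)) _ _)
  map_smul' t a := by
    ext1 v
    funext k
    exact congrArg (fun L => L v) (map_smul (curryFirst (k : ℕ)) t _)

/-- The derivative is computed in the ambient space of families, one coefficient at a time: the
derivative of `Dᵏf` is `Dᵏ⁺¹f`, curried in its first variable. -/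
theorem hasFDerivAt_jetCurve_coe {x : Vec n} (hf : SmoothNear f x) :
    HasFDerivAt (fun y => ((jetCurve r x₀ f y).2.1 : DerivFamily n q r))
      (jetDerivative n q r (jetCurve (r + 1) x₀ f x).2) x := by
  refine (hasFDerivAt_pi (F' := fun k : Fin (r + 1) =>
    ContinuousMultilinearMap ℝ (fun _ : Fin k => Vec n) (Vec q))
    (φ := fun k y => DerivFamily.coeff k (jetCurve r x₀ f y).2.1)
    (φ' := fun k => curryFirst (k : ℕ) (DerivFamily.coeff k.succ (jetCurve (r + 1) x₀ f x).2.1))).2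
    fun k => ?_
  rw [coeff_jetCurve (r := r + 1) hf]
  refine (hasFDerivAt_iteratedFDeriv hf k).congr_of_eventuallyEq ?_
  filter_upwards [hf.eventually] with y hy using coeff_jetCurve hy k

theorem hasFDerivAt_jetCurve {x : Vec n} (hf : SmoothNear f x) :
    HasFDerivAt (jetCurve r x₀ f) (fderiv ℝ (jetCurve r x₀ f) x) x :=
  ((smoothNear_jetCurve hf).self.differentiableAt (by simp)).hasFDerivAt

theorem fderiv_jetCurve_fst {x : Vec n} (hf : SmoothNear f x) (v : Vec n) :
    (fderiv ℝ (jetCurve r x₀ f) x v).1 = v := by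
  have h1 := (hasFDerivAt_jetCurve (r := r) (x₀ := x₀) hf).fst
  have h2 : HasFDerivAt (fun y : Vec n => x₀ + y) (ContinuousLinearMap.id ℝ (Vec n)) x :=
    (hasFDerivAt_id x).const_add x₀
  exact congrArg (fun L => L v) (h1.unique h2)

theorem fderiv_jetCurve_snd {x : Vec n} (hf : SmoothNear f x) (v : Vec n) :
    ((fderiv ℝ (jetCurve r x₀ f) x v).2 : DerivFamily n q r) =
      jetDerivative n q r (jetCurve (r + 1) x₀ f x).2 v := by
  have h1 := (TaylorSpace n q r).subtypeL.hasFDerivAt.comp x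
    (hasFDerivAt_jetCurve (r := r) (x₀ := x₀) hf).snd
  exact congrArg (fun L => L v) (h1.unique (hasFDerivAt_jetCurve_coe (r := r) (x₀ := x₀) hf))

theorem truncate_jetCurve {x : Vec n} (hf : SmoothNear f x) :
    truncate n q r (jetCurve (r + 1) x₀ f x).2 = (jetCurve r x₀ f x).2.1 := by
  refine DerivFamily.ext fun k => ?_
  rw [coeff_jetCurve hf]
  exact coeff_jetCurve hf k.castSucc

variable (n q r) in
-- The constant coefficient survives in the truncation, and each coefficient of positive order is
-- recovered by uncurrying the derivative.
theorem injective_truncate_prod_jetDerivative :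
    Injective ((truncate n q r).prod (jetDerivative n q r)) := by
  intro a b h
  have h1 : truncate n q r a = truncate n q r b := congrArg Prod.fst h
  have h2 : jetDerivative n q r a = jetDerivative n q r b := congrArg Prod.snd h
  ext1
  refine DerivFamily.ext fun k => ?_
  induction k using Fin.cases with
  | zero => exact congrArg (DerivFamily.coeff (0 : Fin (r + 1))) h1
  | succ k =>
    have : curryFirst (k : ℕ) (DerivFamily.coeff k.succ a.1) =
        curryFirst (k : ℕ) (DerivFamily.coeff k.succ b.1) := by
      ext1 v
      exact congrArg (DerivFamily.coeff k) (congrArg (fun L => L v) h2)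
    exact (continuousMultilinearCurryLeftEquiv ℝ (fun _ : Fin ((k : ℕ) + 1) => Vec n) (Vec q)).injective this

/-- A Taylor polynomial is determined by its truncation and its derivatives. -/
theorem exists_taylor_reconstruction (n q r : ℕ) :
    ∃ Λ : TaylorSpace n q r × (Vec n →L[ℝ] JetModel n q r) →L[ℝ] TaylorSpace n q (r + 1),
      ∀ (f : Vec n → Vec q) (x₀ : Vec n), SmoothNear f 0 →
        Λ ((jetCurve r x₀ f 0).2, fderiv ℝ (jetCurve r x₀ f) 0) = taylorOf' (r + 1) f := by
  -- A linear injection has a linear left inverse, continuous here because its domain is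
  -- finite-dimensional. This makes the reconstruction smooth and independent of `x₀`.
  obtain ⟨L, hL⟩ := LinearMap.exists_leftInverse_of_injective _
    (LinearMap.ker_eq_bot.2 (injective_truncate_prod_jetDerivative n q r))
  let Q : JetModel n q r →L[ℝ] DerivFamily n q r :=
    (TaylorSpace n q r).subtypeL.comp (ContinuousLinearMap.snd ℝ (Vec n) (TaylorSpace n q r))
  let P : TaylorSpace n q r × (Vec n →L[ℝ] JetModel n q r) →L[ℝ]
      DerivFamily n q r × (Vec n →L[ℝ] DerivFamily n q r) :=
    (TaylorSpace n q r).subtypeL.prodMap (ContinuousLinearMap.compL ℝ _ _ _ Q)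
  refine ⟨(LinearMap.toContinuousLinearMap L).comp P, fun f x₀ hf => ?_⟩
  have e : P ((jetCurve r x₀ f 0).2, fderiv ℝ (jetCurve r x₀ f) 0) =
      (truncate n q r).prod (jetDerivative n q r) (taylorOf' (r + 1) f) := by
    refine Prod.ext ?_ ?_
    · have := truncate_jetCurve (r := r) (x₀ := x₀) hf
      rw [jetCurve_zero] at this
      exact this.symm
    · ext1 v
      have := fderiv_jetCurve_snd (r := r) (x₀ := x₀) hf v
      rw [jetCurve_zero] at this
      exact this
  show L (P _) = _
  rw [e]
  exact congrArg (fun M => M (taylorOf' (r + 1) f)) hL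

/-- The derivative of the curve of jets is determined by the jet of the next order. -/
theorem exists_fderiv_jetCurve_eq (n q r : ℕ) :
    ∃ B : TaylorSpace n q (r + 1) → (Vec n →L[ℝ] JetModel n q r), ContDiff ℝ ∞ B ∧
      ∀ (f : Vec n → Vec q) (x₀ : Vec n), SmoothNear f 0 →
        fderiv ℝ (jetCurve r x₀ f) 0 = B (taylorOf' (r + 1) f) := by
  -- `jetDerivative` has values in the ambient space of families; `L` brings those that are jets
  -- back into `TaylorSpace`.
  obtain ⟨L, hL⟩ := LinearMap.exists_leftInverse_of_injective (TaylorSpace n q r).subtype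
    (Submodule.ker_subtype _)
  let D := LinearMap.toContinuousLinearMap (jetDerivative n q r)
  let N : DerivFamily n q r →L[ℝ] JetModel n q r :=
    (ContinuousLinearMap.inr ℝ (Vec n) (TaylorSpace n q r)).comp (LinearMap.toContinuousLinearMap L)
  -- The summand `inl` is the derivative of the independent variables `x₀ + x`, which is the
  -- identity.
  refine ⟨fun a => ContinuousLinearMap.inl ℝ (Vec n) (TaylorSpace n q r) + N.comp (D a),
    contDiff_const.add (contDiff_const.clm_comp D.contDiff), fun f x₀ hf => ?_⟩
  ext1 v
  have h2 := fderiv_jetCurve_snd (r := r) (x₀ := x₀) hf v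
  rw [jetCurve_zero] at h2
  refine Prod.ext ((fderiv_jetCurve_fst hf v).trans (add_zero v).symm) ?_
  have := congrArg (fun M => M (fderiv ℝ (jetCurve r x₀ f) 0 v).2) hL
  refine this.symm.trans ((congrArg L h2).trans ?_)
  exact (zero_add (L (jetDerivative n q r (taylorOf' (r + 1) f) v))).symm

theorem fderiv_jetCurve_congr {x₁ : Vec n} {g : Vec n → Vec q} (hf : SmoothNear f 0)
    (hg : SmoothNear g 0) (h : taylorOf' (r + 1) f = taylorOf' (r + 1) g) :
    fderiv ℝ (jetCurve r x₀ f) 0 = fderiv ℝ (jetCurve r x₁ g) 0 := by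
  obtain ⟨B, -, hB⟩ := exists_fderiv_jetCurve_eq n q r
  rw [hB f x₀ hf, hB g x₁ hg, h]

theorem taylorOf'_succ_congr {g : Vec n → Vec q} (hf : SmoothNear f 0) (hg : SmoothNear g 0)
    (h : jetCurve r x₀ f 0 = jetCurve r x₀ g 0)
    (h' : fderiv ℝ (jetCurve r x₀ f) 0 = fderiv ℝ (jetCurve r x₀ g) 0) :
    taylorOf' (r + 1) f = taylorOf' (r + 1) g := by
  obtain ⟨Λ, hΛ⟩ := exists_taylor_reconstruction n q r
  rw [← hΛ f x₀ hf, ← hΛ g x₀ hg, h, h']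

end JetCurve

variable {V : Type*} [NormedAddCommGroup V] [NormedSpace ℝ V] [FiniteDimensional ℝ V]
  {H : Type*} [TopologicalSpace H] {I : ModelWithCorners ℝ V H}
  {F : Type*} [TopologicalSpace F] [ChartedSpace H F] {n : ℕ} [IsManifold I ∞ F] [I.Boundaryless]

/-! ### Planes of prolonged submanifolds in jet charts; jets and their `R`-planes. -/

section
variable {c : F} {A : Splitting V n} {r : ℕ} {x₀ : Vec n}
  {f : Vec n → Vec (Module.finrank ℝ V - n)} {ψ : Vec n → Vec n}

/-- The germ `s` is, after the change of parameters `ψ`, the graph of `f`. -/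
structure ImmGerm.IsGraph (c : F) (A : Splitting V n) (x₀ : Vec n)
    (f : Vec n → Vec (Module.finrank ℝ V - n)) (ψ : Vec n → Vec n) (s : ImmGerm I F n) :
    Prop where
  smooth : SmoothNear f 0
  mem : (x₀, f 0) ∈ (dividedChart (I := I) c A).target
  reparam : IsReparam ψ
  eq : s =ᶠ[𝓝 0] graphGerm c A x₀ f smooth mem ∘ ψ

/-- Transversality to the fibres of divided coordinates. -/
def ImmGerm.IsTransverse (c : F) (A : Splitting V n) (s : ImmGerm I F n) : Prop :=
  s 0 ∈ (dividedChart (I := I) c A).source ∧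
    Injective (fderiv ℝ (fun x => (dividedChart (I := I) c A (s x)).1) 0)

theorem ImmGerm.IsTransverse.exists_isGraph {s : ImmGerm I F n} (h : s.IsTransverse c A) :
    ∃ x₀ f ψ, s.IsGraph c A x₀ f ψ := by
  obtain ⟨hs, hi⟩ := h
  set e := dividedChart (I := I) c A with he
  have hG : SmoothNear (e ∘ s) 0 := s.smoothNear_comp (eventually_contMDiffAt_dividedChart hs)
  have h1 : SmoothNear (fun x => (e (s x)).1) 0 := hG.mono fun x hx => hx.fst
  have h2 : SmoothNear (fun x => (e (s x)).2) 0 := hG.mono fun x hx => hx.snd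
  set x₀ := (e (s 0)).1 with hx₀
  -- The independent variables along `s`, shifted to vanish at `0`, serve as the new parameter;
  -- transversality makes this a change of parameters.
  have hψ : IsReparam fun x => (e (s x)).1 - x₀ :=
    { smooth := h1.mono fun x hx => hx.sub contDiffAt_const
      map_zero := by simp [hx₀]
      injective := by rw [fderiv_sub_const]; exact hi }
  obtain ⟨χ, hχ, -, i2⟩ := hψ.exists_inverse
  have hf : SmoothNear (fun x => (e (s (χ x))).2) 0 :=
    SmoothNear.comp (g := fun x => (e (s x)).2) hχ.map_zero h2 hχ.smooth
  have ht : (x₀, (e (s (χ 0))).2) ∈ e.target := by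
    rw [hχ.map_zero]; exact e.map_source hs
  refine ⟨x₀, _, _, hf, ht, hψ, ?_⟩
  filter_upwards [i2, s.smooth.self_of_nhds.continuousAt.preimage_mem_nhds
    (isOpen_dividedChart_source.mem_nhds hs)] with x hx hx'
  have : graphGerm c A x₀ (fun x => (e (s (χ x))).2) hf ht ((e (s x)).1 - x₀) =
      e.symm (x₀ + ((e (s x)).1 - x₀), (e (s (χ ((e (s x)).1 - x₀)))).2) := rfl
  rw [comp_apply, this, hx, add_sub_cancel]
  exact (e.left_inv hx').symm

/-- Contact of positive order preserves the first derivative up to a change of parameters, so every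
representative of a jet in the domain of the chart is transverse. For `r = 0` contact fixes only the
base point. -/
theorem ImmGerm.isTransverse_of_mem_source {s : ImmGerm I F n} (hr : r ≠ 0)
    (h : Jet.mk r s ∈ (jetChart (I := I) r c A).source) : s.IsTransverse c A := by
  obtain ⟨z, hz, hzs⟩ := h
  unfold graphJet at hzs
  rw [dif_pos hz, Jet.mk_eq_iff] at hzs
  have h0 : s 0 ∈ (GrassmannJet.dividedChart (I := I) c A).source := by
    rw [← hzs.1]; exact graphGerm_zero_mem _ hz
  refine ⟨h0, ?_⟩
  obtain ⟨φ, hφ, h⟩ := hzs.dividedChart (c := c) (A := A) (graphGerm_zero_mem _ hz)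
  have h := (JetEqAt.of_eventuallyEq (contact_graphGerm hz hφ)).symm.trans h
  have d1 := h.fderiv_eq hr
  have s1 : SmoothNear (fun x => z.1 + φ x) 0 :=
    hφ.smooth.mono fun x hx => contDiffAt_const.add hx
  have s2 : SmoothNear (z.map ∘ φ) 0 := SmoothNear.comp hφ.map_zero z.smoothNear_map hφ.smooth
  have s3 : SmoothNear (GrassmannJet.dividedChart (I := I) c A ∘ s) 0 :=
    s.smoothNear_comp (eventually_contMDiffAt_dividedChart h0)
  have a1 := ((s1.prodMk s2).self.differentiableAt (by simp)).hasFDerivAt.fst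
  have a2 := (s3.self.differentiableAt (by simp)).hasFDerivAt.fst
  have a3 : HasFDerivAt (fun x => z.1 + φ x) (fderiv ℝ φ 0) 0 :=
    ((hφ.smooth.self.differentiableAt (by simp)).hasFDerivAt).const_add _
  have e1 := a1.unique a3
  have e2 : fderiv ℝ (fun x => (GrassmannJet.dividedChart (I := I) c A (s x)).1) 0 =
      fderiv ℝ φ 0 := by
    refine a2.fderiv.trans ?_
    rw [← e1]
    congr 1
    exact d1.symm
  rw [e2]
  exact hφ.injective

theorem ImmGerm.IsGraph.mk_eq {s : ImmGerm I F n} (h : s.IsGraph c A x₀ f ψ) (r : ℕ) :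
    jetCurve r x₀ f 0 ∈ jetTarget (I := I) r c A ∧
      Jet.mk r s = graphJet r c A (jetCurve r x₀ f 0) := by
  rw [jetCurve_zero]
  have := mk_graphGerm (I := I) (r := r) h.smooth h.mem
  exact ⟨this.1, (Jet.mk_eq_of_eventuallyEq h.reparam h.eq).trans this.2⟩

theorem ImmGerm.IsGraph.mk_mem_source {s : ImmGerm I F n} (h : s.IsGraph c A x₀ f ψ) (r : ℕ) :
    Jet.mk r s ∈ (jetChart (I := I) r c A).source := by
  rw [(h.mk_eq r).2]; exact graphJet_mem_source (h.mk_eq r).1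

theorem ImmGerm.IsGraph.jetChart_mk {s : ImmGerm I F n} (h : s.IsGraph c A x₀ f ψ) (r : ℕ) :
    jetChart r c A (Jet.mk r s) = jetCurve r x₀ f 0 := by
  rw [(h.mk_eq r).2, jetChart_graphJet (h.mk_eq r).1]

theorem ImmGerm.IsGraph.eventually_mem {s : ImmGerm I F n} (h : s.IsGraph c A x₀ f ψ) (r : ℕ) :
    ∀ᶠ x in 𝓝 (0 : Vec n), jetCurve r x₀ f x ∈ jetTarget (I := I) r c A :=
  (smoothNear_jetCurve h.smooth).self.continuousAt.eventually
    (isOpen_jetTarget.mem_nhds (h.mk_eq r).1)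

/-- The germ at `x` of the graph of `f` is the graph of `f (x + ·)` over the point `x₀ + x`. -/
theorem prolong_graphGerm (hf : SmoothNear f 0)
    (h : (x₀, f 0) ∈ (dividedChart (I := I) c A).target) (r : ℕ) :
    (graphGerm c A x₀ f hf h).prolong r =ᶠ[𝓝 0] graphJet r c A ∘ jetCurve r x₀ f := by
  filter_upwards [(graphGerm c A x₀ f hf h).eventually_isRegularAt, hf.eventually,
    dividedChart_graphMap hf h] with x h1 h2 h3
  have ht : (x₀ + x, f (x + 0)) ∈ (dividedChart (I := I) c A).target := by
    rw [add_zero]; exact h3.1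
  rw [comp_apply, ImmGerm.prolong_eq h1, jetCurve,
    ← (mk_graphGerm (I := I) (r := r) h2.comp_const_add ht).2]
  congr 1
  unfold ImmGerm.translate
  congr 1
  funext y
  show (dividedChart (I := I) c A).symm _ = (dividedChart (I := I) c A).symm _
  rw [add_assoc]

theorem ImmGerm.IsGraph.prolong_eq {s : ImmGerm I F n} (h : s.IsGraph c A x₀ f ψ) (r : ℕ) :
    s.prolong r =ᶠ[𝓝 0] graphJet r c A ∘ jetCurve r x₀ f ∘ ψ := by
  refine (ImmGerm.prolong_eventuallyEq h.reparam h.eq r).trans ?_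
  exact h.reparam.tendsto.eventually (prolong_graphGerm h.smooth h.mem r)

theorem contMDiffAt_graphJet_comp {X : Type*} [NormedAddCommGroup X] [NormedSpace ℝ X]
    {g : X → JetModel n (Module.finrank ℝ V - n) r} {x : X} (hg : ContDiffAt ℝ ∞ g x)
    (h : g x ∈ jetTarget (I := I) r c A) :
    ContMDiffAt 𝓘(ℝ, X) (jetI V n r) ∞ (graphJet (I := I) r c A ∘ g) x :=
  ContMDiffAt.comp x (contMDiffAt_graphJet h) hg.contMDiffAt

/-- In jet coordinates the plane is the range of the derivative of the curve of jets; the change of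
parameters drops out. -/
theorem ImmGerm.IsGraph.tangentPlane_prolong {s : ImmGerm I F n} (h : s.IsGraph c A x₀ f ψ)
    (r : ℕ) : tangentPlane (jetI V n r) (s.prolong r) 0 = range fun v : Vec n =>
      tangentMap (jetI V n r) (jetI V n r) (graphJet (I := I) r c A)
        (⟨jetCurve r x₀ f 0, fderiv ℝ (jetCurve r x₀ f) 0 v⟩ :
          TangentBundle (jetI V n r) (JetModel n (Module.finrank ℝ V - n) r)) := by
  have hs := smoothNear_jetCurve (r := r) (x₀ := x₀) h.smooth
  rw [tangentPlane_congr (h.prolong_eq r), ← comp_assoc,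
    tangentPlane_comp_reparam h.reparam.map_zero
      ((contMDiffAt_graphJet_comp hs.self (h.mk_eq r).1).mdifferentiableAt (by simp))
      (h.reparam.smooth.self.differentiableAt (by simp)) h.reparam.injective,
    tangentPlane_eq_range]
  congr 1
  funext v
  rw [tangentMap_comp_at _ ((contMDiffAt_graphJet (h.mk_eq r).1).mdifferentiableAt (by simp))
    (hs.self.differentiableAt (by simp)).mdifferentiableAt]
  congr 1
  exact tangentBundle_mk_eq (J₁ := jetI V n r) rfl (by rw [mfderiv_eq_fderiv]; rfl)

theorem range_eq_of_range_mk_eq {W : Type*} [NormedAddCommGroup W] [NormedSpace ℝ W]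
    {z z' : W} {u u' : Vec n → W}
    (h : (range fun v => (⟨z, u v⟩ : TangentBundle 𝓘(ℝ, W) W)) = range fun v => ⟨z', u' v⟩) :
    range u = range u' := by
  have e {z z' w w' : W} (h : (⟨z, w⟩ : TangentBundle 𝓘(ℝ, W) W) = ⟨z', w'⟩) : w = w' := by
    cases h; rfl
  ext w
  constructor
  · rintro ⟨v, rfl⟩
    obtain ⟨v', hv'⟩ := h.subset ⟨v, rfl⟩
    exact ⟨v', e hv'⟩
  · rintro ⟨v, rfl⟩
    obtain ⟨v', hv'⟩ := h.superset ⟨v, rfl⟩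
    exact ⟨v', e hv'⟩

theorem tangentPlane_normed {W : Type*} [NormedAddCommGroup W] [NormedSpace ℝ W] (f : Vec n → W)
    (x : Vec n) : tangentPlane 𝓘(ℝ, W) f x =
      range fun v => (⟨f x, fderiv ℝ f x v⟩ : TangentBundle 𝓘(ℝ, W) W) := by
  rw [← mfderiv_eq_fderiv]; rfl

/-- The splitting takes the image of the derivative of `s` as the space of independent variables and
any complement as that of the dependent ones. -/
theorem ImmGerm.exists_isTransverse (s : ImmGerm I F n) : ∃ A, s.IsTransverse (s 0) A := by
  set L := fderiv ℝ (extChartAt I (s 0) ∘ s) 0 with hL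
  have hs : SmoothNear (extChartAt I (s 0) ∘ s) 0 :=
    s.smoothNear_comp (eventually_contMDiffAt_extChartAt (mem_extChartAt_source _))
  have hLd : HasFDerivAt (extChartAt I (s 0) ∘ s) L 0 :=
    (hs.self.differentiableAt (by simp)).hasFDerivAt
  have hLinj : Injective L := injective_fderiv_chart_comp (mem_extChartAt_source (s 0))
    (s.smooth.self_of_nhds.mdifferentiableAt (by simp)) s.immersion
  let Lₗ : Vec n →ₗ[ℝ] V := L
  obtain ⟨W, hW⟩ := Submodule.exists_isCompl (LinearMap.range Lₗ)
  let e₁ : Vec n ≃ₗ[ℝ] LinearMap.range Lₗ := LinearEquiv.ofInjective Lₗ hLinj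
  have hdim : Module.finrank ℝ W = Module.finrank ℝ (Vec (Module.finrank ℝ V - n)) := by
    have k1 := Submodule.finrank_add_eq_of_isCompl hW
    have k2 := e₁.finrank_eq
    rw [finrank_euclideanSpace_fin] at k2 ⊢
    omega
  let e₂ : W ≃ₗ[ℝ] Vec (Module.finrank ℝ V - n) := LinearEquiv.ofFinrankEq _ _ hdim
  let A : Splitting V n := ((Submodule.prodEquivOfIsCompl _ _ hW).symm.trans
    (e₁.symm.prodCongr e₂)).toContinuousLinearEquiv
  have hA : ∀ v, (A (L v)).1 = v := by
    intro v
    have k1 : (Submodule.prodEquivOfIsCompl _ _ hW).symm (L v) = (e₁ v, 0) :=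
      Submodule.prodEquivOfIsCompl_symm_apply_left _ _ hW (e₁ v)
    show e₁.symm ((Submodule.prodEquivOfIsCompl _ _ hW).symm (L v)).1 = v
    rw [k1]
    simp
  refine ⟨A, mem_extChartAt_source _, ?_⟩
  have k : HasFDerivAt (fun x => (dividedChart (I := I) (s 0) A (s x)).1)
      ((ContinuousLinearMap.fst ℝ (Vec n) (Vec (Module.finrank ℝ V - n))).comp
        ((A : V →L[ℝ] Vec n × Vec (Module.finrank ℝ V - n)).comp L)) 0 :=
    (A.hasFDerivAt.comp 0 hLd).fst
  rw [k.fderiv]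
  intro u v huv
  exact (hA u).symm.trans (huv.trans (hA v))

theorem ImmGerm.exists_isGraph (s : ImmGerm I F n) : ∃ A x₀ f ψ, s.IsGraph (s 0) A x₀ f ψ := by
  obtain ⟨A, hA⟩ := s.exists_isTransverse
  exact ⟨A, hA.exists_isGraph⟩

theorem ImmGerm.exists_isGraph_of_mem_source {s : ImmGerm I F n} (hr : r ≠ 0)
    (h : Jet.mk r s ∈ (jetChart (I := I) r c A).source) : ∃ x₀ f ψ, s.IsGraph c A x₀ f ψ :=
  (isTransverse_of_mem_source hr h).exists_isGraph

/-- The derivative of the curve of `r`-jets is a function of the `(r + 1)`-jet. Hence the `R`-plane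
may be computed from any representative. -/
theorem tangentPlane_prolong_congr {s s' : ImmGerm I F n}
    (h : Jet.mk (r + 1) s = Jet.mk (r + 1) s') :
    tangentPlane (jetI V n r) (s.prolong r) 0 = tangentPlane (jetI V n r) (s'.prolong r) 0 := by
  obtain ⟨A, x₀, f, ψ, hs⟩ := s.exists_isGraph
  obtain ⟨x₁, g, χ, hs'⟩ := ImmGerm.exists_isGraph_of_mem_source (s := s') (Nat.succ_ne_zero r)
    (h ▸ hs.mk_mem_source (r + 1))
  have e : jetCurve (r + 1) x₀ f 0 = jetCurve (r + 1) x₁ g 0 := by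
    rw [← hs.jetChart_mk, ← hs'.jetChart_mk, h]
  rw [jetCurve_zero, jetCurve_zero, Prod.mk.injEq] at e
  obtain ⟨rfl, e⟩ := e
  have e' : jetCurve r x₀ f 0 = jetCurve r x₀ g 0 := by
    rw [jetCurve_zero, jetCurve_zero]
    exact Prod.ext rfl ((taylorOf'_eq_iff hs.smooth hs'.smooth).2
      (((taylorOf'_eq_iff hs.smooth hs'.smooth).1 e).mono (Nat.le_succ r)))
  rw [hs.tangentPlane_prolong, hs'.tangentPlane_prolong, e',
    fderiv_jetCurve_congr (x₁ := x₀) hs.smooth hs'.smooth e]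

theorem Jet.RPlane_mk (s : ImmGerm I F n) :
    (Jet.mk (r + 1) s).RPlane = tangentPlane (jetI V n r) (s.prolong r) 0 := by
  ext ξ
  constructor
  · rintro ⟨s', h, hξ⟩
    rwa [tangentPlane_prolong_congr h] at hξ
  · exact fun h => ⟨s, rfl, h⟩

theorem ImmGerm.eventually_contMDiffAt_prolong (s : ImmGerm I F n) (r : ℕ) :
    ∀ᶠ x in 𝓝 (0 : Vec n), ContMDiffAt 𝓘(ℝ, Vec n) (jetI V n r) ∞ (s.prolong r) x := by
  obtain ⟨A, x₀, f, ψ, hs⟩ := s.exists_isGraph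
  have h1 : SmoothNear (jetCurve r x₀ f ∘ ψ) 0 :=
    SmoothNear.comp hs.reparam.map_zero (smoothNear_jetCurve hs.smooth) hs.reparam.smooth
  filter_upwards [h1, eventually_eventually_nhds.2 (hs.prolong_eq r),
    hs.reparam.tendsto.eventually (hs.eventually_mem r)] with x h1 h2 h3
  exact (contMDiffAt_graphJet_comp h1 h3).congr_of_eventuallyEq h2

theorem ImmGerm.mdifferentiableAt_prolong (s : ImmGerm I F n) (r : ℕ) :
    MDifferentiableAt 𝓘(ℝ, Vec n) (jetI V n r) (s.prolong r) 0 :=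
  (s.eventually_contMDiffAt_prolong r).self_of_nhds.mdifferentiableAt (by simp)

/-- In coordinates the projection truncates Taylor polynomials, and the Taylor coefficients of a
smooth family of maps depend smoothly on the parameter. -/
theorem Jet.contMDiff_proj {r k : ℕ} (h : k ≤ r) :
    ContMDiff (jetI V n r) (jetI V n k) ∞ (Jet.proj h : Jet I F n r → Jet I F n k) := by
  intro θ
  obtain ⟨s, rfl⟩ := θ.exists_mk
  obtain ⟨A, x₀, f, ψ, hs⟩ := s.exists_isGraph
  set T : JetModel n (Module.finrank ℝ V - n) r → JetModel n (Module.finrank ℝ V - n) k :=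
    fun z => (z.1, taylorOf' k z.map) with hT
  have hTs (z : JetModel n (Module.finrank ℝ V - n) r) : ContDiffAt ℝ ∞ T z := by
    have h1 : SmoothNear (fun w : JetModel n (Module.finrank ℝ V - n) r × Vec n => w.1.map w.2)
        (z, 0) :=
      SmoothNear.comp (g := taylorMap n (Module.finrank ℝ V - n) r)
        (f := fun w : JetModel n (Module.finrank ℝ V - n) r × Vec n => (w.1.2, w.2)) rfl
        (smoothNear_taylorMap z.2) (ContDiff.smoothNear (by fun_prop) _)
    exact contDiffAt_fst.prodMk (smoothNear_taylorOf' h1).self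
  have e : ∀ z ∈ jetTarget (I := I) r (s 0) A, T z ∈ jetTarget (I := I) k (s 0) A ∧
      Jet.proj h (graphJet (I := I) r (s 0) A z) = graphJet k (s 0) A (T z) := by
    intro z hz
    have := mk_graphGerm (I := I) (r := k) (c := s 0) (A := A) z.smoothNear_map hz
    refine ⟨this.1, Eq.trans ?_ this.2⟩
    unfold graphJet
    rw [dif_pos hz]
    rfl
  have hsrc := hs.mk_mem_source r
  have htgt := jetChart_mem_target hsrc
  have h1 : ContMDiffAt (jetI V n r) (jetI V n k) ∞
      (graphJet (I := I) k (s 0) A ∘ (T ∘ jetChart (I := I) r (s 0) A)) (Jet.mk r s) :=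
    ContMDiffAt.comp _ (contMDiffAt_graphJet (e _ htgt).1)
      (ContMDiffAt.comp _ (hTs _).contMDiffAt (contMDiffAt_jetChart hsrc))
  refine h1.congr_of_eventuallyEq ?_
  filter_upwards [isOpen_jetChart_source.mem_nhds hsrc] with θ hθ
  rw [comp_apply, comp_apply, ← (e _ (jetChart_mem_target hθ)).2, graphJet_jetChart hθ]

theorem base_graphJet {z : JetModel n (Module.finrank ℝ V - n) r}
    (hz : z ∈ jetTarget (I := I) r c A) :
    (graphJet (I := I) r c A z).base = (dividedChart (I := I) c A).symm (z.1, z.map 0) := by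
  unfold graphJet
  rw [dif_pos hz, Jet.base_mk]
  show (dividedChart (I := I) c A).symm _ = _
  rw [add_zero]

theorem dividedChart_base {θ : Jet I F n r} (hθ : θ ∈ (jetChart (I := I) r c A).source) :
    θ.base ∈ (dividedChart (I := I) c A).source ∧ dividedChart (I := I) c A θ.base =
      ((jetChart (I := I) r c A θ).1, (jetChart (I := I) r c A θ).map 0) := by
  have ht := jetChart_mem_target hθ
  have e := base_graphJet ht
  rw [graphJet_jetChart hθ] at e
  rw [e]
  exact ⟨(dividedChart (I := I) c A).map_target ht, (dividedChart (I := I) c A).right_inv ht⟩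

theorem JetModel.contDiff_map_zero {q : ℕ} :
    ContDiff ℝ ∞ fun z : JetModel n q r => z.map 0 :=
  contDiff_iff_contDiffAt.2 fun z => ContDiffAt.comp
    (f := fun z : JetModel n q r => (z.2, (0 : Vec n))) z (smoothNear_taylorMap z.2).self
    (by fun_prop)

theorem Jet.contMDiff_base {r : ℕ} :
    ContMDiff (jetI V n r) I ∞ (Jet.base : Jet I F n r → F) := by
  intro θ
  obtain ⟨s, rfl⟩ := θ.exists_mk
  obtain ⟨A, x₀, f, ψ, hs⟩ := s.exists_isGraph
  have hsrc := hs.mk_mem_source r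
  have htgt := jetChart_mem_target hsrc
  have h0 : ContDiff ℝ ∞ fun z : JetModel n (Module.finrank ℝ V - n) r => (z.1, z.map 0) :=
    contDiff_fst.prodMk JetModel.contDiff_map_zero
  have h1 : ContMDiffAt (jetI V n r) I ∞ ((dividedChart (I := I) (s 0) A).symm ∘
      ((fun z : JetModel n (Module.finrank ℝ V - n) r => (z.1, z.map 0)) ∘
        jetChart (I := I) r (s 0) A)) (Jet.mk r s) :=
    ContMDiffAt.comp _ (contMDiffAt_dividedChart_symm htgt)
      (ContMDiffAt.comp _ h0.contDiffAt.contMDiffAt (contMDiffAt_jetChart hsrc))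
  refine h1.congr_of_eventuallyEq ?_
  filter_upwards [isOpen_jetChart_source.mem_nhds hsrc] with θ hθ
  rw [comp_apply, comp_apply, ← base_graphJet (jetChart_mem_target hθ), graphJet_jetChart hθ]

/-- A jet is determined by its `R`-plane. -/
theorem mk_succ_eq_of_tangentPlane {s s' : ImmGerm I F n}
    (h : tangentPlane (jetI V n r) (s.prolong r) 0 = tangentPlane (jetI V n r) (s'.prolong r) 0) :
    Jet.mk (r + 1) s = Jet.mk (r + 1) s' := by
  obtain ⟨A, hA⟩ := s.exists_isTransverse
  obtain ⟨x₀, f, ψ, hs⟩ := hA.exists_isGraph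
  have h0 : Jet.mk r s = Jet.mk r s' := by
    -- The plane contains the zero vector at its base point, so equal planes lie over the same
    -- `r`-jet.
    have m : tangentMap 𝓘(ℝ, Vec n) (jetI V n r) (s.prolong r)
        (⟨0, 0⟩ : TangentBundle 𝓘(ℝ, Vec n) (Vec n)) ∈
        tangentPlane (jetI V n r) (s.prolong r) 0 := ⟨0, rfl⟩
    rw [h] at m
    obtain ⟨v, hv⟩ := m
    have := congrArg Bundle.TotalSpace.proj hv
    rw [← s.prolong_zero, ← s'.prolong_zero]
    exact this.symm
  have hb : s 0 = s' 0 := congrArg Jet.base h0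
  have hsrc : s 0 ∈ (dividedChart (I := I) (s 0) A).source := mem_extChartAt_source _
  -- For `r = 0` the common `r`-jet says nothing about tangent planes. Transversality of `s'` is
  -- therefore read off from the images of the two planes in the space of independent variables.
  have hA' : s'.IsTransverse (s 0) A := by
    refine ⟨hb ▸ hsrc, ?_⟩
    let X : Jet I F n r → Vec n := fun θ => (dividedChart (I := I) (s 0) A θ.base).1
    have hX : MDifferentiableAt (jetI V n r) 𝓘(ℝ, Vec n) X (Jet.mk r s) := by
      have h1 : ContMDiffAt (jetI V n r) 𝓘(ℝ, Vec n × Vec (Module.finrank ℝ V - n)) ∞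
          (dividedChart (I := I) (s 0) A ∘ Jet.base) (Jet.mk r s) :=
        ContMDiffAt.comp _ (eventually_contMDiffAt_dividedChart hsrc).self_of_nhds
          (Jet.contMDiff_base _)
      exact (ContMDiffAt.comp (Jet.mk r s)
        (contDiff_fst.contMDiff.contMDiffAt (n := ∞)) h1).mdifferentiableAt (by simp)
    have hp (t : ImmGerm I F n) (ht : Jet.mk r t = Jet.mk r s) :
        tangentPlane 𝓘(ℝ, Vec n) (fun x => (dividedChart (I := I) (s 0) A (t x)).1) 0 =
          tangentMap (jetI V n r) 𝓘(ℝ, Vec n) X '' tangentPlane (jetI V n r) (t.prolong r) 0 := by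
      rw [← tangentPlane_comp (by rw [t.prolong_zero, ht]; exact hX) (t.mdifferentiableAt_prolong r)]
      refine tangentPlane_congr ?_
      filter_upwards [t.eventually_isRegularAt] with x hx
      show _ = (dividedChart (I := I) (s 0) A (t.prolong r x).base).1
      rw [ImmGerm.base_prolong hx]
    have e := (hp s rfl).trans ((congrArg _ h).trans (hp s' h0.symm).symm)
    rw [tangentPlane_normed, tangentPlane_normed] at e
    have e := range_eq_of_range_mk_eq e
    have hsurj := surjective_of_injective_endo hA.2
    rw [← range_eq_univ, e, range_eq_univ] at hsurj
    exact (LinearMap.injective_iff_surjective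
      (f := (fderiv ℝ (fun x => (dividedChart (I := I) (s 0) A (s' x)).1) 0 : Vec n →ₗ[ℝ] Vec n))).2
      hsurj
  obtain ⟨x₁, g, χ, hs'⟩ := hA'.exists_isGraph
  have e : jetCurve r x₀ f 0 = jetCurve r x₁ g 0 := by
    rw [← hs.jetChart_mk, ← hs'.jetChart_mk, h0]
  obtain rfl : x₀ = x₁ := by
    rw [jetCurve_zero, jetCurve_zero, Prod.mk.injEq] at e
    exact e.1
  have hd : fderiv ℝ (jetCurve r x₀ f) 0 = fderiv ℝ (jetCurve r x₀ g) 0 := by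
    have k := congrArg (fun S => tangentMap (jetI V n r) (jetI V n r)
      (jetChart (I := I) r (s 0) A) '' S) h
    simp only [hs.tangentPlane_prolong, hs'.tangentPlane_prolong, ← range_comp] at k
    simp only [comp_def, tangentMap_jetChart_graphJet (hs.mk_eq r).1,
      tangentMap_jetChart_graphJet (hs'.mk_eq r).1] at k
    have k := range_eq_of_range_mk_eq k
    ext1 v
    -- Both derivatives have the identity as first component, so they are determined by their
    -- ranges.
    have hv : fderiv ℝ (jetCurve r x₀ f) 0 v ∈ range fun v => fderiv ℝ (jetCurve r x₀ g) 0 v := by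
      rw [← k]; exact ⟨v, rfl⟩
    obtain ⟨u, hu⟩ := hv
    have : u = v := by
      rw [← fderiv_jetCurve_fst (r := r) (x₀ := x₀) hs'.smooth u,
        ← fderiv_jetCurve_fst (r := r) (x₀ := x₀) hs.smooth v]
      exact congrArg Prod.fst hu
    rw [← hu, this]
  have e2 := taylorOf'_succ_congr hs.smooth hs'.smooth e hd
  rw [(hs.mk_eq (r + 1)).2, (hs'.mk_eq (r + 1)).2, jetCurve_zero, jetCurve_zero, e2]

end

end

end GrassmannJet

/-! ### Smooth dependence of jets: from order `r` to order `r + 1`. -/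

namespace GrassmannJet

noncomputable section

variable {V : Type*} [NormedAddCommGroup V] [NormedSpace ℝ V] [FiniteDimensional ℝ V]
  {H : Type*} [TopologicalSpace H] {I : ModelWithCorners ℝ V H}
  {F : Type*} [TopologicalSpace F] [ChartedSpace H F] {n : ℕ} [IsManifold I ∞ F] [I.Boundaryless]

theorem IsReparam.eventually_of_comp {ψ : Vec n → Vec n} (h : IsReparam ψ) {p : Vec n → Prop}
    (hp : ∀ᶠ x in 𝓝 0, p (ψ x)) : ∀ᶠ x in 𝓝 0, p x := by
  obtain ⟨χ, hχ, h1, -⟩ := h.exists_inverse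
  filter_upwards [hχ.tendsto.eventually hp, h1] with x h2 h3
  rwa [h3] at h2

/-- Coordinate expressions of smooth maps between jet spaces. -/
theorem contDiffAt_jetChart_comp {c : F} {A : Splitting V n} {j r : ℕ}
    {g : Jet I F n j → Jet I F n r} {θ : Jet I F n j}
    (hg : ContMDiffAt (jetI V n j) (jetI V n r) ∞ g θ)
    (h1 : θ ∈ (jetChart (I := I) j c A).source) (h2 : g θ ∈ (jetChart (I := I) r c A).source) :
    ContDiffAt ℝ ∞ (jetChart (I := I) r c A ∘ g ∘ graphJet j c A) (jetChart j c A θ) := by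
  have e := graphJet_jetChart h1
  refine ContMDiffAt.contDiffAt (ContMDiffAt.comp (I' := jetI V n r) _ ?_
    (ContMDiffAt.comp (I' := jetI V n j) _ ?_ (contMDiffAt_graphJet (jetChart_mem_target h1))))
  · rw [comp_apply, e]; exact contMDiffAt_jetChart h2
  · rw [e]; exact hg

/-- The coordinate formula for the next jet: `Λ` rebuilds it from a value and a derivative, and the
derivative is that of `g` after the one prescribed by `B`. As `g` is of class `C^∞`, differentiating
it costs nothing. -/
theorem contDiffAt_reconstruction {X Y Z S T : Type*} [NormedAddCommGroup X] [NormedSpace ℝ X]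
    [NormedAddCommGroup Y] [NormedSpace ℝ Y] [NormedAddCommGroup Z] [NormedSpace ℝ Z]
    [NormedAddCommGroup S] [NormedSpace ℝ S] [NormedAddCommGroup T] [NormedSpace ℝ T]
    (Λ : Z × (X →L[ℝ] X × Z) →L[ℝ] T) {B : S → (X →L[ℝ] X × Y)} (hB : ContDiff ℝ ∞ B)
    {g : X × Y → X × Z} {k : X × Y → X × S} {z : X × Y} (hg : ContDiffAt ℝ ∞ g z)
    (hk : ContDiffAt ℝ ∞ k z) :
    ContDiffAt ℝ ∞ (fun z => (z.1, Λ ((g z).2, (fderiv ℝ g z).comp (B (k z).2)))) z := by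
  have h1 : ContDiffAt ℝ ∞ (fun z => (fderiv ℝ g z).comp (B (k z).2)) z :=
    (hg.fderiv_right (m := ∞) (by simp)).clm_comp (hB.comp_contDiffAt z hk.snd)
  exact contDiffAt_fst.prodMk (Λ.contDiff.comp_contDiffAt z (hg.snd.prodMk h1))

/-- If solutions of a system of differential equations are determined by their first jets, then the
smooth dependence of their jets of order `r` implies that of their jets of order `r + 1`. -/
theorem contMDiffAt_of_prolong_eq {r : ℕ} {g : Jet I F n 1 → Jet I F n r}
    {k : Jet I F n 1 → Jet I F n 2} {h : Jet I F n 1 → Jet I F n (r + 1)} {θ₀ : Jet I F n 1}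
    (hg : ContMDiffAt (jetI V n 1) (jetI V n r) ∞ g θ₀)
    (hk : ContMDiffAt (jetI V n 1) (jetI V n 2) ∞ k θ₀)
    (hs : ∀ᶠ θ in 𝓝 θ₀, ∃ s : ImmGerm I F n, Jet.mk 1 s = θ ∧ Jet.mk 2 s = k θ ∧
      Jet.mk (r + 1) s = h θ ∧ s.prolong r =ᶠ[𝓝 0] g ∘ s.prolong 1) :
    ContMDiffAt (jetI V n 1) (jetI V n (r + 1)) ∞ h θ₀ := by
  obtain ⟨s₀, rfl, hs2, hs3, hs4⟩ := hs.self_of_nhds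
  obtain ⟨A, x₀, f₀, ψ₀, hG₀⟩ := s₀.exists_isGraph
  generalize s₀ 0 = c at hG₀
  obtain ⟨Λ, hΛ⟩ := exists_taylor_reconstruction n (Module.finrank ℝ V - n) r
  obtain ⟨B, hB, hB'⟩ := exists_fderiv_jetCurve_eq n (Module.finrank ℝ V - n) 1
  have hsrc := hG₀.mk_mem_source 1
  have hgs : g (Jet.mk 1 s₀) = Jet.mk r s₀ := by
    have := hs4.self_of_nhds
    rw [comp_apply, s₀.prolong_zero, s₀.prolong_zero] at this
    exact this.symm
  set ĝ := jetChart (I := I) r c A ∘ g ∘ graphJet 1 c A with hĝ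
  set k' := jetChart (I := I) 2 c A ∘ k ∘ graphJet 1 c A with hk'
  set z₀ := jetChart (I := I) 1 c A (Jet.mk 1 s₀) with hz₀
  have dg : ContDiffAt ℝ ∞ ĝ z₀ :=
    contDiffAt_jetChart_comp hg hsrc (hgs ▸ hG₀.mk_mem_source r)
  have dk : ContDiffAt ℝ ∞ k' z₀ :=
    contDiffAt_jetChart_comp hk hsrc (hs2 ▸ hG₀.mk_mem_source 2)
  -- Along a solution the curve of `r`-jets is `ĝ` of the curve of first jets. Its derivative is
  -- `Dĝ` after the derivative of the latter, which depends only on the second jet given by `k'`;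
  -- then `Λ` yields the `(r + 1)`-jet.
  let N : JetModel n (Module.finrank ℝ V - n) 1 → JetModel n (Module.finrank ℝ V - n) (r + 1) :=
    fun z => (z.1, Λ ((ĝ z).2, (fderiv ℝ ĝ z).comp (B (k' z).2)))
  have dN : ContDiffAt ℝ ∞ N z₀ := contDiffAt_reconstruction Λ hB dg dk
  have dg' : ∀ᶠ z in 𝓝 z₀, DifferentiableAt ℝ ĝ z :=
    ((dg.of_le (m := 1) (by exact_mod_cast le_top)).eventually (by simp)).mono
      fun z hz => hz.differentiableAt (by simp)
  have key : ∀ θ ∈ (jetChart (I := I) 1 c A).source,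
      DifferentiableAt ℝ ĝ (jetChart (I := I) 1 c A θ) →
      (∃ s : ImmGerm I F n, Jet.mk 1 s = θ ∧ Jet.mk 2 s = k θ ∧
        Jet.mk (r + 1) s = h θ ∧ s.prolong r =ᶠ[𝓝 0] g ∘ s.prolong 1) →
      N (jetChart (I := I) 1 c A θ) ∈ jetTarget (I := I) (r + 1) c A ∧
        h θ = graphJet (r + 1) c A (N (jetChart (I := I) 1 c A θ)) := by
    rintro _ hθ hd ⟨s, rfl, hs2, hs3, hs4⟩
    obtain ⟨x₁, f, ψ, hG⟩ := ImmGerm.exists_isGraph_of_mem_source one_ne_zero hθ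
    -- The relation between prolongations is known along `s`, that is, after `ψ`; since `ψ` is
    -- locally invertible, it holds for the graph itself.
    have e1 : ĝ ∘ jetCurve 1 x₁ f =ᶠ[𝓝 0] jetCurve r x₁ f := by
      refine hG.reparam.eventually_of_comp ?_
      filter_upwards [hs4, hG.prolong_eq r, hG.prolong_eq 1,
        hG.reparam.tendsto.eventually (hG.eventually_mem r)] with x h1 h2 h3 h4
      rw [h2, comp_apply, comp_apply, comp_apply, h3] at h1
      simp only [hĝ, comp_apply] at h1 ⊢
      rw [← h1, jetChart_graphJet h4]
    have e2 : jetChart (I := I) 1 c A (Jet.mk 1 s) = jetCurve 1 x₁ f 0 := hG.jetChart_mk 1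
    have e3 : (k' (jetCurve 1 x₁ f 0)).2 = taylorOf' 2 f := by
      simp only [hk', comp_apply]
      rw [← (hG.mk_eq 1).2, ← hs2, hG.jetChart_mk 2, jetCurve_zero]
    rw [e2] at hd
    have e4 : fderiv ℝ (jetCurve r x₁ f) 0 =
        (fderiv ℝ ĝ (jetCurve 1 x₁ f 0)).comp (B (k' (jetCurve 1 x₁ f 0)).2) := by
      rw [e3, ← hB' f x₁ hG.smooth, ← e1.fderiv_eq]
      exact fderiv_comp 0 hd (hasFDerivAt_jetCurve hG.smooth).differentiableAt
    have e5 : N (jetChart (I := I) 1 c A (Jet.mk 1 s)) = jetCurve (r + 1) x₁ f 0 := by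
      rw [e2]
      refine Prod.ext (by simp [N, jetCurve]) ?_
      show Λ _ = _
      rw [← e4, show ĝ (jetCurve 1 x₁ f 0) = jetCurve r x₁ f 0 from e1.self_of_nhds,
        hΛ f x₁ hG.smooth, jetCurve_zero]
    rw [e5, ← hs3]
    exact hG.mk_eq (r + 1)
  have hN := (key _ hsrc dg'.self_of_nhds ⟨s₀, rfl, hs2, hs3, hs4⟩).1
  have h1 : ContMDiffAt (jetI V n 1) (jetI V n (r + 1)) ∞
      (graphJet (I := I) (r + 1) c A ∘ (N ∘ jetChart (I := I) 1 c A)) (Jet.mk 1 s₀) :=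
    ContMDiffAt.comp _ (contMDiffAt_graphJet hN)
      (ContMDiffAt.comp _ dN.contMDiffAt (contMDiffAt_jetChart hsrc))
  refine h1.congr_of_eventuallyEq ?_
  filter_upwards [isOpen_jetChart_source.mem_nhds hsrc,
    (contMDiffAt_jetChart hsrc).continuousAt.eventually dg', hs] with θ h1 h2 h3
  exact (key θ h1 h2 h3).2

end

end GrassmannJet

namespace GrassmannJet

noncomputable section

/-! ### Tangent planes and tangent vectors of subsets. -/

section
variable {n : ℕ} {W : Type*} [NormedAddCommGroup W] [NormedSpace ℝ W] {K : Type*}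
  [TopologicalSpace K] {J : ModelWithCorners ℝ W K} {N : Type*} [TopologicalSpace N]
  [ChartedSpace K N]

theorem tangentPlane_comp_const_add {f : Vec n → N} {x : Vec n}
    (hf : MDifferentiableAt 𝓘(ℝ, Vec n) J f x) :
    tangentPlane J (fun y => f (x + y)) 0 = tangentPlane J f x := by
  have h : HasFDerivAt (fun y : Vec n => x + y) (ContinuousLinearMap.id ℝ (Vec n)) 0 :=
    (hasFDerivAt_id 0).const_add x
  refine tangentPlane_comp_reparam (f := f) (φ := fun y => x + y) (add_zero x) hf
    h.differentiableAt ?_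
  rw [h.fderiv]
  exact injective_id

/-- `M` has rank `n`, so `L` has rank `n` as well and its kernel has dimension zero. -/
theorem injective_of_range_eq {L M : Vec n →L[ℝ] W} (h : range L = range M) (hM : Injective M) :
    Injective L := by
  have e : LinearMap.range (L : Vec n →ₗ[ℝ] W) = LinearMap.range (M : Vec n →ₗ[ℝ] W) :=
    SetLike.coe_injective h
  have k1 := LinearMap.finrank_range_add_finrank_ker (L : Vec n →ₗ[ℝ] W)
  have k2 := LinearMap.finrank_range_of_inj (f := (M : Vec n →ₗ[ℝ] W)) hM
  rw [e, k2] at k1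
  have k3 : Module.finrank ℝ (LinearMap.ker (L : Vec n →ₗ[ℝ] W)) = 0 := by omega
  exact LinearMap.ker_eq_bot.1 (Submodule.finrank_eq_zero.1 k3)

theorem mem_tangentPlane_iff {f : Vec n → N} {x : Vec n} {ξ : TangentBundle J N} :
    ξ ∈ tangentPlane J f x ↔ ξ.proj = f x ∧
      (ξ.snd : W) ∈ range (mfderiv 𝓘(ℝ, Vec n) J f x : Vec n →L[ℝ] W) := by
  constructor
  · rintro ⟨v, rfl⟩
    exact ⟨rfl, v, rfl⟩
  · obtain ⟨p, w⟩ := ξ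
    rintro ⟨h, v, hv⟩
    exact ⟨v, tangentBundle_mk_eq (J₁ := J) h.symm hv⟩

theorem range_eq_of_tangentPlane_eq {f g : Vec n → N} {x y : Vec n}
    (h : tangentPlane J f x = tangentPlane J g y) :
    range (mfderiv 𝓘(ℝ, Vec n) J f x : Vec n →L[ℝ] W) =
      range (mfderiv 𝓘(ℝ, Vec n) J g y : Vec n →L[ℝ] W) := by
  have e {f g : Vec n → N} {x y : Vec n} (h : tangentPlane J f x ⊆ tangentPlane J g y) :
      range (mfderiv 𝓘(ℝ, Vec n) J f x : Vec n →L[ℝ] W) ⊆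
        range (mfderiv 𝓘(ℝ, Vec n) J g y : Vec n →L[ℝ] W) := by
    rintro _ ⟨v, rfl⟩
    exact (mem_tangentPlane_iff.1 (h ⟨v, rfl⟩)).2
  exact (e h.le).antisymm (e h.ge)

/-- The images under `f` of the straight lines through `0` are curves in `S` with the required
velocities. -/
theorem tangentVectors_of_curve {S : Set N} {f : Vec n → N}
    (hf : ∀ᶠ x in 𝓝 (0 : Vec n), ContMDiffAt 𝓘(ℝ, Vec n) J ∞ f x)
    (hS : ∀ᶠ x in 𝓝 (0 : Vec n), f x ∈ S) : tangentPlane J f 0 ⊆ tangentVectors J S := by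
  rintro _ ⟨v, rfl⟩
  have hc : ContDiff ℝ ∞ fun t : ℝ => t • v := by fun_prop
  have ht : Tendsto (fun t : ℝ => t • v) (𝓝 0) (𝓝 0) := by
    have := hc.continuous.tendsto 0
    rwa [zero_smul] at this
  have hf0 : MDifferentiableAt 𝓘(ℝ, Vec n) J f ((fun t : ℝ => t • v) 0) := by
    simp only [zero_smul]
    exact hf.self_of_nhds.mdifferentiableAt (by simp)
  refine ⟨fun t => f (t • v), ?_, ht.eventually hS, ?_⟩
  · filter_upwards [ht.eventually hf] with t h
    exact ContMDiffAt.comp t h hc.contMDiff.contMDiffAt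
  · have hd : HasFDerivAt (fun t : ℝ => t • v) ((ContinuousLinearMap.id ℝ ℝ).smulRight v) 0 :=
      (hasFDerivAt_id (0 : ℝ)).smul_const v
    have e := tangentMap_comp_at (I := 𝓘(ℝ, ℝ)) (I' := 𝓘(ℝ, Vec n)) (I'' := J)
      (⟨0, (1 : ℝ)⟩ : TangentBundle 𝓘(ℝ, ℝ) ℝ) hf0 hd.differentiableAt.mdifferentiableAt
    refine Eq.trans ?_ e.symm
    have e2 : tangentMap 𝓘(ℝ, ℝ) 𝓘(ℝ, Vec n) (fun t : ℝ => t • v)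
        (⟨0, (1 : ℝ)⟩ : TangentBundle 𝓘(ℝ, ℝ) ℝ) = ⟨0, v⟩ := by
      refine tangentBundle_mk_eq (J₁ := 𝓘(ℝ, Vec n)) (zero_smul ℝ v) ?_
      rw [mfderiv_eq_fderiv]
      refine (congrArg (fun L : ℝ →L[ℝ] Vec n => L 1) hd.fderiv).trans ?_
      simp
    rw [e2]
    rfl

/-- A curve `γ` in the image satisfies `g ∘ p ∘ γ = γ`; differentiate. Thus velocities of curves in
the image come from vectors on `U`, whatever the image looks like as a subset. -/
theorem tangentVectors_image {W' : Type*} [NormedAddCommGroup W'] [NormedSpace ℝ W'] {K' : Type*}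
    [TopologicalSpace K'] {J' : ModelWithCorners ℝ W' K'} {N' : Type*} [TopologicalSpace N']
    [ChartedSpace K' N'] {g : N → N'} {p : N' → N} {U : Set N} (hU : IsOpen U)
    (hg : ContMDiffOn J J' ∞ g U) (hp : ContMDiff J' J ∞ p) (hpg : ∀ x ∈ U, p (g x) = x)
    {η : TangentBundle J' N'} (hη : η ∈ tangentVectors J' (g '' U)) :
    tangentMap J J' g (tangentMap J' J p η) = η ∧ ∃ x ∈ U, η.proj = g x := by
  obtain ⟨γ, h1, h2, rfl⟩ := hη
  have h0 : γ 0 ∈ g '' U := h2.self_of_nhds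
  refine ⟨?_, ?_⟩
  · have hx : p (γ 0) ∈ U := by
      obtain ⟨x, hx, e⟩ := h0
      rw [← e, hpg x hx]; exact hx
    have d1 : MDifferentiableAt 𝓘(ℝ, ℝ) J' γ 0 := h1.self_of_nhds.mdifferentiableAt (by simp)
    have d2 : MDifferentiableAt J' J p (γ 0) := (hp _).mdifferentiableAt (by simp)
    have d3 : MDifferentiableAt J J' g (p (γ 0)) :=
      (hg.contMDiffAt (hU.mem_nhds hx)).mdifferentiableAt (by simp)
    have e1 := tangentMap_comp_at (I := 𝓘(ℝ, ℝ)) (I' := J') (I'' := J)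
      (⟨0, (1 : ℝ)⟩ : TangentBundle 𝓘(ℝ, ℝ) ℝ) d2 d1
    have e2 := tangentMap_comp_at (I := 𝓘(ℝ, ℝ)) (I' := J) (I'' := J')
      (⟨0, (1 : ℝ)⟩ : TangentBundle 𝓘(ℝ, ℝ) ℝ) (g := g) (f := p ∘ γ) d3 (d2.comp 0 d1)
    have e3 : g ∘ p ∘ γ =ᶠ[𝓝 0] γ := by
      filter_upwards [h2] with t ht
      obtain ⟨x, hx, e⟩ := ht
      rw [comp_apply, comp_apply, ← e, hpg x hx]
    have e4 := tangentMap_congr (J₁ := 𝓘(ℝ, ℝ)) (J₂ := J')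
      (ξ := (⟨0, (1 : ℝ)⟩ : TangentBundle 𝓘(ℝ, ℝ) ℝ)) e3
    rw [e2, e1] at e4
    exact e4
  · obtain ⟨x, hx, e⟩ := h0
    exact ⟨x, hx, e.symm⟩

end

/-! ### Solutions of a section of `π_{2,1}`, their jets, and the prolongations of its image. -/

variable {V : Type*} [NormedAddCommGroup V] [NormedSpace ℝ V] [FiniteDimensional ℝ V]
  {H : Type*} [TopologicalSpace H] {I : ModelWithCorners ℝ V H}
  {F : Type*} [TopologicalSpace F] [ChartedSpace H F] {n : ℕ} [IsManifold I ∞ F] [I.Boundaryless]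

/-- Submanifolds whose second jets are prescribed by the first ones. -/
def ImmGerm.IsSolution (κ : Jet I F n 1 → Jet I F n 2) (s : ImmGerm I F n) : Prop :=
  ∀ᶠ x in 𝓝 (0 : Vec n), s.prolong 2 x = κ (s.prolong 1 x)

section
variable {κ : Jet I F n 1 → Jet I F n 2} {U : Set (Jet I F n 1)} {r : ℕ}

theorem ImmGerm.IsSolution.mk_two {s : ImmGerm I F n} (h : s.IsSolution κ) :
    Jet.mk 2 s = κ (Jet.mk 1 s) := by
  have := h.self_of_nhds
  rwa [s.prolong_zero, s.prolong_zero] at this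

/-- The condition concerns all points near `0`, so the germs at nearby points inherit it. -/
theorem ImmGerm.IsSolution.translate {s : ImmGerm I F n} (h : s.IsSolution κ) :
    ∀ᶠ x in 𝓝 (0 : Vec n), ∃ hx : s.IsRegularAt x, (s.translate x hx).IsSolution κ := by
  filter_upwards [s.eventually_isRegularAt, eventually_eventually_nhds.2 h] with x hx h
  refine ⟨hx, ?_⟩
  have c : Tendsto (fun y : Vec n => x + y) (𝓝 0) (𝓝 x) := by
    have : ContinuousAt (fun y : Vec n => x + y) 0 := by fun_prop
    rwa [ContinuousAt, add_zero] at this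
  filter_upwards [prolong_translate hx 1, prolong_translate hx 2, c.eventually h] with y h1 h2 h3
  rw [h1, h2, h3]

theorem tangentPlane_prolong_translate {s : ImmGerm I F n} {x : Vec n} (h : s.IsRegularAt x)
    (hd : MDifferentiableAt 𝓘(ℝ, Vec n) (jetI V n r) (s.prolong r) x) :
    tangentPlane (jetI V n r) ((s.translate x h).prolong r) 0 =
      tangentPlane (jetI V n r) (s.prolong r) x := by
  rw [tangentPlane_congr (ImmGerm.prolong_translate h r), tangentPlane_comp_const_add hd]

theorem tangentPlane_proj_prolong (s : ImmGerm I F n) {k : ℕ} (h : k ≤ r) :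
    tangentMap (jetI V n r) (jetI V n k) (Jet.proj h) '' tangentPlane (jetI V n r) (s.prolong r) 0 =
      tangentPlane (jetI V n k) (s.prolong k) 0 := by
  rw [← tangentPlane_comp ((Jet.contMDiff_proj h _).mdifferentiableAt (by simp))
    (s.mdifferentiableAt_prolong r)]
  exact tangentPlane_congr (Eventually.of_forall fun x => s.proj_prolong h x)

theorem tangentPlane_base_prolong (s : ImmGerm I F n) :
    tangentMap (jetI V n r) I Jet.base '' tangentPlane (jetI V n r) (s.prolong r) 0 =
      tangentPlane I s 0 := by
  rw [← tangentPlane_comp ((Jet.contMDiff_base _).mdifferentiableAt (by simp))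
    (s.mdifferentiableAt_prolong r)]
  refine tangentPlane_congr ?_
  filter_upwards [s.eventually_isRegularAt] with x hx using ImmGerm.base_prolong hx r

theorem Jet.proj_of_mem_RPlane {θ : Jet I F n (r + 1)}
    {ξ : TangentBundle (jetI V n r) (Jet I F n r)} (h : ξ ∈ θ.RPlane) :
    ξ.proj = θ.proj (Nat.le_succ r) := by
  obtain ⟨s, rfl⟩ := θ.exists_mk
  rw [RPlane_mk] at h
  rw [(mem_tangentPlane_iff.1 h).1, s.prolong_zero]
  rfl

/-- Integral submanifolds of the distribution given by a section of `π_{2,1}` are prolongations of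
solutions. -/
theorem exists_isSolution (hκ : ∀ θ, (κ θ).proj (Nat.le_succ 1) = θ)
    (hD : IntegrableOn (jetI V n 1) n {ξ | ξ ∈ (κ ξ.proj).RPlane} U) {θ : Jet I F n 1}
    (hθ : θ ∈ U) : ∃ s : ImmGerm I F n, Jet.mk 1 s = θ ∧ s.IsSolution κ := by
  obtain ⟨f, rfl, hf, -, hfD⟩ := hD θ hθ
  -- The tangent plane of the integral submanifold at `f x` is the whole of `R_{κ(f x)}`, whose
  -- vectors all lie over `f x` because `κ` is a section.
  have hpl : ∀ᶠ x in 𝓝 (0 : Vec n), ∀ t : ImmGerm I F n, Jet.mk 2 t = κ (f x) →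
      tangentPlane (jetI V n 1) f x = tangentPlane (jetI V n 1) (t.prolong 1) 0 := by
    filter_upwards [hfD] with x hx t ht
    rw [hx, ← Jet.RPlane_mk, ht]
    ext ξ
    constructor
    · rintro ⟨h1, h2⟩
      rw [← h2]; exact h1
    · intro h
      have e : ξ.proj = f x := (Jet.proj_of_mem_RPlane h).trans (hκ _)
      refine ⟨?_, e⟩
      show ξ ∈ (κ ξ.proj).RPlane
      rw [e]; exact h
  have hs : ∀ᶠ x in 𝓝 (0 : Vec n), ContMDiffAt 𝓘(ℝ, Vec n) I ∞ (Jet.base ∘ f) x :=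
    hf.mono fun x hx => ContMDiffAt.comp x (Jet.contMDiff_base _) hx
  -- The candidate is the projection of the integral submanifold to `F`. Its plane at `0` is the
  -- projection of an `R`-plane, hence the tangent plane of an immersed germ, so it is an immersion
  -- by dimension.
  let s : ImmGerm I F n :=
    { toFun := Jet.base ∘ f
      smooth := hs
      immersion := by
        obtain ⟨t, ht⟩ := (κ (f 0)).exists_mk
        have e := hpl.self_of_nhds t ht
        have e2 : tangentPlane I (Jet.base ∘ f) 0 = tangentPlane I t 0 := by
          rw [tangentPlane_comp ((Jet.contMDiff_base _).mdifferentiableAt (by simp))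
            (hf.self_of_nhds.mdifferentiableAt (by simp)), e, tangentPlane_base_prolong]
        exact injective_of_range_eq (W := V) (range_eq_of_tangentPlane_eq e2) t.immersion }
  -- A first jet is determined by its plane in `J⁰`. The plane of `s` at `x` is the projection of
  -- the tangent plane of `f`, hence of `R_{κ(f x)}`, and that is the plane of the jet `f x`.
  have h1 : s.prolong 1 =ᶠ[𝓝 0] f := by
    have h0 : ∀ᶠ x in 𝓝 (0 : Vec n), s.prolong 0 x = (f x).proj (Nat.zero_le 1) := by
      filter_upwards [s.eventually_isRegularAt] with x hx
      apply Jet.base_injective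
      rw [ImmGerm.base_prolong hx, Jet.base_proj]
      rfl
    filter_upwards [s.eventually_isRegularAt, eventually_eventually_nhds.2 h0, hpl, hf,
      s.eventually_contMDiffAt_prolong 0] with x hx h2 h3 h4 h5
    obtain ⟨t, ht⟩ := (κ (f x)).exists_mk
    have ht1 : Jet.mk 1 t = f x := by
      rw [← hκ (f x), ← ht]; rfl
    rw [ImmGerm.prolong_eq hx, ← ht1]
    apply mk_succ_eq_of_tangentPlane
    rw [tangentPlane_prolong_translate hx (h5.mdifferentiableAt (by simp)),
      ← tangentPlane_proj_prolong t (Nat.zero_le 1), ← h3 t ht,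
      ← tangentPlane_comp ((Jet.contMDiff_proj _ _).mdifferentiableAt (by simp))
        (h4.mdifferentiableAt (by simp))]
    exact tangentPlane_congr h2
  refine ⟨s, ?_, ?_⟩
  · rw [← s.prolong_zero, h1.self_of_nhds]
  -- The same argument one order higher: `s.prolong 1` agrees with `f`, so it is tangent to `R_{κ(f
  -- x)}`, and this plane determines the second jet.
  · filter_upwards [s.eventually_isRegularAt, eventually_eventually_nhds.2 h1, hpl,
      s.eventually_contMDiffAt_prolong 1] with x hx h2 h3 h4
    obtain ⟨t, ht⟩ := (κ (f x)).exists_mk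
    rw [h2.self_of_nhds, ImmGerm.prolong_eq hx, ← ht]
    apply mk_succ_eq_of_tangentPlane
    rw [tangentPlane_prolong_translate hx (h4.mdifferentiableAt (by simp)), ← h3 t ht]
    exact tangentPlane_congr h2

/-- The choice is made point by point, with no regularity in `θ` and arbitrarily outside `U`;
smoothness of the jets comes later from `contMDiffAt_of_prolong_eq`. -/
theorem exists_solution_section
    (hsol : ∀ θ ∈ U, ∃ s : ImmGerm I F n, Jet.mk 1 s = θ ∧ s.IsSolution κ) :
    ∃ t : Jet I F n 1 → ImmGerm I F n, (∀ θ ∈ U, Jet.mk 1 (t θ) = θ) ∧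
      ∀ θ ∈ U, (t θ).IsSolution κ := by
  have h (θ : Jet I F n 1) :
      ∃ s : ImmGerm I F n, θ ∈ U → Jet.mk 1 s = θ ∧ s.IsSolution κ := by
    by_cases hθ : θ ∈ U
    · obtain ⟨s, hs⟩ := hsol θ hθ
      exact ⟨s, fun _ => hs⟩
    · obtain ⟨s, -⟩ := θ.exists_mk
      exact ⟨s, fun h => absurd h hθ⟩
  choose t ht using h
  exact ⟨t, fun θ hθ => (ht θ hθ).1, fun θ hθ => (ht θ hθ).2⟩

/-- The jets of solutions are smooth functions of their first jets. -/
theorem exists_solution_jets_succ (hU : IsOpen U) (hκs : ContMDiffOn (jetI V n 1) (jetI V n 2) ∞ κ U)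
    (hsol : ∀ θ ∈ U, ∃ s : ImmGerm I F n, Jet.mk 1 s = θ ∧ s.IsSolution κ) (r : ℕ) :
    ∃ G : Jet I F n 1 → Jet I F n (r + 1), ContMDiffOn (jetI V n 1) (jetI V n (r + 1)) ∞ G U ∧
      ∀ s : ImmGerm I F n, s.IsSolution κ → Jet.mk 1 s ∈ U →
        Jet.mk (r + 1) s = G (Jet.mk 1 s) ∧ s.prolong (r + 1) =ᶠ[𝓝 0] G ∘ s.prolong 1 := by
  -- An identity between the jets of all solutions at their centers holds along each solution,
  -- because its translates are solutions.
  have hpro : ∀ {r : ℕ} {G : Jet I F n 1 → Jet I F n r},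
      (∀ s : ImmGerm I F n, s.IsSolution κ → Jet.mk 1 s ∈ U → Jet.mk r s = G (Jet.mk 1 s)) →
      ∀ s : ImmGerm I F n, s.IsSolution κ → Jet.mk 1 s ∈ U →
        s.prolong r =ᶠ[𝓝 0] G ∘ s.prolong 1 := by
    intro r G hG s hs hsU
    have hc : ∀ᶠ x in 𝓝 (0 : Vec n), s.prolong 1 x ∈ U :=
      (s.mdifferentiableAt_prolong 1).continuousAt.eventually
        (hU.mem_nhds (by rwa [s.prolong_zero]))
    filter_upwards [hs.translate, hc] with x ⟨hx, hx'⟩ hxU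
    rw [comp_apply, ImmGerm.prolong_eq hx, ImmGerm.prolong_eq hx]
    rw [ImmGerm.prolong_eq hx] at hxU
    exact hG _ hx' hxU
  induction r with
  -- The induction starts at order `1`, where `G` is the identity.
  | zero => exact ⟨id, contMDiffOn_id, fun s _ _ => ⟨rfl, EventuallyEq.rfl⟩⟩
  | succ r ih =>
    obtain ⟨G, hG, hGs⟩ := ih
    have hpl : ∀ s : ImmGerm I F n, s.IsSolution κ → Jet.mk 1 s ∈ U →
        tangentPlane (jetI V n (r + 1)) (s.prolong (r + 1)) 0 =
          tangentMap (jetI V n 1) (jetI V n (r + 1)) G ''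
            tangentPlane (jetI V n 1) (s.prolong 1) 0 := by
      intro s hs hsU
      rw [← tangentPlane_comp ?_ (s.mdifferentiableAt_prolong 1)]
      · exact tangentPlane_congr (hGs s hs hsU).2
      · rw [s.prolong_zero]
        exact (hG.contMDiffAt (hU.mem_nhds hsU)).mdifferentiableAt (by simp)
    -- Both planes are the image under `dG` of the same plane `R_{κ(θ)}`, and the plane determines
    -- the next jet.
    have huniq : ∀ s s' : ImmGerm I F n, s.IsSolution κ → s'.IsSolution κ → Jet.mk 1 s ∈ U →
        Jet.mk 1 s = Jet.mk 1 s' → Jet.mk (r + 1 + 1) s = Jet.mk (r + 1 + 1) s' := by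
      intro s s' hs hs' hsU he
      apply mk_succ_eq_of_tangentPlane
      rw [hpl s hs hsU, hpl s' hs' (he ▸ hsU), tangentPlane_prolong_congr
        (hs.mk_two.trans ((congrArg κ he).trans hs'.mk_two.symm))]
    obtain ⟨t, ht1, ht2⟩ := exists_solution_section hsol
    have hval : ∀ s : ImmGerm I F n, s.IsSolution κ → Jet.mk 1 s ∈ U →
        Jet.mk (r + 1 + 1) s = (fun θ => Jet.mk (r + 1 + 1) (t θ)) (Jet.mk 1 s) :=
      fun s hs hsU => huniq s _ hs (ht2 _ hsU) hsU (ht1 _ hsU).symm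
    refine ⟨fun θ => Jet.mk (r + 1 + 1) (t θ), fun θ hθ => ContMDiffAt.contMDiffWithinAt ?_,
      fun s hs hsU => ⟨hval s hs hsU, hpro hval s hs hsU⟩⟩
    refine contMDiffAt_of_prolong_eq (hG.contMDiffAt (hU.mem_nhds hθ))
      (hκs.contMDiffAt (hU.mem_nhds hθ)) ?_
    filter_upwards [hU.mem_nhds hθ] with θ hθ
    exact ⟨t θ, ht1 θ hθ, (ht2 θ hθ).mk_two.trans (congrArg κ (ht1 θ hθ)), rfl,
      (hGs _ (ht2 θ hθ) ((ht1 θ hθ).symm ▸ hθ)).2⟩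

theorem tangentPlane_subset_cartan (s : ImmGerm I F n) :
    tangentPlane (jetI V n r) (s.prolong r) 0 ⊆ cartan I F n r := by
  rintro ξ hξ
  refine Submodule.subset_span ⟨s, ?_, hξ⟩
  rw [(mem_tangentPlane_iff.1 hξ).1, s.prolong_zero]

theorem exists_solution_jets (hU : IsOpen U)
    (hκs : ContMDiffOn (jetI V n 1) (jetI V n 2) ∞ κ U)
    (hsol : ∀ θ ∈ U, ∃ s : ImmGerm I F n, Jet.mk 1 s = θ ∧ s.IsSolution κ) (hr : r ≠ 0) :
    ∃ G : Jet I F n 1 → Jet I F n r, ContMDiffOn (jetI V n 1) (jetI V n r) ∞ G U ∧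
      ∀ s : ImmGerm I F n, s.IsSolution κ → Jet.mk 1 s ∈ U →
        Jet.mk r s = G (Jet.mk 1 s) ∧ s.prolong r =ᶠ[𝓝 0] G ∘ s.prolong 1 := by
  obtain ⟨r, rfl⟩ := Nat.exists_eq_succ_of_ne_zero hr
  exact exists_solution_jets_succ hU hκs hsol r

/-- All the planes that span the Cartan distribution at a jet of order `r ≥ 2` project to one plane
in `J¹`, the `R`-plane of the underlying second jet. It is a linear subspace, so it contains the
projection of the span. -/
theorem tangentMap_proj_cartan {η : TangentBundle (jetI V n r) (Jet I F n r)}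
    (hr : 2 ≤ r) (hη : η ∈ cartan I F n r) :
    tangentMap (jetI V n r) (jetI V n 1) (Jet.proj (by omega)) η ∈
      (η.proj.proj (show 2 ≤ r by omega)).RPlane := by
  obtain ⟨p, w⟩ := η
  obtain ⟨s₀, rfl⟩ := p.exists_mk
  let P : Submodule ℝ (JetModel n (Module.finrank ℝ V - n) 1) := LinearMap.range
    (mfderiv 𝓘(ℝ, Vec n) (jetI V n 1) (s₀.prolong 1) 0 :
      Vec n →L[ℝ] JetModel n (Module.finrank ℝ V - n) 1).toLinearMap
  let L : JetModel n (Module.finrank ℝ V - n) r →L[ℝ]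
      JetModel n (Module.finrank ℝ V - n) 1 :=
    mfderiv (jetI V n r) (jetI V n 1) (Jet.proj (show 1 ≤ r by omega)) (Jet.mk r s₀)
  have key : ∀ w : JetModel n (Module.finrank ℝ V - n) r, w ∈ P.comap L.toLinearMap ↔
      tangentMap (jetI V n r) (jetI V n 1) (Jet.proj (by omega))
        (⟨Jet.mk r s₀, w⟩ : TangentBundle (jetI V n r) (Jet I F n r)) ∈
      tangentPlane (jetI V n 1) (s₀.prolong 1) 0 := by
    intro w
    rw [mem_tangentPlane_iff]
    refine ⟨fun h => ⟨s₀.prolong_zero 1 ▸ rfl, h⟩, fun h => h.2⟩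
  show _ ∈ (Jet.mk 2 s₀).RPlane
  rw [Jet.RPlane_mk]
  refine (key w).1 ?_
  refine Submodule.span_le.2 ?_ hη
  rintro w ⟨s, hs, hw⟩
  refine (key w).2 ?_
  have h2 : Jet.mk 2 s = Jet.mk 2 s₀ := congrArg (Jet.proj (show 2 ≤ r by omega)) hs
  rw [← tangentPlane_prolong_congr h2,
    ← tangentPlane_proj_prolong s (show 1 ≤ r by omega)]
  exact mem_image_of_mem _ hw

/-- The jets of the solutions through the points of `U` define smooth maps `G l` with the projection
to `J¹` as left inverse. Their images are the successive prolongations, and both the prolongations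
and the Cartan distributions are computed by passing back and forth between `U` and the image. -/
theorem prolongationsIsomorphicTo_of_isSolution (hU : IsOpen U)
    (hκs : ContMDiffOn (jetI V n 1) (jetI V n 2) ∞ κ U)
    (hsol : ∀ θ ∈ U, ∃ s : ImmGerm I F n, Jet.mk 1 s = θ ∧ s.IsSolution κ) :
    ProlongationsIsomorphicTo {θ | θ.proj (Nat.le_succ 1) ∈ U ∧ κ (θ.proj (Nat.le_succ 1)) = θ} U
      {ξ | ξ ∈ (κ ξ.proj).RPlane} := by
  choose G hG hGs using fun l : ℕ => exists_solution_jets hU hκs hsol (show 2 + l ≠ 0 by omega)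
  obtain ⟨t, ht1, ht2⟩ := exists_solution_section hsol
  have hGt (r : ℕ) {θ : Jet I F n 1} (hθ : θ ∈ U) : Jet.mk (2 + r) (t θ) = G r θ := by
    have := (hGs r _ (ht2 θ hθ) ((ht1 θ hθ).symm ▸ hθ)).1
    rwa [ht1 θ hθ] at this
  have hpr (r : ℕ) {θ : Jet I F n 1} (hθ : θ ∈ U) : (G r θ).proj (by omega) = θ := by
    rw [← hGt r hθ, Jet.proj_mk, ht1 θ hθ]
  have hpl (r : ℕ) {θ : Jet I F n 1} (hθ : θ ∈ U) :
      tangentPlane (jetI V n (2 + r)) ((t θ).prolong (2 + r)) 0 =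
        tangentMap (jetI V n 1) (jetI V n (2 + r)) (G r) ''
          tangentPlane (jetI V n 1) ((t θ).prolong 1) 0 := by
    have hsU : Jet.mk 1 (t θ) ∈ U := (ht1 θ hθ).symm ▸ hθ
    rw [← tangentPlane_comp ?_ ((t θ).mdifferentiableAt_prolong 1)]
    · exact tangentPlane_congr (hGs r _ (ht2 θ hθ) hsU).2
    · rw [(t θ).prolong_zero]
      exact ((hG r).contMDiffAt (hU.mem_nhds hsU)).mdifferentiableAt (by simp)
  have htv (r : ℕ) {θ : Jet I F n 1} (hθ : θ ∈ U) :
      tangentPlane (jetI V n (2 + r)) ((t θ).prolong (2 + r)) 0 ⊆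
        tangentVectors (jetI V n (2 + r)) (G r '' U) := by
    have hsU : Jet.mk 1 (t θ) ∈ U := (ht1 θ hθ).symm ▸ hθ
    refine tangentVectors_of_curve ((t θ).eventually_contMDiffAt_prolong _) ?_
    filter_upwards [(hGs r _ (ht2 θ hθ) hsU).2,
      ((t θ).mdifferentiableAt_prolong 1).continuousAt.eventually
        (hU.mem_nhds (by rwa [(t θ).prolong_zero]))] with x h1 h2
    exact ⟨_, h2, h1.symm⟩
  have step (r : ℕ) : prolongation (G r '' U) = G (r + 1) '' U := by
    ext θ
    constructor
    -- The `R`-plane of `θ` is tangent to the image of `G r`, hence equals `dG(dπ R_θ)`. Here `dπ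
    -- R_θ` is the `R`-plane of the second jet under `θ`, which is that of the solution through
    -- `θ₁`. So `θ` and this solution have the same `R`-plane at order `2 + r`.
    · rintro ⟨⟨θ₁, hθ₁, e⟩, hR⟩
      obtain ⟨s, rfl⟩ := θ.exists_mk
      rw [Jet.RPlane_mk] at hR
      refine ⟨θ₁, hθ₁, ?_⟩
      rw [← hGt _ hθ₁] at e ⊢
      refine mk_succ_eq_of_tangentPlane (r := 2 + r) ?_
      have e2 : Jet.mk 2 (t θ₁) = Jet.mk 2 s :=
        congrArg (Jet.proj (show 2 ≤ 2 + r by omega)) e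
      rw [hpl _ hθ₁, tangentPlane_prolong_congr e2,
        ← tangentPlane_proj_prolong s (show 1 ≤ 2 + r by omega), image_image]
      refine (image_congr fun ξ hξ => ?_).trans (image_id _)
      exact (tangentVectors_image hU (hG _) (Jet.contMDiff_proj _) (fun x hx => hpr _ hx)
        (hR hξ)).1
    · rintro ⟨θ₁, hθ₁, rfl⟩
      rw [← hGt _ hθ₁]
      refine ⟨⟨θ₁, hθ₁, (hGt _ hθ₁).symm⟩, ?_⟩
      rw [show Jet.mk (2 + (r + 1)) (t θ₁) = Jet.mk (2 + r + 1) (t θ₁) from rfl, Jet.RPlane_mk]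
      exact htv _ hθ₁
  have hS (l : ℕ) : iterProlongation
      {θ | θ.proj (Nat.le_succ 1) ∈ U ∧ κ (θ.proj (Nat.le_succ 1)) = θ} l = G l '' U := by
    induction l with
    | zero =>
      have h0 {θ : Jet I F n 1} (hθ : θ ∈ U) : G 0 θ = κ θ := by
        rw [← hGt 0 hθ]
        exact (ht2 θ hθ).mk_two.trans (congrArg κ (ht1 θ hθ))
      ext θ
      constructor
      · rintro ⟨h1, h2⟩
        exact ⟨_, h1, (h0 h1).trans h2⟩
      · rintro ⟨θ₁, hθ₁, rfl⟩
        have e : (G 0 θ₁).proj (Nat.le_succ 1) = θ₁ := hpr 0 hθ₁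
        show (G 0 θ₁).proj (Nat.le_succ 1) ∈ U ∧ κ ((G 0 θ₁).proj (Nat.le_succ 1)) = G 0 θ₁
        rw [e]
        exact ⟨hθ₁, (h0 hθ₁).symm⟩
    | succ l ih =>
      rw [← step l, ← ih]
      rfl
  intro l
  refine ⟨G l, ⟨hU, hG l, ?_, ?_⟩, ?_⟩
  · rw [hS]
    refine ⟨mapsTo_image _ _, fun θ hθ θ' hθ' h => ?_, surjOn_image _ _⟩
    rw [← hpr l hθ, h, hpr l hθ']
  -- The inverse is the restriction of a projection that is smooth on the whole jet space.
  · exact ⟨univ, Jet.proj (by omega), isOpen_univ, subset_univ _,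
      (Jet.contMDiff_proj _).contMDiffOn, fun θ hθ => hpr l hθ⟩
  · rw [hS]
    ext η
    constructor
    · rintro ⟨ξ, ⟨hξ, hU⟩, rfl⟩
      have h2 : κ ξ.proj = Jet.mk 2 (t ξ.proj) :=
        ((ht2 _ hU).mk_two.trans (congrArg κ (ht1 _ hU))).symm
      have h3 : ξ ∈ tangentPlane (jetI V n 1) ((t ξ.proj).prolong 1) 0 := by
        rw [← Jet.RPlane_mk, ← h2]; exact hξ
      have h4 := mem_image_of_mem (tangentMap (jetI V n 1) (jetI V n (2 + l)) (G l)) h3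
      rw [← hpl l hU] at h4
      exact ⟨tangentPlane_subset_cartan _ h4, htv l hU h4⟩
    · rintro ⟨h1, h2⟩
      -- The preimage is `dπ η`: tangency to the image makes `dG` return `η`, and the Cartan
      -- condition puts `dπ η` into `R_{κ(θ)}`.
      obtain ⟨h3, θ, hθ, h4⟩ := tangentVectors_image hU (hG l)
        (Jet.contMDiff_proj (show 1 ≤ 2 + l by omega)) (fun x hx => hpr l hx) h2
      have h5 := tangentMap_proj_cartan (show 2 ≤ 2 + l by omega) h1
      have h6 : (tangentMap (jetI V n (2 + l)) (jetI V n 1)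
          (Jet.proj (show 1 ≤ 2 + l by omega)) η).proj = θ := by
        show η.proj.proj (show 1 ≤ 2 + l by omega) = θ
        rw [h4, hpr l hθ]
      have h7 : η.proj.proj (show 2 ≤ 2 + l by omega) = κ θ := by
        rw [h4, ← hGt l hθ, Jet.proj_mk]
        exact (ht2 θ hθ).mk_two.trans (congrArg κ (ht1 θ hθ))
      refine ⟨_, ⟨?_, ?_⟩, h3⟩
      · show _ ∈ (κ (tangentMap _ _ _ η).proj).RPlane
        rw [h6, ← h7]; exact h5
      · rw [h6]; exact hθ

end

end

end GrassmannJet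

namespace GrassmannJet

noncomputable section

/-! ### Christoffel symbols of a smooth torsion-free connection. -/

section Christoffel

variable {V : Type*} [NormedAddCommGroup V] [NormedSpace ℝ V] [FiniteDimensional ℝ V]
  {H : Type*} [TopologicalSpace H] {I : ModelWithCorners ℝ V H}
  {F : Type*} [TopologicalSpace F] [ChartedSpace H F] [IsManifold I ∞ F] [I.Boundaryless]

/-- Reduces smoothness of the Christoffel symbols to that of finitely many entries. -/
theorem contDiffAt_of_apply_basis {X A B ι : Type*} [NormedAddCommGroup X] [NormedSpace ℝ X]
    [NormedAddCommGroup A] [NormedSpace ℝ A] [FiniteDimensional ℝ A] [NormedAddCommGroup B]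
    [NormedSpace ℝ B] [Fintype ι] (b : Module.Basis ι ℝ A) {f : X → A →L[ℝ] B} {x : X}
    (h : ∀ i, ContDiffAt ℝ ∞ (fun x => f x (b i)) x) : ContDiffAt ℝ ∞ f x := by
  have e : f = fun x => ∑ i, (LinearMap.toContinuousLinearMap (b.coord i)).smulRight (f x (b i)) := by
    funext x
    ext v
    conv_lhs => rw [← b.sum_repr v, map_sum]
    simp only [map_smul, FunLike.coe_sum, Finset.sum_apply]
    rfl
  rw [e]
  exact ContDiffAt.sum fun i _ => contDiffAt_const.smulRight (h i)

theorem isManifold_one (I : ModelWithCorners ℝ V H) (F : Type*) [TopologicalSpace F]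
    [ChartedSpace H F] [IsManifold I ∞ F] : IsManifold I 1 F :=
  IsManifold.of_le (n := ∞) (by exact_mod_cast le_top)

variable (I) in
/-- The derivative at `q` of the chart around `c`. -/
def chartDeriv (c q : F) : TangentSpace I q →L[ℝ] V := mfderiv I 𝓘(ℝ, V) (extChartAt I c) q

variable (I) in
/-- The vector field that is constant in the chart around `c`. -/
def constField (c : F) (b : V) (q : F) : TangentSpace I q := (chartDeriv I c q).inverse b

theorem isInvertible_chartDeriv {c q : F} (h : q ∈ (extChartAt I c).source) :
    (chartDeriv I c q).IsInvertible := by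
  have := isManifold_one I F
  exact isInvertible_mfderiv_extChartAt h

theorem chartDeriv_constField {c q : F} (h : q ∈ (extChartAt I c).source) (b : V) :
    chartDeriv I c q (constField I c b q) = b :=
  (isInvertible_chartDeriv h).self_apply_inverse b

theorem constField_chartDeriv {c q : F} (h : q ∈ (extChartAt I c).source) (v : TangentSpace I q) :
    constField I c (chartDeriv I c q v) q = v :=
  (isInvertible_chartDeriv h).inverse_apply_self v

/-- The trivialization of the tangent bundle around `c` is the derivative of the chart. -/
theorem contMDiffAt_field_iff {c q : F} (h : q ∈ (extChartAt I c).source)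
    {Y : (q : F) → TangentSpace I q} :
    ContMDiffAt I I.tangent ∞ (fun q => (⟨q, Y q⟩ : TangentBundle I F)) q ↔
      ContMDiffAt I 𝓘(ℝ, V) ∞ (fun q => chartDeriv I c q (Y q)) q := by
  have := isManifold_one I F
  have : IsManifold I (∞ + 1) F := inferInstanceAs (IsManifold I ∞ F)
  have h' : q ∈ (trivializationAt V (TangentSpace I) c).baseSet := by
    simpa using h
  have : ContMDiffVectorBundle ∞ V (TangentSpace I : F → Type _) I :=
    TangentBundle.contMDiffVectorBundle
  rw [(trivializationAt V (TangentSpace I) c).contMDiffAt_section_iff h']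
  refine Filter.EventuallyEq.contMDiffAt_iff ?_
  filter_upwards [(trivializationAt V (TangentSpace I) c).open_baseSet.mem_nhds h'] with x hx
  unfold chartDeriv
  rw [← TangentBundle.continuousLinearMapAt_trivializationAt (by simpa using hx),
    Bundle.Trivialization.continuousLinearMapAt_apply,
    Bundle.Trivialization.coe_linearMapAt_of_mem _ hx]

theorem mdifferentiableAt_field_iff {c q : F} (h : q ∈ (extChartAt I c).source)
    {Y : (q : F) → TangentSpace I q} :
    MDifferentiableAt I I.tangent (fun q => (⟨q, Y q⟩ : TangentBundle I F)) q ↔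
      MDifferentiableAt I 𝓘(ℝ, V) (fun q => chartDeriv I c q (Y q)) q := by
  have : IsManifold I (1 + 1) F := IsManifold.of_le (n := ∞) two_le
  have := isManifold_one I F
  have h' : q ∈ (trivializationAt V (TangentSpace I) c).baseSet := by
    simpa using h
  rw [(trivializationAt V (TangentSpace I) c).mdifferentiableAt_section_iff I Y h']
  refine Filter.EventuallyEq.mdifferentiableAt_iff ?_
  filter_upwards [(trivializationAt V (TangentSpace I) c).open_baseSet.mem_nhds h'] with x hx
  unfold chartDeriv
  rw [← TangentBundle.continuousLinearMapAt_trivializationAt (by simpa using hx),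
    Bundle.Trivialization.continuousLinearMapAt_apply,
    Bundle.Trivialization.coe_linearMapAt_of_mem _ hx]

theorem eventually_mem_source {c p : F} (h : p ∈ (extChartAt I c).source) :
    ∀ᶠ q in 𝓝 p, q ∈ (extChartAt I c).source := (isOpen_extChartAt_source c).mem_nhds h

theorem contMDiffAt_constField {c q : F} (h : q ∈ (extChartAt I c).source) (b : V) :
    ContMDiffAt I I.tangent ∞ (fun q => (⟨q, constField I c b q⟩ : TangentBundle I F)) q := by
  rw [contMDiffAt_field_iff h]
  refine (contMDiffAt_const (c := b)).congr_of_eventuallyEq ?_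
  filter_upwards [eventually_mem_source h] with x hx using chartDeriv_constField hx b

theorem mdifferentiableAt_of_contMDiffAt_field {p : F} {Y : (q : F) → TangentSpace I q}
    (h : ContMDiffAt I I.tangent ∞ (fun q => (⟨q, Y q⟩ : TangentBundle I F)) p) :
    MDifferentiableAt I I.tangent (fun q => (⟨q, Y q⟩ : TangentBundle I F)) p :=
  h.mdifferentiableAt (by simp)

/-- `B` is the value at `p` of the Christoffel symbols of a torsion-free connection, in the chart
around `c`. -/
structure IsChristoffel (cov : Connection I F) (c p : F) (B : V →L[ℝ] V →L[ℝ] V) : Prop where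
  symm : ∀ a b, B a b = B b a
  eq : ∀ Y : (q : F) → TangentSpace I q,
    MDifferentiableAt I I.tangent (fun q => (⟨q, Y q⟩ : TangentBundle I F)) p →
    ∀ v : TangentSpace I p, chartDeriv I c p (cov Y p v) =
      mvfderiv I (fun q => chartDeriv I c q (Y q)) p v +
        B (chartDeriv I c p v) (chartDeriv I c p (Y p))

/-- Near `c`, the connection is smooth and torsion-free: it has smooth symmetric Christoffel symbols
in the chart around `c`. -/
def HasChristoffel (cov : Connection I F) (c : F) : Prop :=
  ∃ Ch : V → V →L[ℝ] V →L[ℝ] V, SmoothNear Ch (extChartAt I c c) ∧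
    ∀ᶠ p in 𝓝 c, IsChristoffel cov c p (Ch (extChartAt I c p))

/-- The connection that differentiates the coordinates of a vector field in the chart around `c`. -/
def flatDerivative (c : F) (Y : (q : F) → TangentSpace I q) (p : F) :
    TangentSpace I p →L[ℝ] TangentSpace I p :=
  (chartDeriv I c p).inverse ∘L mvfderiv I (fun q => chartDeriv I c q (Y q)) p

/-- The difference of two connections is a tensor; with this one as reference, the tensor consists
of the Christoffel symbols. -/
theorem isCovariantDerivativeOn_flatDerivative (c : F) :
    IsCovariantDerivativeOn (I := I) V (V := (TangentSpace I : F → Type _)) (flatDerivative c)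
      (extChartAt I c).source := by
  refine ⟨fun {Y Y' p} hY hY' hp => ?_, fun {Y g p} hY hg hp => ?_⟩
  · have h1 := (mdifferentiableAt_field_iff hp).1 hY
    have h2 := (mdifferentiableAt_field_iff hp).1 hY'
    have e : (fun q => chartDeriv I c q ((Y + Y') q)) =
        (fun q => chartDeriv I c q (Y q)) + fun q => chartDeriv I c q (Y' q) := by
      funext q; exact map_add _ _ _
    unfold flatDerivative
    rw [e, mvfderiv_add h1 h2, ContinuousLinearMap.comp_add]
  · have h1 := (mdifferentiableAt_field_iff hp).1 hY
    have e : (fun q => chartDeriv I c q ((g • Y) q)) =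
        g • fun q => chartDeriv I c q (Y q) := by
      funext q; exact map_smul (chartDeriv I c q) (g q) (Y q)
    unfold flatDerivative
    rw [e, mvfderiv_smul hg h1, ContinuousLinearMap.comp_add, ContinuousLinearMap.comp_smul]
    congr 1
    ext1 v
    have := constField_chartDeriv hp (Y p)
    show constField I c (mvfderiv I g p v • chartDeriv I c p (Y p)) p = mvfderiv I g p v • Y p
    conv_rhs => rw [← this]
    exact map_smul (chartDeriv I c p).inverse _ _

theorem flatDerivative_constField {c p : F} (h : p ∈ (extChartAt I c).source) (b : V) :
    flatDerivative c (constField I c b) p = 0 := by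
  have e : (fun q => chartDeriv I c q (constField I c b q)) =ᶠ[𝓝 p] fun _ => b := by
    filter_upwards [eventually_mem_source h] with x hx using chartDeriv_constField hx b
  have : mvfderiv I (fun q => chartDeriv I c q (constField I c b q)) p = 0 := by
    unfold mvfderiv
    rw [e.mfderiv_eq, mfderiv_const]
    rfl
  unfold flatDerivative
  rw [this, ContinuousLinearMap.comp_zero]

/-- Coordinate fields are pullbacks of constant fields under the chart. Constant fields commute, and
pullback respects brackets. -/
theorem mlieBracket_constField {c p : F} (h : p ∈ (extChartAt I c).source) (a b : V) :
    VectorField.mlieBracket I (constField I c a) (constField I c b) p = 0 := by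
  have two_le' : (2 : WithTop ℕ∞) ≤ ∞ := one_add_one_eq_two (R := WithTop ℕ∞) ▸ two_le
  have : IsManifold I (minSmoothness ℝ 2) F := by
    rw [minSmoothness_of_isRCLikeNormedField]
    exact IsManifold.of_le (n := ∞) two_le'
  let X (a : V) : (x : V) → TangentSpace 𝓘(ℝ, V) x := fun _ => a
  have hc (a : V) : MDifferentiableAt 𝓘(ℝ, V) 𝓘(ℝ, V).tangent
      (fun x => (⟨x, X a x⟩ : TangentBundle 𝓘(ℝ, V) V)) (extChartAt I c p) := by
    refine mdifferentiableAt_of_contMDiffAt_field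
      ((contMDiffAt_field_iff (c := extChartAt I c p) (mem_extChartAt_source _)).2 ?_)
    refine (contMDiffAt_const (c := a)).congr_of_eventuallyEq (Eventually.of_forall fun x => ?_)
    have : chartDeriv 𝓘(ℝ, V) (extChartAt I c p) x = ContinuousLinearMap.id ℝ V := by
      unfold chartDeriv
      rw [extChartAt_model_space_eq_id]
      exact mfderiv_id
    exact congrArg (fun L : V →L[ℝ] V => L a) this
  have key := VectorField.mpullback_mlieBracket (I := I) (I' := 𝓘(ℝ, V)) (f := extChartAt I c)
    (x₀ := p) (n := ∞) (hc a) (hc b) (eventually_contMDiffAt_extChartAt h).self_of_nhds (by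
      rw [minSmoothness_of_isRCLikeNormedField]; exact two_le')
  have zero : VectorField.mlieBracket 𝓘(ℝ, V) (X a) (X b) (extChartAt I c p) = 0 := by
    rw [← VectorField.mlieBracketWithin_univ, VectorField.mlieBracketWithin_eq_lieBracketWithin]
    unfold VectorField.lieBracketWithin
    have hz (a : V) : fderivWithin ℝ (X a) univ (extChartAt I c p) = 0 :=
      fderivWithin_const_apply a
    rw [hz, hz]
    exact sub_self _
  refine key.symm.trans ?_
  rw [VectorField.mpullback_apply, zero]
  exact map_zero _

section Existence

variable [CompleteSpace V]

theorem chartDeriv_flatDerivative {c p : F} (h : p ∈ (extChartAt I c).source)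
    (Y : (q : F) → TangentSpace I q) (v : TangentSpace I p) :
    chartDeriv I c p (flatDerivative c Y p v) = mvfderiv I (fun q => chartDeriv I c q (Y q)) p v :=
  chartDeriv_constField h _

/-- The difference between a connection and the one given by the chart around `c`. -/
def chartDifference (cov : Connection I F) (c p : F) :
    TangentSpace I p →L[ℝ] TangentSpace I p →L[ℝ] TangentSpace I p :=
  have : ContMDiffVectorBundle 1 V (TangentSpace I : F → Type _) I :=
    have : IsManifold I (1 + 1) F := IsManifold.of_le (n := ∞) two_le
    TangentBundle.contMDiffVectorBundle
  have := isManifold_one I F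
  IsCovariantDerivativeOn.difference (s := (extChartAt I c).source) cov.isCovariantDerivativeOn
    (isCovariantDerivativeOn_flatDerivative c) p

theorem chartDifference_apply (cov : Connection I F) {c p : F}
    (h : p ∈ (extChartAt I c).source) {Y : (q : F) → TangentSpace I q}
    (hY : MDifferentiableAt I I.tangent (fun q => (⟨q, Y q⟩ : TangentBundle I F)) p) :
    chartDifference cov c p (Y p) = cov Y p - flatDerivative c Y p := by
  have : ContMDiffVectorBundle 1 V (TangentSpace I : F → Type _) I :=
    have : IsManifold I (1 + 1) F := IsManifold.of_le (n := ∞) two_le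
    TangentBundle.contMDiffVectorBundle
  have := isManifold_one I F
  exact IsCovariantDerivativeOn.difference_apply (s := (extChartAt I c).source)
    cov.isCovariantDerivativeOn (isCovariantDerivativeOn_flatDerivative c) h hY

theorem chartDifference_constField (cov : Connection I F) {c p : F}
    (h : p ∈ (extChartAt I c).source) (b : V) :
    chartDifference cov c p (constField I c b p) = cov (constField I c b) p := by
  rw [chartDifference_apply cov h
    (mdifferentiableAt_of_contMDiffAt_field (contMDiffAt_constField h b)),
    flatDerivative_constField h, sub_zero]

/-- The Christoffel symbols of a connection in the chart around `c`. -/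
def christoffel (cov : Connection I F) (c p : F) : V →L[ℝ] V →L[ℝ] V :=
  let D : V →L[ℝ] V →L[ℝ] V := chartDifference cov c p
  let J : V →L[ℝ] V := (chartDeriv I c p).inverse
  let L : V →L[ℝ] V := chartDeriv I c p
  -- The difference tensor takes the field first and the direction second; the outer `flip` puts the
  -- direction first.
  ((ContinuousLinearMap.compL ℝ V V V L).comp
    ((ContinuousLinearMap.compL ℝ V V V).flip J ∘L (D ∘L J))).flip

theorem christoffel_apply (cov : Connection I F) (c p : F) (a b : V) :
    christoffel cov c p a b =
      chartDeriv I c p (chartDifference cov c p (constField I c b p) (constField I c a p)) := rfl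

/-- Symmetry is the vanishing of the torsion on two coordinate fields, whose bracket is zero. The
formula splits the connection into its flat part and the difference tensor. -/
theorem isChristoffel_christoffel {cov : Connection I F} (hcov : cov.torsion = 0) {c p : F}
    (h : p ∈ (extChartAt I c).source) : IsChristoffel cov c p (christoffel cov c p) where
  symm a b := by
    have hX (b : V) := mdifferentiableAt_of_contMDiffAt_field (contMDiffAt_constField h b)
    have := (cov.torsion_eq_zero_iff).1 hcov (hX a) (hX b)
    rw [mlieBracket_constField h, sub_eq_zero] at this
    rw [christoffel_apply, christoffel_apply, chartDifference_constField cov h,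
      chartDifference_constField cov h, this]
  eq Y hY v := by
    have h1 := DFunLike.congr_fun (chartDifference_apply cov h hY) v
    rw [christoffel_apply, constField_chartDeriv h, constField_chartDeriv h, h1,
      ← chartDeriv_flatDerivative h, ← map_add]
    congr 1
    exact (add_sub_cancel _ _).symm

/-- Smoothness of the connection will be applied to a globally smooth field, so the coordinate field
is cut off by a bump function. -/
theorem exists_global_constField [T2Space F] (c : F) (b : V) :
    ∃ X : (q : F) → TangentSpace I q,
      ContMDiff I I.tangent ∞ (fun q => (⟨q, X q⟩ : TangentBundle I F)) ∧
        ∀ᶠ q in 𝓝 c, X q = constField I c b q := by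
  have := isManifold_one I F
  obtain ⟨ρ⟩ : Nonempty (SmoothBumpFunction I c) := inferInstance
  refine ⟨(ρ : F → ℝ) • constField I c b, fun q => ?_, ?_⟩
  · by_cases hq : q ∈ tsupport ρ
    · exact ContMDiffAt.smul_section ρ.contMDiffAt (contMDiffAt_constField
        (by simpa using ρ.tsupport_subset_chartAt_source hq) b)
    · have h0 : (fun q => (⟨q, ((ρ : F → ℝ) • constField I c b) q⟩ : TangentBundle I F)) =ᶠ[𝓝 q]
          fun q => ⟨q, 0⟩ := by
        filter_upwards [(isClosed_tsupport ρ).isOpen_compl.mem_nhds hq] with x hx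
        have : ρ x = 0 := image_eq_zero_of_notMem_tsupport hx
        exact tangentBundle_mk_eq (J₁ := I) rfl (by simp [this]; rfl)
      exact (Bundle.contMDiff_zeroSection ℝ (TangentSpace I : F → Type _)
        |>.contMDiffAt).congr_of_eventuallyEq h0
  · filter_upwards [ρ.eventuallyEq_one] with x hx
    simp [hx]

theorem contMDiffAt_christoffel_apply [T2Space F] (cov : Connection I F)
    [hs : CovariantDerivative.ContMDiffCovariantDerivative cov ∞] (c : F) (a b : V) :
    ∀ᶠ p in 𝓝 c, ContMDiffAt I 𝓘(ℝ, V) ∞ (fun q => christoffel cov c q a b) p := by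
  obtain ⟨X, hX, hXc⟩ := exists_global_constField (I := I) c b
  filter_upwards [eventually_eventually_nhds.2 hXc,
    eventually_mem_source (mem_extChartAt_source (I := I) c)] with p hp hps
  have h1 : ContMDiffAt I I.tangent ∞
      (fun q => (⟨q, cov X q (constField I c a q)⟩ : TangentBundle I F)) p :=
    ContMDiffAt.clm_bundle_apply
      ((hs.contMDiff.contMDiff (σ := X) hX.contMDiffOn).contMDiffAt univ_mem)
      (contMDiffAt_constField hps a)
  refine ((contMDiffAt_field_iff hps).1 h1).congr_of_eventuallyEq ?_
  filter_upwards [eventually_eventually_nhds.2 hp, eventually_mem_source hps] with q hq hqs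
  rw [christoffel_apply, chartDifference_constField cov hqs]
  refine congrArg (fun L : TangentSpace I q →L[ℝ] TangentSpace I q =>
    chartDeriv I c q (L (constField I c a q))) ?_
  -- Covariant derivatives are local, so near `c` the cut-off field may be replaced by the
  -- coordinate field.
  exact cov.isCovariantDerivativeOn.congr_of_eventuallyEq (s := univ)
    (mdifferentiableAt_of_contMDiffAt_field (contMDiffAt_constField hqs b))
    (mdifferentiableAt_of_contMDiffAt_field (hX q)) univ_mem (hq.mono fun _ h => h.symm)

theorem hasChristoffel_of_torsion_eq_zero [T2Space F] (cov : Connection I F)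
    [CovariantDerivative.ContMDiffCovariantDerivative cov ∞] (h : cov.torsion = 0) (c : F) :
    HasChristoffel cov c := by
  have hc := mem_extChartAt_source (I := I) c
  refine ⟨fun x => christoffel cov c ((extChartAt I c).symm x), ?_, ?_⟩
  · have h1 : ∀ᶠ p in 𝓝 c, ∀ i j : Fin (Module.finrank ℝ V), ContMDiffAt I 𝓘(ℝ, V) ∞
        (fun q => christoffel cov c q (Module.finBasis ℝ V i) (Module.finBasis ℝ V j)) p :=
      eventually_all.2 fun i => eventually_all.2 fun j => contMDiffAt_christoffel_apply cov c _ _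
    have h2 : Tendsto (extChartAt I c).symm (𝓝 (extChartAt I c c)) (𝓝 c) := by
      have := (contMDiffAt_extChartAt_symm (mem_extChartAt_target (I := I) c)).continuousAt
      rwa [ContinuousAt, extChartAt_to_inv] at this
    filter_upwards [h2.eventually h1, (isOpen_extChartAt_target c).mem_nhds
      (mem_extChartAt_target (I := I) c)] with x hx hxt
    have h3 (i j : Fin (Module.finrank ℝ V)) : ContDiffAt ℝ ∞ (fun x => christoffel cov c
        ((extChartAt I c).symm x) (Module.finBasis ℝ V i) (Module.finBasis ℝ V j)) x :=
      (ContMDiffAt.comp x (hx i j) (contMDiffAt_extChartAt_symm hxt)).contDiffAt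
    exact contDiffAt_of_apply_basis (Module.finBasis ℝ V) fun i =>
      contDiffAt_of_apply_basis (Module.finBasis ℝ V) fun j => h3 i j
  · filter_upwards [eventually_mem_source hc] with p hp
    have e : (extChartAt I c).symm (extChartAt I c p) = p := (extChartAt I c).left_inv hp
    simp only [e]
    exact isChristoffel_christoffel h hp

end Existence

end Christoffel

/-! ### Christoffel symbols of the product connection. -/

section Product

variable {V : Type*} [NormedAddCommGroup V] [NormedSpace ℝ V] [FiniteDimensional ℝ V]
  {H : Type*} [TopologicalSpace H] {I : ModelWithCorners ℝ V H}
  {M : Type*} [TopologicalSpace M] [ChartedSpace H M] [IsManifold I ∞ M] [I.Boundaryless]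
  {V' : Type*} [NormedAddCommGroup V'] [NormedSpace ℝ V'] [FiniteDimensional ℝ V']
  {H' : Type*} [TopologicalSpace H'] {I' : ModelWithCorners ℝ V' H'}
  {E : Type*} [TopologicalSpace E] [ChartedSpace H' E] [IsManifold I' ∞ E] [I'.Boundaryless]

theorem chartDeriv_prod {c z : M × E} (h₁ : z.1 ∈ (extChartAt I c.1).source)
    (h₂ : z.2 ∈ (extChartAt I' c.2).source) :
    chartDeriv (I.prod I') c z = (chartDeriv I c.1 z.1).prodMap (chartDeriv I' c.2 z.2) := by
  have d1 := (eventually_contMDiffAt_extChartAt h₁).self_of_nhds.mdifferentiableAt (by simp)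
  have d2 := (eventually_contMDiffAt_extChartAt h₂).self_of_nhds.mdifferentiableAt (by simp)
  unfold chartDeriv
  rw [extChartAt_prod, modelWithCornersSelf_prod, ← chartedSpaceSelf_prod]
  exact mfderiv_prodMap d1 d2

theorem mvfderiv_eq_add_partial {W : Type*} [NormedAddCommGroup W] [NormedSpace ℝ W]
    {g : M × E → W} {z : M × E} (hg : MDifferentiableAt (I.prod I') 𝓘(ℝ, W) g z)
    (v : TangentSpace (I.prod I') z) :
    mvfderiv (I.prod I') g z v = mvfderiv I (fun x : M => g (x, z.2)) z.1 v.1 +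
      mvfderiv I' (fun e : E => g (z.1, e)) z.2 v.2 := by
  exact mfderiv_prod_eq_add_apply hg

theorem mvfderiv_congr {W : Type*} [NormedAddCommGroup W] [NormedSpace ℝ W] {g g' : M → W} {x : M}
    (h : g =ᶠ[𝓝 x] g') (v : TangentSpace I x) : mvfderiv I g x v = mvfderiv I g' x v :=
  DFunLike.congr_fun (h.mfderiv_eq (I := I) (I' := 𝓘(ℝ, W))) v

theorem mvfderiv_clm_comp {W W' : Type*} [NormedAddCommGroup W] [NormedSpace ℝ W]
    [NormedAddCommGroup W'] [NormedSpace ℝ W'] (L : W →L[ℝ] W') {g : M → W} {x : M}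
    (hg : MDifferentiableAt I 𝓘(ℝ, W) g x) (v : TangentSpace I x) :
    mvfderiv I (fun x => L (g x)) x v = L (mvfderiv I g x v) := by
  have h := HasMFDerivAt.comp x (L.hasFDerivAt (x := g x)).hasMFDerivAt hg.hasMFDerivAt
  exact DFunLike.congr_fun h.mfderiv v

variable (V V') in
/-- The direct sum of two bilinear maps. -/
def prodBilin (B : V →L[ℝ] V →L[ℝ] V) (B' : V' →L[ℝ] V' →L[ℝ] V') :
    V × V' →L[ℝ] V × V' →L[ℝ] V × V' :=
  (ContinuousLinearMap.compL ℝ (V × V') V (V × V') (ContinuousLinearMap.inl ℝ V V') ∘L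
    (ContinuousLinearMap.compL ℝ (V × V') V V).flip (ContinuousLinearMap.fst ℝ V V')) ∘L
      (B ∘L ContinuousLinearMap.fst ℝ V V') +
  (ContinuousLinearMap.compL ℝ (V × V') V' (V × V') (ContinuousLinearMap.inr ℝ V V') ∘L
    (ContinuousLinearMap.compL ℝ (V × V') V' V').flip (ContinuousLinearMap.snd ℝ V V')) ∘L
      (B' ∘L ContinuousLinearMap.snd ℝ V V')

theorem prodBilin_apply (B : V →L[ℝ] V →L[ℝ] V) (B' : V' →L[ℝ] V' →L[ℝ] V') (a b : V × V') :
    prodBilin V V' B B' a b = (B a.1 b.1, B' a.2 b.2) := by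
  simp [prodBilin]

/-- The mixed blocks of the product connection are plain derivatives, because they differentiate one
component while its base point stays fixed. Only the two diagonal blocks contribute Christoffel
symbols. -/
theorem IsChristoffel.prod {Θ : Connection I M} {Γ : Connection I' E} {c z : M × E}
    {B : V →L[ℝ] V →L[ℝ] V} {B' : V' →L[ℝ] V' →L[ℝ] V'}
    (hB : IsChristoffel Θ c.1 z.1 B) (hB' : IsChristoffel Γ c.2 z.2 B')
    (h₁ : z.1 ∈ (extChartAt I c.1).source) (h₂ : z.2 ∈ (extChartAt I' c.2).source) :
    IsChristoffel (prodConnection I I' Θ Γ) c z (prodBilin V V' B B') where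
  symm a b := by rw [prodBilin_apply, prodBilin_apply, hB.symm, hB'.symm]
  eq Y hY v := by
    have hz : z ∈ (extChartAt (I.prod I') c).source := by
      rw [extChartAt_prod]; exact ⟨h₁, h₂⟩
    have hY' := mdifferentiableAt_comp_equivTangentBundleProd hY
    have hl := MDifferentiableAt.comp z.1 (f := fun x : M => (x, z.2)) hY'
      (mdifferentiableAt_prodMk_left z)
    have hr := MDifferentiableAt.comp z.2 (f := fun e : E => (z.1, e)) hY'
      (mdifferentiableAt_prodMk_right z)
    have hW := (mdifferentiableAt_field_iff hz).1 hY
    have hsrc : ∀ᶠ w in 𝓝 z, chartDeriv (I.prod I') c w (Y w) =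
        (chartDeriv I c.1 w.1 (Y w).1, chartDeriv I' c.2 w.2 (Y w).2) := by
      filter_upwards [(continuousAt_fst (p := z)).eventually (eventually_mem_source h₁),
        (continuousAt_snd (p := z)).eventually (eventually_mem_source h₂)] with w k1 k2
      rw [chartDeriv_prod k1 k2]
      rfl
    have hG := hW.congr_of_eventuallyEq (f₁ := fun w : M × E =>
      ((chartDeriv I c.1 w.1 (Y w).1, chartDeriv I' c.2 w.2 (Y w).2) : V × V'))
      (hsrc.mono fun _ h => h.symm)
    have hG₁ : MDifferentiableAt (I.prod I') 𝓘(ℝ, V)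
        (fun w : M × E => chartDeriv I c.1 w.1 (Y w).1) z :=
      (ContinuousLinearMap.fst ℝ V V').mdifferentiableAt.comp z hG
    have hG₂ : MDifferentiableAt (I.prod I') 𝓘(ℝ, V')
        (fun w : M × E => chartDeriv I' c.2 w.2 (Y w).2) z :=
      (ContinuousLinearMap.snd ℝ V V').mdifferentiableAt.comp z hG
    have e₁ := mvfderiv_clm_comp (ContinuousLinearMap.fst ℝ V V') hG v
    have e₂ := mvfderiv_clm_comp (ContinuousLinearMap.snd ℝ V V') hG v
    rw [mvfderiv_congr hsrc v, chartDeriv_prod h₁ h₂]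
    refine Prod.ext ?_ ?_
    · have a₁ := hB.eq _ hl.fst v.1
      -- Along the second factor the point of `M` is fixed, so the derivative of its chart is a
      -- constant linear map and commutes with differentiation.
      have a₂ := mvfderiv_clm_comp (W := V) (W' := V) (chartDeriv I c.1 z.1)
        (mdifferentiableAt_of_const_proj hr.fst) v.2
      refine ((chartDeriv I c.1 z.1).map_add _ _).trans ?_
      refine Eq.trans ?_ (congrArg₂ (fun a b : V => a + b)
        ((mvfderiv_eq_add_partial hG₁ v).symm.trans e₁)
        (congrArg Prod.fst (prodBilin_apply B B' _ _).symm))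
      refine (congrArg₂ (fun a b : V => a + b) a₁ a₂.symm).trans ?_
      exact add_right_comm _ _ _
    · have a₁ := hB'.eq _ hr.snd v.2
      have a₂ := mvfderiv_clm_comp (W := V') (W' := V') (chartDeriv I' c.2 z.2)
        (mdifferentiableAt_of_const_proj hl.snd) v.1
      refine ((chartDeriv I' c.2 z.2).map_add _ _).trans ?_
      refine Eq.trans ?_ (congrArg₂ (fun a b : V' => a + b)
        ((mvfderiv_eq_add_partial hG₂ v).symm.trans e₂)
        (congrArg Prod.snd (prodBilin_apply B B' _ _).symm))
      refine (congrArg₂ (fun a b : V' => a + b) a₂.symm a₁).trans ?_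
      exact (add_assoc _ _ _).symm

theorem HasChristoffel.prod {Θ : Connection I M} {Γ : Connection I' E} {x : M} {e : E}
    (hΘ : HasChristoffel Θ x) (hΓ : HasChristoffel Γ e) :
    HasChristoffel (prodConnection I I' Θ Γ) (x, e) := by
  obtain ⟨B, hB, hB'⟩ := hΘ
  obtain ⟨C, hC, hC'⟩ := hΓ
  refine ⟨fun w => prodBilin V V' (B w.1) (C w.2), ?_, ?_⟩
  · have h1 : SmoothNear (fun w : V × V' => B w.1) (extChartAt (I.prod I') (x, e) (x, e)) :=
      SmoothNear.comp (g := B) (f := Prod.fst) (by rw [extChartAt_prod]; rfl) hB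
        (ContDiff.smoothNear contDiff_fst _)
    have h2 : SmoothNear (fun w : V × V' => C w.2) (extChartAt (I.prod I') (x, e) (x, e)) :=
      SmoothNear.comp (g := C) (f := Prod.snd) (by rw [extChartAt_prod]; rfl) hC
        (ContDiff.smoothNear contDiff_snd _)
    filter_upwards [h1, h2] with w h1 h2
    exact (contDiffAt_const.clm_comp (h1.clm_comp contDiffAt_const)).add
      (contDiffAt_const.clm_comp (h2.clm_comp contDiffAt_const))
  · rw [nhds_prod_eq]
    filter_upwards [(hB'.and (eventually_mem_source (mem_extChartAt_source (I := I) x))).prod_mk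
      (hC'.and (eventually_mem_source (mem_extChartAt_source (I := I') e)))] with z hz
    have := IsChristoffel.prod (c := (x, e)) hz.1.1 hz.2.1 hz.1.2 hz.2.2
    rw [extChartAt_prod]
    exact this

end Product

end

end GrassmannJet

namespace GrassmannJet

noncomputable section

variable {V : Type*} [NormedAddCommGroup V] [NormedSpace ℝ V] [FiniteDimensional ℝ V]
  {H : Type*} [TopologicalSpace H] {I : ModelWithCorners ℝ V H}
  {F : Type*} [TopologicalSpace F] [ChartedSpace H F] {n : ℕ} [IsManifold I ∞ F] [I.Boundaryless]

/-! ### Divided coordinates of vector fields -/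

section Fields
variable {c p : F} {A : Splitting V n}

variable (I) in
/-- The derivative of divided coordinates. -/
def dividedDeriv (c : F) (A : Splitting V n) (p : F) :
    TangentSpace I p →L[ℝ] Vec n × Vec (Module.finrank ℝ V - n) :=
  mfderiv I 𝓘(ℝ, Vec n × Vec (Module.finrank ℝ V - n)) (dividedChart (I := I) c A) p

theorem mdifferentiableAt_dividedChart (hp : p ∈ (dividedChart (I := I) c A).source) :
    MDifferentiableAt I 𝓘(ℝ, Vec n × Vec (Module.finrank ℝ V - n))
      (dividedChart (I := I) c A) p :=
  (eventually_contMDiffAt_dividedChart hp).self_of_nhds.mdifferentiableAt (by simp)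

theorem dividedDeriv_apply (hp : p ∈ (dividedChart (I := I) c A).source) (v : TangentSpace I p) :
    dividedDeriv I c A p v = A (chartDeriv I c p v) := by
  have h1 : MDifferentiableAt I 𝓘(ℝ, V) (extChartAt I c) p :=
    (eventually_contMDiffAt_extChartAt hp).self_of_nhds.mdifferentiableAt (by simp)
  have h := HasMFDerivAt.comp p
    ((A : V →L[ℝ] Vec n × Vec (Module.finrank ℝ V - n)).hasFDerivAt
      (x := extChartAt I c p)).hasMFDerivAt h1.hasMFDerivAt
  exact DFunLike.congr_fun h.mfderiv v

theorem dividedDeriv_injective (hp : p ∈ (dividedChart (I := I) c A).source) :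
    Injective (dividedDeriv I c A p) := fun v w h => by
  rw [dividedDeriv_apply hp, dividedDeriv_apply hp] at h
  exact (isInvertible_chartDeriv hp).injective (A.injective h)

theorem dividedDeriv_comp {X : Type*} [NormedAddCommGroup X] [NormedSpace ℝ X] {m : X → F} {x : X}
    (hx : m x ∈ (dividedChart (I := I) c A).source) (hm : MDifferentiableAt 𝓘(ℝ, X) I m x)
    (u : X) : dividedDeriv I c A (m x) (mfderiv 𝓘(ℝ, X) I m x u) =
      fderiv ℝ (dividedChart (I := I) c A ∘ m) x u := by
  let L : X →L[ℝ] Vec n × Vec (Module.finrank ℝ V - n) :=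
    (dividedDeriv I c A (m x)).comp (mfderiv 𝓘(ℝ, X) I m x)
  have h : HasFDerivAt (dividedChart (I := I) c A ∘ m) L x :=
    (HasMFDerivAt.comp x (mdifferentiableAt_dividedChart hx).hasMFDerivAt
      hm.hasMFDerivAt).hasFDerivAt
  exact (DFunLike.congr_fun h.fderiv u).symm

/-- The tangent space of a graph is the graph of the derivative; `ψ` drops out because its
derivative is onto. -/
theorem mem_range_mfderiv_iff {s : Vec n → F} {x x₀ : Vec n} {ψ : Vec n → Vec n}
    {f : Vec n → Vec (Module.finrank ℝ V - n)}
    (hx : s x ∈ (dividedChart (I := I) c A).source) (hs : MDifferentiableAt 𝓘(ℝ, Vec n) I s x)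
    (h : dividedChart (I := I) c A ∘ s =ᶠ[𝓝 x] fun y => (x₀ + ψ y, f (ψ y)))
    (hψ : DifferentiableAt ℝ ψ x) (hf : DifferentiableAt ℝ f (ψ x))
    (hi : Injective (fderiv ℝ ψ x)) (w : TangentSpace I (s x)) :
    w ∈ LinearMap.range (mfderiv 𝓘(ℝ, Vec n) I s x).toLinearMap ↔
      (dividedDeriv I c A (s x) w).2 = fderiv ℝ f (ψ x) (dividedDeriv I c A (s x) w).1 := by
  have hd : HasFDerivAt (fun y => (x₀ + ψ y, f (ψ y)))
      ((fderiv ℝ ψ x).prod ((fderiv ℝ f (ψ x)).comp (fderiv ℝ ψ x))) x :=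
    (hψ.hasFDerivAt.const_add x₀).prodMk (hf.hasFDerivAt.comp x hψ.hasFDerivAt)
  have e (u : Vec n) : dividedDeriv I c A (s x) (mfderiv 𝓘(ℝ, Vec n) I s x u) =
      (fderiv ℝ ψ x u, fderiv ℝ f (ψ x) (fderiv ℝ ψ x u)) := by
    rw [dividedDeriv_comp hx hs, h.fderiv_eq, hd.fderiv]
    rfl
  constructor
  · rintro ⟨u, rfl⟩
    have := e u
    exact (congrArg Prod.snd this).trans (congrArg (fderiv ℝ f (ψ x)) (congrArg Prod.fst this).symm)
  · intro hw
    obtain ⟨u, hu⟩ := surjective_of_injective_endo hi (dividedDeriv I c A (s x) w).1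
    refine ⟨u, dividedDeriv_injective hx ((e u).trans ?_)⟩
    rw [hu, ← hw]

/-- Supplies the test fields for the second fundamental form and for parallelism. -/
theorem exists_field (hp : p ∈ (dividedChart (I := I) c A).source)
    {g : F → Vec n × Vec (Module.finrank ℝ V - n)}
    (hg : ∀ᶠ q in 𝓝 p, ContMDiffAt I 𝓘(ℝ, Vec n × Vec (Module.finrank ℝ V - n)) ∞ g q) :
    ∃ Y : (q : F) → TangentSpace I q, SmoothFieldNear Y p ∧
      ∀ᶠ q in 𝓝 p, dividedDeriv I c A q (Y q) = g q := by
  refine ⟨fun q => constField I c (A.symm (g q)) q, ?_, ?_⟩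
  · filter_upwards [hg, eventually_mem_source hp] with q hq hqs
    rw [contMDiffAt_field_iff hqs]
    refine ContMDiffAt.congr_of_eventuallyEq (f := fun q => A.symm (g q)) ?_ ?_
    · exact ContMDiffAt.comp q (A.symm.contDiff.contMDiff.contMDiffAt (x := g q)) hq
    · filter_upwards [eventually_mem_source hqs] with x hx using chartDeriv_constField hx _
  · filter_upwards [eventually_mem_source hp] with q hq
    rw [dividedDeriv_apply hq, chartDeriv_constField hq, A.apply_symm_apply]

/-- The second derivatives prescribed by a connection for the totally geodesic graphs with
slope `P`. -/
def geodesicTerm (A : Splitting V n) (B : V →L[ℝ] V →L[ℝ] V)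
    (P : Vec n →L[ℝ] Vec (Module.finrank ℝ V - n))
    (a : Vec n × Vec (Module.finrank ℝ V - n)) (η : Vec n) : Vec (Module.finrank ℝ V - n) :=
  P (A (B (A.symm a) (A.symm (η, P η)))).1 - (A (B (A.symm a) (A.symm (η, P η)))).2

/-- The covariant derivative of a field that, along the map `m`, lies in the planes of slope `P`. -/
theorem dividedDeriv_cov {cov : Connection I F} {X : Type*} [NormedAddCommGroup X]
    [NormedSpace ℝ X] {m : X → F} {x : X} {B : V →L[ℝ] V →L[ℝ] V}
    (hB : IsChristoffel cov c (m x) B) (hx : m x ∈ (dividedChart (I := I) c A).source)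
    (hm : MDifferentiableAt 𝓘(ℝ, X) I m x) {P : X → Vec n →L[ℝ] Vec (Module.finrank ℝ V - n)}
    (hP : DifferentiableAt ℝ P x) {Y : (q : F) → TangentSpace I q}
    (hY : MDifferentiableAt I I.tangent (fun q => (⟨q, Y q⟩ : TangentBundle I F)) (m x))
    (h : ∀ᶠ y in 𝓝 x, (dividedDeriv I c A (m y) (Y (m y))).2 =
      P y (dividedDeriv I c A (m y) (Y (m y))).1) (u : X) :
    (dividedDeriv I c A (m x) (cov Y (m x) (mfderiv 𝓘(ℝ, X) I m x u))).2 -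
      P x (dividedDeriv I c A (m x) (cov Y (m x) (mfderiv 𝓘(ℝ, X) I m x u))).1 =
    fderiv ℝ P x u (dividedDeriv I c A (m x) (Y (m x))).1 -
      geodesicTerm A B (P x) (dividedDeriv I c A (m x) (mfderiv 𝓘(ℝ, X) I m x u))
        (dividedDeriv I c A (m x) (Y (m x))).1 := by
  have hg := (mdifferentiableAt_field_iff hx).1 hY
  have hgm : HasFDerivAt (fun y => chartDeriv I c (m y) (Y (m y)))
      (fderiv ℝ (fun y => chartDeriv I c (m y) (Y (m y))) x) x :=
    (hg.comp x hm).differentiableAt.hasFDerivAt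
  set g := fun y => chartDeriv I c (m y) (Y (m y)) with hgdef
  have hcomp : mvfderiv I (fun q => chartDeriv I c q (Y q)) (m x) (mfderiv 𝓘(ℝ, X) I m x u) =
      fderiv ℝ g x u := by
    let L : X →L[ℝ] V :=
      (mfderiv I 𝓘(ℝ, V) (fun q => chartDeriv I c q (Y q)) (m x)).comp (mfderiv 𝓘(ℝ, X) I m x)
    have : HasFDerivAt g L x :=
      (HasMFDerivAt.comp x hg.hasMFDerivAt hm.hasMFDerivAt).hasFDerivAt
    exact (DFunLike.congr_fun this.fderiv u).symm
  have hcov := hB.eq Y hY (mfderiv 𝓘(ℝ, X) I m x u)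
  rw [hcomp] at hcov
  have hsrc : ∀ᶠ y in 𝓝 x, (A (g y)).2 = P y (A (g y)).1 := by
    filter_upwards [h, hm.continuousAt.eventually (eventually_mem_source hx)] with y hy hys
    rwa [dividedDeriv_apply hys] at hy
  have hAg := (A : V →L[ℝ] Vec n × Vec (Module.finrank ℝ V - n)).hasFDerivAt.comp x hgm
  have d1 := hAg.snd
  have d2 := hP.hasFDerivAt.clm_apply hAg.fst
  -- Differentiating `(A g).2 = P (A g).1` shows that, modulo the plane, the flat part of the
  -- covariant derivative is the derivative of the slope. The Christoffel part contributes the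
  -- `geodesicTerm` with a minus sign.
  have key := DFunLike.congr_fun ((d1.congr_of_eventuallyEq
    (hsrc.mono fun _ h => h.symm)).unique d2) u
  have key' : (A (fderiv ℝ g x u)).2 =
      P x (A (fderiv ℝ g x u)).1 + fderiv ℝ P x u (A (g x)).1 := key
  have hYx : chartDeriv I c (m x) (Y (m x)) = A.symm ((A (g x)).1, P x (A (g x)).1) := by
    rw [← hsrc.self_of_nhds]
    exact (A.symm_apply_apply (g x)).symm
  rw [dividedDeriv_apply hx, dividedDeriv_apply hx, dividedDeriv_apply hx, hcov, map_add,
    Prod.snd_add, Prod.fst_add, key', geodesicTerm, A.symm_apply_apply]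
  have hYx' : chartDeriv I c (m x) (Y (m x)) = g x := rfl
  rw [hYx', map_add]
  rw [hYx'] at hYx
  rw [← hYx]
  abel

end Fields

/-! ### Coordinates of first order jets -/

section FirstJet
variable {q : ℕ}

variable (n q) in
/-- The slope of a first order Taylor polynomial. -/
def slope : TaylorSpace n q 1 →ₗ[ℝ] (Vec n →L[ℝ] Vec q) :=
  (continuousMultilinearCurryFin1 ℝ (Vec n) (Vec q)).toLinearEquiv.toLinearMap ∘ₗ
    (DerivFamily.coeff (1 : Fin 2) ∘ₗ (TaylorSpace n q 1).subtype)

variable (n q) in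
/-- The value of a first order Taylor polynomial. -/
def value : TaylorSpace n q 1 →ₗ[ℝ] Vec q :=
  (continuousMultilinearCurryFin0 ℝ (Vec n) (Vec q)).toLinearEquiv.toLinearMap ∘ₗ
    (DerivFamily.coeff (0 : Fin 2) ∘ₗ (TaylorSpace n q 1).subtype)

theorem slope_taylorOf' {f : Vec n → Vec q} (hf : SmoothNear f 0) :
    slope n q (taylorOf' 1 f) = fderiv ℝ f 0 := by
  ext1 v
  have := congrArg (fun L => L fun _ => v) (coeff_taylorOf' (r := 1) hf 1)
  refine this.trans ?_
  exact iteratedFDeriv_one_apply _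

theorem value_taylorOf' {f : Vec n → Vec q} (hf : SmoothNear f 0) :
    value n q (taylorOf' 1 f) = f 0 :=
  congrArg (fun L => L 0) (coeff_taylorOf' (r := 1) hf 0)

theorem taylorSpace_one_ext {a b : TaylorSpace n q 1} (h0 : value n q a = value n q b)
    (h1 : slope n q a = slope n q b) : a = b := by
  ext1
  refine DerivFamily.ext fun k => ?_
  fin_cases k
  · exact (continuousMultilinearCurryFin0 ℝ (Vec n) (Vec q)).injective h0
  · exact (continuousMultilinearCurryFin1 ℝ (Vec n) (Vec q)).injective h1

variable (n q) in
/-- The point and the slope of a first order jet. -/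
def firstJet : JetModel n q 1 →L[ℝ] (Vec n × Vec q) × (Vec n →L[ℝ] Vec q) :=
  LinearMap.toContinuousLinearMap
    ((LinearMap.id.prodMap (value n q)).prod (slope n q ∘ₗ LinearMap.snd ℝ _ _))

theorem firstJet_apply (z : JetModel n q 1) :
    firstJet n q z = ((z.1, value n q z.2), slope n q z.2) := rfl

theorem firstJet_injective : Injective (firstJet n q) := fun a b h => by
  rw [firstJet_apply, firstJet_apply] at h
  exact Prod.ext (congrArg (fun w => w.1.1) h)
    (taylorSpace_one_ext (congrArg (fun w => w.1.2) h) (congrArg (fun w => w.2) h))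

theorem firstJet_jetCurve {x₀ x : Vec n} {f : Vec n → Vec q} (hf : SmoothNear f x) :
    firstJet n q (jetCurve 1 x₀ f x) = ((x₀ + x, f x), fderiv ℝ f x) := by
  rw [firstJet_apply, jetCurve, slope_taylorOf' hf.comp_const_add,
    value_taylorOf' hf.comp_const_add, fderiv_comp_add_left, add_zero]

theorem firstJet_eq_map (z : JetModel n q 1) :
    firstJet n q z = ((z.1, z.map 0), fderiv ℝ z.map 0) := by
  have := firstJet_jetCurve (x₀ := z.1) z.smoothNear_map
  rwa [jetCurve_zero, taylorOf'_map, add_zero] at this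

end FirstJet

section JetCoord
variable {c : F} {A : Splitting V n} {θ : Jet I F n 1} {x₀ : Vec n}
  {f : Vec n → Vec (Module.finrank ℝ V - n)} {ψ : Vec n → Vec n} {s : ImmGerm I F n}

/-- The point and the slope of a first order jet, in divided coordinates. -/
def jetCoord (c : F) (A : Splitting V n) (θ : Jet I F n 1) :
    (Vec n × Vec (Module.finrank ℝ V - n)) × (Vec n →L[ℝ] Vec (Module.finrank ℝ V - n)) :=
  firstJet n (Module.finrank ℝ V - n) (jetChart (I := I) 1 c A θ)

theorem contMDiffAt_jetCoord (h : θ ∈ (jetChart (I := I) 1 c A).source) :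
    ContMDiffAt (jetI V n 1) 𝓘(ℝ, (Vec n × Vec (Module.finrank ℝ V - n)) ×
      (Vec n →L[ℝ] Vec (Module.finrank ℝ V - n))) ∞ (jetCoord (I := I) c A) θ :=
  ContMDiffAt.comp θ (firstJet n _).contDiff.contMDiff.contMDiffAt (contMDiffAt_jetChart h)

/-- The derivative of the coordinates of first order jets. -/
def jetCoordDeriv (c : F) (A : Splitting V n) (θ : Jet I F n 1) :
    TangentSpace (jetI V n 1) θ →L[ℝ] (Vec n × Vec (Module.finrank ℝ V - n)) ×
      (Vec n →L[ℝ] Vec (Module.finrank ℝ V - n)) :=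
  mfderiv (jetI V n 1) 𝓘(ℝ, (Vec n × Vec (Module.finrank ℝ V - n)) ×
      (Vec n →L[ℝ] Vec (Module.finrank ℝ V - n))) (jetCoord (I := I) c A) θ

/-- `jetCoord` is a chart followed by an injective linear map, so vectors of `J¹` may be compared in
these coordinates. -/
theorem jetCoordDeriv_injective (h : θ ∈ (jetChart (I := I) 1 c A).source) :
    Injective (jetCoordDeriv c A θ) := by
  have m1 := (contMDiffAt_jetChart h).mdifferentiableAt (by simp)
  have m2 := (contMDiffAt_graphJet (jetChart_mem_target h)).mdifferentiableAt (by simp)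
  have e := HasMFDerivAt.comp θ ((firstJet n (Module.finrank ℝ V - n)).hasFDerivAt
    (x := jetChart (I := I) 1 c A θ)).hasMFDerivAt m1.hasMFDerivAt
  have e' := HasMFDerivAt.comp θ m2.hasMFDerivAt m1.hasMFDerivAt
  have e'' : HasMFDerivAt (jetI V n 1) (jetI V n 1) (id : Jet I F n 1 → Jet I F n 1) θ
      ((mfderiv (jetI V n 1) (jetI V n 1) (graphJet (I := I) 1 c A) (jetChart 1 c A θ)).comp
        (mfderiv (jetI V n 1) (jetI V n 1) (jetChart (I := I) 1 c A) θ)) := by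
    refine e'.congr_of_eventuallyEq ?_
    filter_upwards [isOpen_jetChart_source.mem_nhds h] with y hy
    exact (graphJet_jetChart hy).symm
  have k := hasMFDerivAt_unique e'' (hasMFDerivAt_id θ)
  intro v w hvw
  have h1 : mfderiv (jetI V n 1) (jetI V n 1) (jetChart (I := I) 1 c A) θ v =
      mfderiv (jetI V n 1) (jetI V n 1) (jetChart (I := I) 1 c A) θ w :=
    firstJet_injective ((DFunLike.congr_fun e.mfderiv v).symm.trans
      (hvw.trans (DFunLike.congr_fun e.mfderiv w)))
  exact (DFunLike.congr_fun k v).symm.trans ((congrArg (mfderiv (jetI V n 1) (jetI V n 1)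
    (graphJet (I := I) 1 c A) (jetChart 1 c A θ)) h1).trans (DFunLike.congr_fun k w))

theorem jetCoord_fst (h : θ ∈ (jetChart (I := I) 1 c A).source) :
    (jetCoord c A θ).1 = dividedChart (I := I) c A θ.base := by
  rw [(dividedChart_base h).2, jetCoord, firstJet_eq_map]

theorem ImmGerm.IsGraph.jetCoord_mk (hs : s.IsGraph c A x₀ f ψ) :
    jetCoord c A (Jet.mk 1 s) = ((x₀, f 0), fderiv ℝ f 0) := by
  rw [jetCoord, hs.jetChart_mk, firstJet_jetCurve hs.smooth, add_zero]

theorem ImmGerm.IsGraph.jetCoord_prolong (hs : s.IsGraph c A x₀ f ψ) :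
    jetCoord c A ∘ s.prolong 1 =ᶠ[𝓝 0]
      (fun x => ((x₀ + x, f x), fderiv ℝ f x)) ∘ ψ := by
  filter_upwards [hs.prolong_eq 1, hs.reparam.tendsto.eventually (hs.eventually_mem 1),
    hs.reparam.tendsto.eventually hs.smooth.eventually] with x h1 h2 h3
  rw [comp_apply, h1, comp_apply, comp_apply, jetCoord, jetChart_graphJet h2,
    firstJet_jetCurve h3]
  rfl

theorem ImmGerm.IsGraph.dividedChart_comp (hs : s.IsGraph c A x₀ f ψ) :
    dividedChart (I := I) c A ∘ s =ᶠ[𝓝 0] fun x => (x₀ + ψ x, f (ψ x)) := by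
  filter_upwards [hs.eq, hs.reparam.tendsto.eventually
    (dividedChart_graphMap hs.smooth hs.mem)] with x h1 h2
  rw [comp_apply, h1]
  exact h2.2

theorem ImmGerm.IsGraph.mem_source (hs : s.IsGraph c A x₀ f ψ) :
    s 0 ∈ (dividedChart (I := I) c A).source :=
  (dividedChart_base (hs.mk_mem_source 1)).1

theorem mem_plane_iff (h : θ ∈ (jetChart (I := I) 1 c A).source) (w : TangentSpace I θ.base) :
    (⟨θ.base, w⟩ : TangentBundle I F) ∈ θ.plane ↔
      (dividedDeriv I c A θ.base w).2 = (jetCoord c A θ).2 (dividedDeriv I c A θ.base w).1 := by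
  have key (s : ImmGerm I F n) (hs : Jet.mk 1 s = θ) (w : TangentSpace I (s 0)) :
      w ∈ LinearMap.range (mfderiv 𝓘(ℝ, Vec n) I s 0).toLinearMap ↔
      (dividedDeriv I c A (s 0) w).2 = (jetCoord c A θ).2 (dividedDeriv I c A (s 0) w).1 := by
    obtain ⟨x₀, f, ψ, hG⟩ := ImmGerm.exists_isGraph_of_mem_source one_ne_zero (hs ▸ h)
    rw [mem_range_mfderiv_iff hG.mem_source (s.smooth.self_of_nhds.mdifferentiableAt (by simp))
      hG.dividedChart_comp (hG.reparam.smooth.self.differentiableAt (by simp))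
      (by rw [hG.reparam.map_zero]; exact hG.smooth.self.differentiableAt (by simp))
      hG.reparam.injective, ← hs, hG.jetCoord_mk, hG.reparam.map_zero]
  constructor
  · rintro ⟨s, rfl, u, hu⟩
    refine (key s rfl w).1 ⟨u, ?_⟩
    exact tangentBundle_mk_inj hu
  · obtain ⟨s, rfl⟩ := θ.exists_mk
    intro hw
    obtain ⟨u, hu⟩ := (key s rfl w).2 hw
    exact ⟨s, rfl, u, tangentBundle_mk_eq (J₁ := I) rfl hu⟩

/-- Up to the change of parameters, the curve of first jets is `x ↦ ((x₀ + x, f x), Df x)`, and the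
`R`-plane is the range of its derivative. -/
theorem ImmGerm.IsGraph.mem_RPlane_iff (hs : s.IsGraph c A x₀ f ψ)
    (ξ : TangentBundle (jetI V n 1) (Jet I F n 1)) :
    ξ ∈ (Jet.mk 2 s).RPlane ↔ ξ.proj = Jet.mk 1 s ∧ ∃ e : Vec n, jetCoordDeriv c A ξ.proj ξ.2 =
      ((e, fderiv ℝ f 0 e), fderiv ℝ (fderiv ℝ f) 0 e) := by
  have hd : HasFDerivAt (fun x => ((x₀ + x, f x), fderiv ℝ f x))
      (((ContinuousLinearMap.id ℝ (Vec n)).prod (fderiv ℝ f 0)).prod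
        (fderiv ℝ (fderiv ℝ f) 0)) (ψ 0) := by
    rw [hs.reparam.map_zero]
    refine HasFDerivAt.prodMk (((hasFDerivAt_id 0).const_add x₀).prodMk
      (hs.smooth.self.differentiableAt (by simp)).hasFDerivAt) ?_
    exact ((hs.smooth.self.fderiv_right (m := ∞) (by simp)).differentiableAt
      (by simp)).hasFDerivAt
  have hψ := (hs.reparam.smooth.self.differentiableAt (by simp)).hasFDerivAt
  have h1 := hd.comp 0 hψ
  have hJ := (contMDiffAt_jetCoord (hs.mk_mem_source 1)).mdifferentiableAt (by simp)
  rw [← s.prolong_zero] at hJ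
  have h2 := HasMFDerivAt.comp 0 hJ.hasMFDerivAt (s.mdifferentiableAt_prolong 1).hasMFDerivAt
  let L : Vec n →L[ℝ] (Vec n × Vec (Module.finrank ℝ V - n)) ×
      (Vec n →L[ℝ] Vec (Module.finrank ℝ V - n)) :=
    (jetCoordDeriv c A (s.prolong 1 0)).comp
      (mfderiv 𝓘(ℝ, Vec n) (jetI V n 1) (s.prolong 1) 0)
  have h3 : HasFDerivAt ((fun x => ((x₀ + x, f x), fderiv ℝ f x)) ∘ ψ) L 0 :=
    (h2.congr_of_eventuallyEq hs.jetCoord_prolong.symm).hasFDerivAt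
  have e (u : Vec n) : jetCoordDeriv c A (s.prolong 1 0)
      (mfderiv 𝓘(ℝ, Vec n) (jetI V n 1) (s.prolong 1) 0 u) =
      ((fderiv ℝ ψ 0 u, fderiv ℝ f 0 (fderiv ℝ ψ 0 u)),
        fderiv ℝ (fderiv ℝ f) 0 (fderiv ℝ ψ 0 u)) :=
    DFunLike.congr_fun (h3.unique h1) u
  rw [Jet.RPlane_mk]
  constructor
  · rintro ⟨u, rfl⟩
    exact ⟨s.prolong_zero 1, fderiv ℝ ψ 0 u, e u⟩
  · obtain ⟨θ, w⟩ := ξ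
    rintro ⟨h, e', he'⟩
    rw [← s.prolong_zero] at h
    dsimp only at h
    subst h
    obtain ⟨u, rfl⟩ := surjective_of_injective_endo hs.reparam.injective e'
    refine ⟨u, tangentBundle_mk_eq (J₁ := jetI V n 1) rfl ?_⟩
    refine jetCoordDeriv_injective (c := c) (A := A) ?_ ((e u).trans he'.symm)
    rw [s.prolong_zero]
    exact hs.mk_mem_source 1

end JetCoord

end

end GrassmannJet

namespace GrassmannJet

noncomputable section

variable {V : Type*} [NormedAddCommGroup V] [NormedSpace ℝ V] [FiniteDimensional ℝ V]
  {H : Type*} [TopologicalSpace H] {I : ModelWithCorners ℝ V H}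
  {F : Type*} [TopologicalSpace F] [ChartedSpace H F] {n : ℕ} [IsManifold I ∞ F] [I.Boundaryless]

/-! ### Totally geodesic submanifolds and horizontal lifts in coordinates -/

section Geodesic
variable {cov : Connection I F} {c p : F} {A : Splitting V n} {θ : Jet I F n 1} {x₀ : Vec n}
  {f : Vec n → Vec (Module.finrank ℝ V - n)} {ψ : Vec n → Vec n} {s : ImmGerm I F n}
  {B : V →L[ℝ] V →L[ℝ] V} {P : Vec n →L[ℝ] Vec (Module.finrank ℝ V - n)}

theorem ImmGerm.IsGraph.eventually_mem_range_iff (hs : s.IsGraph c A x₀ f ψ) :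
    ∀ᶠ x in 𝓝 (0 : Vec n), ∀ w : TangentSpace I (s x),
      w ∈ LinearMap.range (mfderiv 𝓘(ℝ, Vec n) I s x).toLinearMap ↔
        (dividedDeriv I c A (s x) w).2 = fderiv ℝ f (ψ x) (dividedDeriv I c A (s x) w).1 := by
  filter_upwards [s.smooth, s.smooth.self_of_nhds.continuousAt.eventually
    (isOpen_dividedChart_source.mem_nhds hs.mem_source),
    eventually_eventually_nhds.2 hs.dividedChart_comp, hs.reparam.smooth,
    hs.reparam.tendsto.eventually hs.smooth, hs.reparam.eventually_injective]
    with x h1 h2 h3 h4 h5 h6 w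
  exact mem_range_mfderiv_iff h2 (h1.mdifferentiableAt (by simp)) h3
    (h4.differentiableAt (by simp)) (h5.differentiableAt (by simp)) h6 w

theorem ImmGerm.IsGraph.hasFDerivAt_slope (hs : s.IsGraph c A x₀ f ψ) :
    HasFDerivAt (fun x => fderiv ℝ f (ψ x)) ((fderiv ℝ (fderiv ℝ f) 0).comp (fderiv ℝ ψ 0)) 0 := by
  have h1 : HasFDerivAt (fderiv ℝ f) (fderiv ℝ (fderiv ℝ f) 0) (ψ 0) := by
    rw [hs.reparam.map_zero]
    exact ((hs.smooth.self.fderiv_right (m := ∞) (by simp)).differentiableAt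
      (by simp)).hasFDerivAt
  exact h1.comp 0 (hs.reparam.smooth.self.differentiableAt (by simp)).hasFDerivAt

theorem ImmGerm.IsGraph.dividedDeriv_mfderiv (hs : s.IsGraph c A x₀ f ψ) (u : Vec n) :
    dividedDeriv I c A (s 0) (mfderiv 𝓘(ℝ, Vec n) I s 0 u) =
      (fderiv ℝ ψ 0 u, fderiv ℝ f 0 (fderiv ℝ ψ 0 u)) := by
  have h1 := (hs.reparam.smooth.self.differentiableAt (by simp)).hasFDerivAt
  have h2 : HasFDerivAt f (fderiv ℝ f 0) (ψ 0) := by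
    rw [hs.reparam.map_zero]
    exact (hs.smooth.self.differentiableAt (by simp)).hasFDerivAt
  rw [dividedDeriv_comp hs.mem_source (s.smooth.self_of_nhds.mdifferentiableAt (by simp)),
    hs.dividedChart_comp.fderiv_eq]
  have hd : HasFDerivAt (fun x => (x₀ + ψ x, f (ψ x)))
    ((fderiv ℝ ψ 0).prod ((fderiv ℝ f 0).comp (fderiv ℝ ψ 0))) 0 :=
    (h1.const_add x₀).prodMk (h2.comp 0 h1)
  rw [hd.fderiv]
  rfl

/-- Totally geodesic contact in coordinates. -/
theorem ImmGerm.IsGraph.secondFundamentalForm_eq_zero_iff (hs : s.IsGraph c A x₀ f ψ)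
    (hB : IsChristoffel cov c (s 0) B) :
    (∀ (v : TangentSpace I (s 0)) (Y : (q : F) → TangentSpace I q),
      v ∈ LinearMap.range (mfderiv 𝓘(ℝ, Vec n) I s 0).toLinearMap → SmoothFieldNear Y (s 0) →
      (∀ᶠ x in 𝓝 (0 : Vec n), Y (s x) ∈ LinearMap.range (mfderiv 𝓘(ℝ, Vec n) I s x).toLinearMap) →
      secondFundamentalForm cov s v Y = 0) ↔
    ∀ e η : Vec n, fderiv ℝ (fderiv ℝ f) 0 e η =
      geodesicTerm A B (fderiv ℝ f 0) (e, fderiv ℝ f 0 e) η := by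
  have hsm := s.smooth.self_of_nhds.mdifferentiableAt (n := ∞) (by simp)
  have hreg := hs.eventually_mem_range_iff
  have hslope := hs.hasFDerivAt_slope
  -- By `dividedDeriv_cov` the normal part of the covariant derivative depends on `Y` only through
  -- its first coordinates at `s 0`.
  have key (u : Vec n) (Y : (q : F) → TangentSpace I q) (hY : SmoothFieldNear Y (s 0))
      (hYs : ∀ᶠ x in 𝓝 (0 : Vec n), Y (s x) ∈
        LinearMap.range (mfderiv 𝓘(ℝ, Vec n) I s x).toLinearMap) :
      secondFundamentalForm cov s (mfderiv 𝓘(ℝ, Vec n) I s 0 u) Y = 0 ↔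
        fderiv ℝ (fderiv ℝ f) 0 (fderiv ℝ ψ 0 u) (dividedDeriv I c A (s 0) (Y (s 0))).1 =
        geodesicTerm A B (fderiv ℝ f 0) (fderiv ℝ ψ 0 u, fderiv ℝ f 0 (fderiv ℝ ψ 0 u))
          (dividedDeriv I c A (s 0) (Y (s 0))).1 := by
    have h := dividedDeriv_cov (X := Vec n) (m := s) hB hs.mem_source hsm
      hslope.differentiableAt (mdifferentiableAt_of_contMDiffAt_field hY.self_of_nhds) (by
        filter_upwards [hreg, hYs] with x h1 h2 using (h1 _).1 h2) u
    rw [hs.dividedDeriv_mfderiv, hslope.fderiv, hs.reparam.map_zero] at h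
    unfold secondFundamentalForm
    rw [Submodule.Quotient.mk_eq_zero, hreg.self_of_nhds, hs.reparam.map_zero, ← sub_eq_zero, h,
      sub_eq_zero]
    rfl
  constructor
  · intro h e η
    obtain ⟨u, rfl⟩ := surjective_of_injective_endo hs.reparam.injective e
    have hx₀ : (dividedChart (I := I) c A (s 0)).1 - x₀ = 0 := by
      have := congrArg Prod.fst hs.dividedChart_comp.self_of_nhds
      simp only [comp_apply, hs.reparam.map_zero, add_zero] at this
      rw [this, sub_self]
    have hgs : SmoothNear (fun w : Vec n × Vec (Module.finrank ℝ V - n) =>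
        (η, fderiv ℝ f (w.1 - x₀) η)) (dividedChart (I := I) c A (s 0)) := by
      have h1 : SmoothNear (fun y => (η, fderiv ℝ f y η)) 0 := by
        filter_upwards [hs.smooth] with y hy
        exact contDiffAt_const.prodMk ((hy.fderiv_right (m := ∞) (by simp)).clm_apply
          contDiffAt_const)
      exact SmoothNear.comp (f := fun w : Vec n × Vec (Module.finrank ℝ V - n) => w.1 - x₀)
        hx₀ h1 (ContDiff.smoothNear (contDiff_fst.sub contDiff_const) _)
    -- The test field has first coordinates constantly `η` near `s 0`. It is extended off the graph
    -- by ignoring the dependent variables, and it is tangent to the graph along the graph.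
    obtain ⟨Y, hY, hYg⟩ := exists_field hs.mem_source
      (g := fun q => (η, fderiv ℝ f ((dividedChart (I := I) c A q).1 - x₀) η)) (by
        have hD := eventually_contMDiffAt_dividedChart hs.mem_source
        filter_upwards [hD, hD.self_of_nhds.continuousAt.eventually hgs] with q h1 h2
        exact ContMDiffAt.comp (g := fun w : Vec n × Vec (Module.finrank ℝ V - n) =>
          (η, fderiv ℝ f (w.1 - x₀) η)) q h2.contMDiffAt h1)
    have hYs : ∀ᶠ x in 𝓝 (0 : Vec n), Y (s x) ∈
        LinearMap.range (mfderiv 𝓘(ℝ, Vec n) I s x).toLinearMap := by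
      filter_upwards [hreg, hsm.continuousAt.eventually hYg, hs.dividedChart_comp] with x h1 h2 h3
      rw [h1, h2]
      have : dividedChart (I := I) c A (s x) = (x₀ + ψ x, f (ψ x)) := h3
      rw [this, add_sub_cancel_left]
    have := (key u Y hY hYs).1 (h _ Y ⟨u, rfl⟩ hY hYs)
    rwa [hYg.self_of_nhds] at this
  · rintro h _ Y ⟨u, rfl⟩ hY hYs
    exact (key u Y hY hYs).2 (h _ _)

theorem mem_plane_iff_of_base (h : θ ∈ (jetChart (I := I) 1 c A).source) (hb : θ.base = p)
    (w : TangentSpace I p) : (⟨p, w⟩ : TangentBundle I F) ∈ θ.plane ↔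
      (dividedDeriv I c A p w).2 = (jetCoord c A θ).2 (dividedDeriv I c A p w).1 := by
  subst hb
  exact mem_plane_iff h w

/-- Parallel plane fields in coordinates. -/
theorem isParallelAlong_iff {σ : F → Jet I F n 1} (hσ : IsPlaneField σ p)
    (hsrc : σ p ∈ (jetChart (I := I) 1 c A).source) (hB : IsChristoffel cov c p B)
    (v : TangentSpace I p) :
    IsParallelAlong cov σ p v ↔ ∀ η, (jetCoordDeriv c A (σ p) (mfderiv I (jetI V n 1) σ p v)).2 η =
      geodesicTerm A B (jetCoord c A (σ p)).2 (dividedDeriv I c A p v) η := by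
  have hbp : (σ p).base = p := hσ.2.self_of_nhds
  have hp : p ∈ (dividedChart (I := I) c A).source := by
    have := (dividedChart_base hsrc).1
    rwa [hbp] at this
  -- Here `m` is the inverse of the divided chart, so that `dividedDeriv_cov` differentiates over
  -- all of `F` instead of along a submanifold.
  obtain ⟨m, x, hmd, e, rfl⟩ : ∃ (m : Vec n × Vec (Module.finrank ℝ V - n) → F) (x : _),
      MDifferentiableAt 𝓘(ℝ, Vec n × Vec (Module.finrank ℝ V - n)) I m x ∧
      dividedChart (I := I) c A ∘ m =ᶠ[𝓝 x] id ∧ m x = p := by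
    have hx := (dividedChart (I := I) c A).map_source hp
    refine ⟨_, _, (contMDiffAt_dividedChart_symm hx).mdifferentiableAt (by simp), ?_,
      (dividedChart (I := I) c A).left_inv hp⟩
    filter_upwards [isOpen_dividedChart_target.mem_nhds hx] with y hy
      using (dividedChart (I := I) c A).right_inv hy
  have hmv : mfderiv 𝓘(ℝ, Vec n × Vec (Module.finrank ℝ V - n)) I m x
      (dividedDeriv I c A (m x) v) = v := by
    apply dividedDeriv_injective hp
    rw [dividedDeriv_comp hp hmd]
    rw [e.fderiv_eq, fderiv_id]
    rfl
  have hσm := hσ.1.self_of_nhds.mdifferentiableAt (n := ∞) (by simp)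
  have hJ := (contMDiffAt_jetCoord hsrc).mdifferentiableAt (by simp)
  let T : Vec n × Vec (Module.finrank ℝ V - n) →L[ℝ] (Vec n × Vec (Module.finrank ℝ V - n)) ×
      (Vec n →L[ℝ] Vec (Module.finrank ℝ V - n)) :=
    (jetCoordDeriv c A (σ (m x))).comp ((mfderiv I (jetI V n 1) σ (m x)).comp
      (mfderiv 𝓘(ℝ, Vec n × Vec (Module.finrank ℝ V - n)) I m x))
  have hσm' : HasMFDerivAt 𝓘(ℝ, Vec n × Vec (Module.finrank ℝ V - n)) (jetI V n 1) (σ ∘ m) x _ :=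
    HasMFDerivAt.comp x hσm.hasMFDerivAt hmd.hasMFDerivAt
  have hT : HasFDerivAt (jetCoord c A ∘ σ ∘ m) T x :=
    (HasMFDerivAt.comp (g := jetCoord c A) (f := σ ∘ m) x hJ.hasMFDerivAt hσm').hasFDerivAt
  have hplane : ∀ᶠ q in 𝓝 (m x), ∀ w : TangentSpace I q,
      (⟨q, w⟩ : TangentBundle I F) ∈ (σ q).plane ↔
        (dividedDeriv I c A q w).2 = (jetCoord c A (σ q)).2 (dividedDeriv I c A q w).1 := by
    filter_upwards [hσ.2, hσm.continuousAt.eventually (isOpen_jetChart_source.mem_nhds hsrc)]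
      with q h1 h2 w using mem_plane_iff_of_base h2 h1 w
  have key (Y : (q : F) → TangentSpace I q) (hY : SmoothFieldNear Y (m x))
      (hYs : ∀ᶠ q in 𝓝 (m x), (⟨q, Y q⟩ : TangentBundle I F) ∈ (σ q).plane) :
      (⟨m x, cov Y (m x) v⟩ : TangentBundle I F) ∈ (σ (m x)).plane ↔
        (jetCoordDeriv c A (σ (m x)) (mfderiv I (jetI V n 1) σ (m x) v)).2
          (dividedDeriv I c A (m x) (Y (m x))).1 =
        geodesicTerm A B (jetCoord c A (σ (m x))).2 (dividedDeriv I c A (m x) v)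
          (dividedDeriv I c A (m x) (Y (m x))).1 := by
    have h := dividedDeriv_cov (m := m) hB hp hmd hT.snd.differentiableAt
      (mdifferentiableAt_of_contMDiffAt_field hY.self_of_nhds) (by
        filter_upwards [hmd.continuousAt.eventually hplane, hmd.continuousAt.eventually hYs]
          with y h1 h2 using (h1 _).1 h2) (dividedDeriv I c A (m x) v)
    rw [hmv, hT.snd.fderiv] at h
    simp only [comp_apply] at h
    have hTv : T (dividedDeriv I c A (m x) v) =
        jetCoordDeriv c A (σ (m x)) (mfderiv I (jetI V n 1) σ (m x) v) :=
      congrArg (fun v => jetCoordDeriv c A (σ (m x)) (mfderiv I (jetI V n 1) σ (m x) v)) hmv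
    rw [hplane.self_of_nhds, ← sub_eq_zero, h, sub_eq_zero, ← hTv]
    rfl
  constructor
  · intro h η
    -- The section of `σ` whose first coordinates are constantly `η`.
    obtain ⟨Y, hY, hYg⟩ := exists_field hp (g := fun q => (η, (jetCoord c A (σ q)).2 η)) (by
      filter_upwards [hσ.1, hσm.continuousAt.eventually (isOpen_jetChart_source.mem_nhds hsrc)]
        with q h1 h2
      have h3 := ContMDiffAt.comp q (contMDiffAt_jetCoord h2) h1
      have h4 : ContDiff ℝ ∞ fun w : (Vec n × Vec (Module.finrank ℝ V - n)) ×
          (Vec n →L[ℝ] Vec (Module.finrank ℝ V - n)) => (η, w.2 η) := by fun_prop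
      exact ContMDiffAt.comp (g := fun w : (Vec n × Vec (Module.finrank ℝ V - n)) ×
          (Vec n →L[ℝ] Vec (Module.finrank ℝ V - n)) => (η, w.2 η)) (f := jetCoord c A ∘ σ) q
        h4.contMDiff.contMDiffAt h3)
    have hYs : ∀ᶠ q in 𝓝 (m x), (⟨q, Y q⟩ : TangentBundle I F) ∈ (σ q).plane := by
      filter_upwards [hplane, hYg] with q h1 h2
      rw [h1, h2]
    have := (key Y hY hYs).1 (h Y hY hYs)
    rwa [hYg.self_of_nhds] at this
  · intro h Y hY hYs
    exact (key Y hY hYs).2 (h _)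

end Geodesic

end

end GrassmannJet

namespace GrassmannJet

noncomputable section

variable {V : Type*} [NormedAddCommGroup V] [NormedSpace ℝ V] [FiniteDimensional ℝ V]
  {H : Type*} [TopologicalSpace H] {I : ModelWithCorners ℝ V H}
  {F : Type*} [TopologicalSpace F] [ChartedSpace H F] {n : ℕ} [IsManifold I ∞ F] [I.Boundaryless]

/-! ### The section `Γ̈` in coordinates -/

section Quadratic
variable {q : ℕ}

/-- A quadratic map. -/
def quadratic (u : Vec q) (P : Vec n →L[ℝ] Vec q) (K : Vec n →L[ℝ] Vec n →L[ℝ] Vec q) (y : Vec n) :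
    Vec q := u + P y + (2⁻¹ : ℝ) • K y y

variable {u : Vec q} {P : Vec n →L[ℝ] Vec q} {K : Vec n →L[ℝ] Vec n →L[ℝ] Vec q}

theorem quadratic_zero : quadratic u P K 0 = u := by simp [quadratic]

theorem smoothNear_quadratic (y : Vec n) : SmoothNear (quadratic u P K) y :=
  ContDiff.smoothNear (by unfold quadratic; fun_prop) y

/-- Symmetry of `K` makes the two terms of the product rule equal, which cancels the factor `2⁻¹`.
-/
theorem fderiv_quadratic (hK : ∀ a b, K a b = K b a) :
    fderiv ℝ (quadratic u P K) = fun y => P + K y := by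
  funext y
  have h := (((P.hasFDerivAt (x := y)).const_add u).add
    ((K.hasFDerivAt.clm_apply (hasFDerivAt_id y)).const_smul (2⁻¹ : ℝ))).fderiv
  refine Eq.trans h ?_
  ext1 v
  have : (2⁻¹ : ℝ) • (K y v + K v y) = K y v := by
    rw [hK v y, ← two_smul ℝ (K y v), smul_smul]
    norm_num
  exact congrArg (P v + ·) this

theorem fderiv_quadratic_zero (hK : ∀ a b, K a b = K b a) :
    fderiv ℝ (quadratic u P K) 0 = P := by
  rw [fderiv_quadratic hK]; simp

theorem fderiv_fderiv_quadratic (hK : ∀ a b, K a b = K b a) :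
    fderiv ℝ (fderiv ℝ (quadratic u P K)) 0 = K := by
  rw [fderiv_quadratic hK]
  exact (K.hasFDerivAt.const_add P).fderiv

end Quadratic

section Hess
variable {A : Splitting V n} {B : V →L[ℝ] V →L[ℝ] V}
  {P : Vec n →L[ℝ] Vec (Module.finrank ℝ V - n)}

/-- The second derivative prescribed by a connection for the totally geodesic graphs with
slope `P`. -/
def hess (A : Splitting V n) (B : V →L[ℝ] V →L[ℝ] V)
    (P : Vec n →L[ℝ] Vec (Module.finrank ℝ V - n)) :
    Vec n →L[ℝ] Vec n →L[ℝ] Vec (Module.finrank ℝ V - n) :=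
  let ι : Vec n →L[ℝ] V := (A.symm : Vec n × Vec (Module.finrank ℝ V - n) →L[ℝ] V).comp
    ((ContinuousLinearMap.id ℝ (Vec n)).prod P)
  let R : V →L[ℝ] Vec (Module.finrank ℝ V - n) :=
    (P.comp (ContinuousLinearMap.fst ℝ _ _) - ContinuousLinearMap.snd ℝ _ _).comp
      (A : V →L[ℝ] Vec n × Vec (Module.finrank ℝ V - n))
  (ContinuousLinearMap.compL ℝ (Vec n) V _ R).comp (B.bilinearComp ι ι)

theorem hess_apply (e η : Vec n) : hess A B P e η = geodesicTerm A B P (e, P e) η := rfl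

/-- This is where vanishing torsion matters: only a symmetric form is the second derivative of a
smooth map, so without it the equation might have no second jet over a given first jet. -/
theorem hess_symm (hB : ∀ a b, B a b = B b a) (e η : Vec n) :
    hess A B P e η = hess A B P η e := by
  rw [hess_apply, hess_apply, geodesicTerm, geodesicTerm, hB]

end Hess

section Structure
variable {cov : Connection I F} {c p : F} {A : Splitting V n} {θ : Jet I F n 1} {x₀ : Vec n}
  {f : Vec n → Vec (Module.finrank ℝ V - n)} {ψ : Vec n → Vec n} {s : ImmGerm I F n}
  {B : V →L[ℝ] V →L[ℝ] V}

theorem isGraph_graphGerm (hf : SmoothNear f 0)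
    (h : (x₀, f 0) ∈ (dividedChart (I := I) c A).target) :
    (graphGerm c A x₀ f hf h).IsGraph c A x₀ f id :=
  ⟨hf, h, IsReparam.id, EventuallyEq.rfl⟩

theorem jetCoord_graphJet (hf : SmoothNear f 0)
    (h : (x₀, f 0) ∈ (dividedChart (I := I) c A).target) :
    (x₀, taylorOf' 1 f) ∈ jetTarget (I := I) 1 c A ∧
      jetCoord c A (graphJet (I := I) 1 c A (x₀, taylorOf' 1 f)) = ((x₀, f 0), fderiv ℝ f 0) := by
  have h1 := mk_graphGerm (I := I) (r := 1) hf h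
  refine ⟨h1.1, ?_⟩
  rw [← h1.2]
  exact (isGraph_graphGerm hf h).jetCoord_mk

theorem jetCoord_injOn : InjOn (jetCoord (I := I) (n := n) c A)
    (jetChart (I := I) 1 c A).source := fun θ h θ' h' e => by
  rw [← graphJet_jetChart h, firstJet_injective e, graphJet_jetChart h']

theorem jetCoordDeriv_fst {σ : F → Jet I F n 1} (hσ : IsPlaneField σ p)
    (hsrc : σ p ∈ (jetChart (I := I) 1 c A).source) (v : TangentSpace I p) :
    (jetCoordDeriv c A (σ p) (mfderiv I (jetI V n 1) σ p v)).1 = dividedDeriv I c A p v := by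
  have hbp : (σ p).base = p := hσ.2.self_of_nhds
  have hp : p ∈ (dividedChart (I := I) c A).source := by
    have := (dividedChart_base hsrc).1
    rwa [hbp] at this
  have hσm := hσ.1.self_of_nhds.mdifferentiableAt (n := ∞) (by simp)
  have hJ := (contMDiffAt_jetCoord hsrc).mdifferentiableAt (by simp)
  have h1 := HasMFDerivAt.comp p hJ.hasMFDerivAt hσm.hasMFDerivAt
  have h2 := HasMFDerivAt.comp p ((ContinuousLinearMap.fst ℝ
    (Vec n × Vec (Module.finrank ℝ V - n)) (Vec n →L[ℝ] Vec (Module.finrank ℝ V - n))).hasFDerivAt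
      (x := jetCoord c A (σ p))).hasMFDerivAt h1
  have e : dividedChart (I := I) c A =ᶠ[𝓝 p]
      (ContinuousLinearMap.fst ℝ (Vec n × Vec (Module.finrank ℝ V - n))
        (Vec n →L[ℝ] Vec (Module.finrank ℝ V - n))) ∘ (jetCoord c A ∘ σ) := by
    filter_upwards [hσ.2, hσm.continuousAt.eventually (isOpen_jetChart_source.mem_nhds hsrc)]
      with q h1 h2
    exact ((jetCoord_fst h2).trans (congrArg _ h1)).symm
  exact (DFunLike.congr_fun (h2.congr_of_eventuallyEq e).mfderiv v).symm

theorem tangentMap_base_planeField {σ : F → Jet I F n 1} (hσ : IsPlaneField σ p)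
    (v : TangentSpace I p) :
    tangentMap (jetI V n 1) I Jet.base
      (⟨σ p, mfderiv I (jetI V n 1) σ p v⟩ : TangentBundle (jetI V n 1) (Jet I F n 1)) =
      ⟨p, v⟩ := by
  have hσm := hσ.1.self_of_nhds.mdifferentiableAt (n := ∞) (by simp)
  have hb := (Jet.contMDiff_base (I := I) (F := F) (n := n) (r := 1) (σ p)).mdifferentiableAt
    (by simp)
  have h := HasMFDerivAt.comp p hb.hasMFDerivAt hσm.hasMFDerivAt
  have h' : HasMFDerivAt I I (id : F → F) p _ :=
    h.congr_of_eventuallyEq (hσ.2.mono fun q hq => hq.symm)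
  exact tangentBundle_mk_eq (J₁ := I) hσ.2.self_of_nhds
    (DFunLike.congr_fun (hasMFDerivAt_unique h' (hasMFDerivAt_id p)) v)

/-- Through each jet passes a plane field with prescribed derivative. -/
theorem exists_planeField (h : θ ∈ (jetChart (I := I) 1 c A).source)
    (K : Vec n →L[ℝ] Vec n →L[ℝ] Vec (Module.finrank ℝ V - n)) :
    ∃ σ : F → Jet I F n 1, IsPlaneField σ θ.base ∧ σ θ.base = θ ∧
      ∀ v, (jetCoordDeriv c A (σ θ.base) (mfderiv I (jetI V n 1) σ θ.base v)).2 =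
        K (dividedDeriv I c A θ.base v).1 := by
  obtain ⟨hp, hD⟩ := dividedChart_base h
  set p := θ.base with hpdef
  set P := (jetCoord c A θ).2 with hP
  set w₀ := dividedChart (I := I) c A p with hw₀
  -- At the point with coordinates `y` the plane gets the slope `P + K (y.1 - w₀.1)`. This is affine
  -- in `y`, with value `P` at the base point and derivative `K` in the independent variables.
  let k : (Vec n × Vec (Module.finrank ℝ V - n)) × Vec n → Vec (Module.finrank ℝ V - n) :=
    fun w => w.1.2 + (P w.2 + K (w.1.1 - w₀.1) w.2)
  have hk : ContDiff ℝ ∞ k := by fun_prop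
  have hkx (w) : SmoothNear (fun x => k (w, x)) 0 := ContDiff.smoothNear (by fun_prop) _
  have hk0 (w) : k (w, 0) = w.2 := by simp [k]
  have hkd (w) : fderiv ℝ (fun x => k (w, x)) 0 = P + K (w.1 - w₀.1) :=
    (((P + K (w.1 - w₀.1)).hasFDerivAt).const_add w.2).fderiv
  let T : Vec n × Vec (Module.finrank ℝ V - n) → JetModel n (Module.finrank ℝ V - n) 1 :=
    fun w => (w.1, taylorOf' 1 fun x => k (w, x))
  have hT : ContDiff ℝ ∞ T := contDiff_fst.prodMk (contDiff_iff_contDiffAt.2 fun w =>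
    (smoothNear_taylorOf' (hk.smoothNear _)).self)
  have key (w) (hw : w ∈ (dividedChart (I := I) c A).target) :=
    jetCoord_graphJet (I := I) (c := c) (A := A) (x₀ := w.1) (hkx w) (by rw [hk0]; exact hw)
  have hσc : ∀ q ∈ (dividedChart (I := I) c A).source,
      (graphJet (I := I) 1 c A (T (dividedChart (I := I) c A q))).base = q ∧
      jetCoord c A (graphJet (I := I) 1 c A (T (dividedChart (I := I) c A q))) =
        (dividedChart (I := I) c A q, P + K ((dividedChart (I := I) c A q).1 - w₀.1)) := by
    intro q hq
    obtain ⟨h1, h2⟩ := key _ ((dividedChart (I := I) c A).map_source hq)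
    rw [hk0, hkd] at h2
    refine ⟨?_, h2⟩
    have h3 := jetCoord_fst (graphJet_mem_source h1)
    rw [h2] at h3
    exact ((dividedChart (I := I) c A).injOn hq
      (dividedChart_base (graphJet_mem_source h1)).1 h3).symm
  have hev : ∀ᶠ q in 𝓝 p, q ∈ (dividedChart (I := I) c A).source :=
    isOpen_dividedChart_source.mem_nhds hp
  have hσ : IsPlaneField (fun q => graphJet (I := I) 1 c A (T (dividedChart (I := I) c A q))) p := by
    refine ⟨?_, hev.mono fun q hq => (hσc q hq).1⟩
    filter_upwards [hev] with q hq
    exact ContMDiffAt.comp q (contMDiffAt_graphJet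
      (key _ ((dividedChart (I := I) c A).map_source hq)).1)
      (ContMDiffAt.comp q hT.contMDiff.contMDiffAt
        (eventually_contMDiffAt_dividedChart hq).self_of_nhds)
  have hσθ : graphJet (I := I) 1 c A (T w₀) = θ := by
    refine jetCoord_injOn (graphJet_mem_source
      (key _ ((dividedChart (I := I) c A).map_source hp)).1) h ?_
    rw [(hσc p hp).2]
    refine Prod.ext (jetCoord_fst h).symm ?_
    simp [hw₀, hP]
  refine ⟨_, hσ, hσθ, fun v => ?_⟩
  have hσm := hσ.1.self_of_nhds.mdifferentiableAt (n := ∞) (by simp)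
  have hJ := (contMDiffAt_jetCoord (hσθ.symm ▸ h)).mdifferentiableAt (by simp)
  have h1 := HasMFDerivAt.comp p hJ.hasMFDerivAt hσm.hasMFDerivAt
  let ℓ : Vec n × Vec (Module.finrank ℝ V - n) → (Vec n × Vec (Module.finrank ℝ V - n)) ×
      (Vec n →L[ℝ] Vec (Module.finrank ℝ V - n)) := fun w => (w, P + K (w.1 - w₀.1))
  have hℓ : HasFDerivAt ℓ ((ContinuousLinearMap.id ℝ _).prod
      (K.comp (ContinuousLinearMap.fst ℝ _ _))) w₀ :=
    (hasFDerivAt_id w₀).prodMk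
      ((K.hasFDerivAt.comp w₀ (hasFDerivAt_fst.sub_const w₀.1)).const_add P)
  have h2 := HasMFDerivAt.comp p hℓ.hasMFDerivAt (mdifferentiableAt_dividedChart hp).hasMFDerivAt
  have h3 := h2.congr_of_eventuallyEq
    (hev.mono fun q hq => (hσc q hq).2 :
      _ =ᶠ[𝓝 p] ℓ ∘ dividedChart (I := I) c A)
  exact congrArg Prod.snd (DFunLike.congr_fun (hasMFDerivAt_unique h1 h3) v)

/-- The horizontal lift of a plane in coordinates. -/
theorem mem_liftedPlane_iff (h : θ ∈ (jetChart (I := I) 1 c A).source)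
    (hB : IsChristoffel cov c θ.base B) (ξ : TangentBundle (jetI V n 1) (Jet I F n 1)) :
    ξ ∈ liftedPlane cov θ ↔ ξ.proj = θ ∧ ∃ e : Vec n, jetCoordDeriv c A ξ.proj ξ.2 =
      ((e, (jetCoord c A θ).2 e), hess A B (jetCoord c A θ).2 e) := by
  constructor
  · rintro ⟨⟨σ, p, v, hσ, hpar, rfl⟩, hθ, hb⟩
    dsimp only at hθ
    subst hθ
    have hbp : (σ p).base = p := hσ.2.self_of_nhds
    rw [tangentMap_base_planeField hσ, mem_plane_iff_of_base h hbp] at hb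
    rw [hbp] at hB
    rw [isParallelAlong_iff hσ h hB] at hpar
    refine ⟨rfl, (dividedDeriv I c A p v).1, ?_⟩
    have e : dividedDeriv I c A p v = ((dividedDeriv I c A p v).1,
      (jetCoord c A (σ p)).2 (dividedDeriv I c A p v).1) := Prod.ext rfl hb
    refine Prod.ext ?_ ?_
    · exact (jetCoordDeriv_fst hσ h v).trans e
    · ext1 η
      rw [hess_apply, ← e]
      exact hpar η
  · obtain ⟨θ', w⟩ := ξ
    rintro ⟨h', e, he⟩
    dsimp only at h'
    subst h'
    dsimp only at he
    -- A plane field through `θ'` whose slope has derivative `hess` in the independent variables is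
    -- parallel along every vector of the plane `θ'`, since such a vector has coordinates `(e, P
    -- e)`.
    obtain ⟨σ, hσ, hσθ, hd⟩ := exists_planeField h (hess A B (jetCoord c A θ').2)
    have hp := (dividedChart_base h).1
    generalize hpdef : θ'.base = p at *
    subst hσθ
    obtain ⟨v, hv⟩ : ∃ v : TangentSpace I p, dividedDeriv I c A p v =
        (e, (jetCoord c A (σ p)).2 e) := by
      refine ⟨constField I c (A.symm (e, (jetCoord c A (σ p)).2 e)) p, ?_⟩
      rw [dividedDeriv_apply hp, chartDeriv_constField hp, A.apply_symm_apply]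
    have hw : mfderiv I (jetI V n 1) σ p v = w := by
      refine jetCoordDeriv_injective h (Eq.trans ?_ he.symm)
      refine Prod.ext ((jetCoordDeriv_fst hσ h v).trans hv) ?_
      rw [hd, hv]
    subst hw
    refine ⟨⟨σ, p, v, hσ, ?_, rfl⟩, rfl, ?_⟩
    · rw [isParallelAlong_iff hσ h hB]
      intro η
      rw [hd, hv]
      rfl
    · rw [tangentMap_base_planeField hσ, mem_plane_iff_of_base h hpdef, hv]

/-- The `R`-plane of the second jet of `s` and the horizontal lift have the same coordinates, so
this jet is an admissible value of the `choose`. It is the only one, because a jet is determined by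
its `R`-plane. -/
theorem ImmGerm.IsGraph.grassmannStructure_mk (hs : s.IsGraph c A x₀ f ψ)
    (hB : IsChristoffel cov c (s 0) B)
    (hf : fderiv ℝ (fderiv ℝ f) 0 = hess A B (fderiv ℝ f 0)) :
    grassmannStructure cov (Jet.mk 1 s) = Jet.mk 2 s := by
  have hR : (Jet.mk 2 s).RPlane = liftedPlane cov (Jet.mk 1 s) := by
    ext ξ
    rw [hs.mem_RPlane_iff, mem_liftedPlane_iff (hs.mk_mem_source 1) hB, hs.jetCoord_mk, hf]
  have hex : ∃ θ₂ : Jet I F n 2, θ₂.proj (by norm_num) = Jet.mk 1 s ∧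
      θ₂.RPlane = liftedPlane cov (Jet.mk 1 s) := ⟨Jet.mk 2 s, rfl, hR⟩
  unfold grassmannStructure
  rw [dif_pos hex]
  obtain ⟨-, h2⟩ := hex.choose_spec
  obtain ⟨s', hs'⟩ := hex.choose.exists_mk
  rw [← hs'] at h2 ⊢
  rw [← hR, Jet.RPlane_mk, Jet.RPlane_mk] at h2
  exact mk_succ_eq_of_tangentPlane h2

/-- The jet over `θ` of a totally geodesic submanifold is that of the graph of a quadratic map. -/
theorem exists_isGraph_quadratic (h : θ ∈ (jetChart (I := I) 1 c A).source)
    (hB : IsChristoffel cov c θ.base B) :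
    ∃ s : ImmGerm I F n, s.IsGraph c A (jetCoord c A θ).1.1
      (quadratic (jetCoord c A θ).1.2 (jetCoord c A θ).2 (hess A B (jetCoord c A θ).2)) id ∧
      Jet.mk 1 s = θ ∧ grassmannStructure cov θ = Jet.mk 2 s := by
  have hsym := hess_symm (A := A) (P := (jetCoord c A θ).2) hB.symm
  have hsm : SmoothNear (quadratic (jetCoord c A θ).1.2 (jetCoord c A θ).2
    (hess A B (jetCoord c A θ).2)) 0 := smoothNear_quadratic 0
  have ht : ((jetCoord c A θ).1.1, quadratic (jetCoord c A θ).1.2 (jetCoord c A θ).2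
      (hess A B (jetCoord c A θ).2) 0) ∈ (dividedChart (I := I) c A).target := by
    rw [quadratic_zero, Prod.mk.eta, jetCoord_fst h]
    exact (dividedChart (I := I) c A).map_source (dividedChart_base h).1
  have hG := isGraph_graphGerm (I := I) hsm ht
  have h1 : Jet.mk 1 (graphGerm (I := I) c A _ _ hsm ht) = θ := by
    refine jetCoord_injOn (hG.mk_mem_source 1) h ?_
    rw [hG.jetCoord_mk, quadratic_zero, fderiv_quadratic_zero hsym]
  refine ⟨_, hG, h1, ?_⟩
  rw [← hG.grassmannStructure_mk (cov := cov) (B := B), h1]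
  · rw [← Jet.base_mk (r := 1), h1]; exact hB
  · rw [fderiv_fderiv_quadratic hsym, fderiv_quadratic_zero hsym]

theorem grassmannStructure_proj (hcov : ∀ p, HasChristoffel cov p) (θ : Jet I F n 1) :
    (grassmannStructure cov θ).proj (Nat.le_succ 1) = θ := by
  obtain ⟨s, rfl⟩ := θ.exists_mk
  obtain ⟨A, x₀, f, ψ, hs⟩ := s.exists_isGraph
  obtain ⟨Ch, -, hCh⟩ := hcov (s 0)
  obtain ⟨s', -, h1, h2⟩ := exists_isGraph_quadratic (hs.mk_mem_source 1) hCh.self_of_nhds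
  rw [h2, Jet.proj_mk, h1]

/-- The totally geodesic equation is the image of the section `Γ̈`. -/
theorem mem_geodesicEquation_iff (hcov : ∀ p, HasChristoffel cov p) (θ : Jet I F n 2) :
    θ ∈ geodesicEquation n cov ↔
      grassmannStructure cov (θ.proj (Nat.le_succ 1)) = θ := by
  constructor
  · intro h
    obtain ⟨s, rfl⟩ := θ.exists_mk
    obtain ⟨A, x₀, f, ψ, hs⟩ := s.exists_isGraph
    obtain ⟨Ch, -, hCh⟩ := hcov (s 0)
    refine hs.grassmannStructure_mk hCh.self_of_nhds ?_
    ext1 e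
    ext1 η
    exact (hs.secondFundamentalForm_eq_zero_iff hCh.self_of_nhds).1 (h s rfl) e η
  · rintro h s rfl
    obtain ⟨A, x₀, f, ψ, hs⟩ := s.exists_isGraph
    obtain ⟨Ch, -, hCh⟩ := hcov (s 0)
    have hB := hCh.self_of_nhds
    rw [hs.secondFundamentalForm_eq_zero_iff hB]
    -- The second jet of `s` is that of a quadratic graph whose second derivative is `hess` by
    -- construction.
    obtain ⟨s', hs', h1, h2⟩ := exists_isGraph_quadratic (cov := cov) (hs.mk_mem_source 1) hB
    have hsym := hess_symm (A := A) (P := (jetCoord (s 0) A (Jet.mk 1 s)).2) hB.symm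
    have h3 : Jet.mk 2 s' = Jet.mk 2 s := h2.symm.trans h
    have h4 := hs'.jetChart_mk 2
    rw [h3, hs.jetChart_mk 2, jetCurve_zero, jetCurve_zero] at h4
    have h5 := (taylorOf'_eq_iff hs.smooth hs'.smooth).1 (congrArg Prod.snd h4)
    intro e η
    have h6 := congrArg (fun L => L ![e, η]) (h5 2 le_rfl)
    rw [iteratedFDeriv_two_apply, iteratedFDeriv_two_apply, fderiv_fderiv_quadratic hsym] at h6
    rw [hs.jetCoord_mk] at h6
    exact h6

/-- In coordinates the section sends `(x, u, P)` to the second jet of the quadratic graph with value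
`u`, slope `P` and second derivative `hess`. This is smooth because the Christoffel symbols are. -/
theorem contMDiff_grassmannStructure (hcov : ∀ p, HasChristoffel cov p) :
    ContMDiff (jetI V n 1) (jetI V n 2) ∞ (grassmannStructure (n := n) cov) := by
  intro θ₀
  obtain ⟨s, rfl⟩ := θ₀.exists_mk
  obtain ⟨A, x₀, f, ψ, hs⟩ := s.exists_isGraph
  obtain ⟨Ch, hChs, hCh⟩ := hcov (s 0)
  have hsrc := hs.mk_mem_source 1
  have hev : ∀ᶠ θ in 𝓝 (Jet.mk 1 s), θ ∈ (jetChart (I := I) 1 (s 0) A).source :=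
    isOpen_jetChart_source.mem_nhds hsrc
  have hbase : ∀ᶠ θ : Jet I F n 1 in 𝓝 (Jet.mk 1 s),
      IsChristoffel cov (s 0) θ.base (Ch (extChartAt I (s 0) θ.base)) :=
    ((Jet.contMDiff_base (I := I) (r := 1)).continuous.tendsto (Jet.mk 1 s)).eventually hCh
  let k : ((Vec n × Vec (Module.finrank ℝ V - n)) × (Vec n →L[ℝ] Vec (Module.finrank ℝ V - n))) ×
      Vec n → Vec (Module.finrank ℝ V - n) :=
    fun w => quadratic w.1.1.2 w.1.2 (hess A (Ch (A.symm w.1.1)) w.1.2) w.2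
  let T : ((Vec n × Vec (Module.finrank ℝ V - n)) × (Vec n →L[ℝ] Vec (Module.finrank ℝ V - n))) →
      JetModel n (Module.finrank ℝ V - n) 2 :=
    fun w => (w.1.1, taylorOf' 2 fun x => k (w, x))
  have hAs (θ : Jet I F n 1) (hθ : θ ∈ (jetChart (I := I) 1 (s 0) A).source) :
      A.symm (jetCoord (s 0) A θ).1 = extChartAt I (s 0) θ.base := by
    rw [jetCoord_fst hθ]
    exact A.symm_apply_apply _
  have hk : SmoothNear k (jetCoord (s 0) A (Jet.mk 1 s), 0) := by
    have h1 : SmoothNear (fun w : ((Vec n × Vec (Module.finrank ℝ V - n)) ×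
        (Vec n →L[ℝ] Vec (Module.finrank ℝ V - n))) × Vec n => Ch (A.symm w.1.1))
        (jetCoord (s 0) A (Jet.mk 1 s), 0) :=
      SmoothNear.comp (f := fun w : ((Vec n × Vec (Module.finrank ℝ V - n)) ×
        (Vec n →L[ℝ] Vec (Module.finrank ℝ V - n))) × Vec n => A.symm w.1.1)
        (hAs _ hsrc) hChs (ContDiff.smoothNear (by fun_prop) _)
    filter_upwards [h1] with w hw
    have hy : ContDiffAt ℝ ∞ (fun w : ((Vec n × Vec (Module.finrank ℝ V - n)) ×
        (Vec n →L[ℝ] Vec (Module.finrank ℝ V - n))) × Vec n => A.symm (w.2, w.1.2 w.2)) w := by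
      fun_prop
    have h2 := A.contDiff.contDiffAt.comp w ((hw.clm_apply hy).clm_apply hy)
    have h3 : ContDiffAt ℝ ∞ (fun w : ((Vec n × Vec (Module.finrank ℝ V - n)) ×
        (Vec n →L[ℝ] Vec (Module.finrank ℝ V - n))) × Vec n => w.1.1.2 + w.1.2 w.2) w := by
      fun_prop
    have h4 : ContDiffAt ℝ ∞ (fun w : ((Vec n × Vec (Module.finrank ℝ V - n)) ×
        (Vec n →L[ℝ] Vec (Module.finrank ℝ V - n))) × Vec n => w.1.2) w := by
      fun_prop
    exact h3.add (((h4.clm_apply h2.fst).sub h2.snd).const_smul (2⁻¹ : ℝ))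
  have hT : ContDiffAt ℝ ∞ T (jetCoord (s 0) A (Jet.mk 1 s)) :=
    ContDiffAt.prodMk (by fun_prop) (smoothNear_taylorOf' hk).self
  have key (θ : Jet I F n 1) (h1 : θ ∈ (jetChart (I := I) 1 (s 0) A).source)
      (h2 : IsChristoffel cov (s 0) θ.base (Ch (extChartAt I (s 0) θ.base))) :
      T (jetCoord (s 0) A θ) ∈ jetTarget (I := I) 2 (s 0) A ∧
        grassmannStructure cov θ = graphJet 2 (s 0) A (T (jetCoord (s 0) A θ)) := by
    obtain ⟨s', hs', -, h4⟩ := exists_isGraph_quadratic h1 h2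
    have h5 := hs'.mk_eq 2
    rw [jetCurve_zero, ← hAs θ h1] at h5
    exact ⟨h5.1, h4.trans h5.2⟩
  refine ContMDiffAt.congr_of_eventuallyEq (f := graphJet (I := I) 2 (s 0) A ∘
    (T ∘ jetCoord (s 0) A)) ?_ ?_
  · exact ContMDiffAt.comp _ (contMDiffAt_graphJet (key _ hsrc hbase.self_of_nhds).1)
      (ContMDiffAt.comp _ hT.contMDiffAt (contMDiffAt_jetCoord hsrc))
  · filter_upwards [hev, hbase] with θ h1 h2 using (key θ h1 h2).2

end Structure

end

end GrassmannJet

namespace GrassmannJet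

noncomputable section

/-! ### Jets of submanifolds that are immersed by a map -/

section Immersed
variable {V : Type*} [NormedAddCommGroup V] [NormedSpace ℝ V] [FiniteDimensional ℝ V]
  {H : Type*} [TopologicalSpace H] {I : ModelWithCorners ℝ V H}
  {F : Type*} [TopologicalSpace F] [ChartedSpace H F] {n : ℕ} [IsManifold I ∞ F] [I.Boundaryless]
  {W : Type*} [NormedAddCommGroup W] [NormedSpace ℝ W]
  {c : F} {A : Splitting V n} {x₀ : Vec n} {f : Vec n → Vec (Module.finrank ℝ V - n)}
  {ψ : Vec n → Vec n} {s : ImmGerm I F n}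

/-- The right side involves only the first jet of `s`, so immersivity becomes a condition on points
of `J¹`, which `isOpen_immersedJets` shows to be open. -/
theorem ImmGerm.IsGraph.injective_fderiv_iff (hs : s.IsGraph c A x₀ f ψ) {G : F → W}
    (hG : MDifferentiableAt I 𝓘(ℝ, W) G (s 0)) :
    Injective (fderiv ℝ (G ∘ s) 0) ↔
      Injective ((fderiv ℝ (G ∘ (dividedChart (I := I) c A).symm)
        (jetCoord c A (Jet.mk 1 s)).1).comp
          ((ContinuousLinearMap.id ℝ (Vec n)).prod (jetCoord c A (Jet.mk 1 s)).2)) := by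
  rw [hs.jetCoord_mk]
  dsimp only
  have h0 : (dividedChart (I := I) c A).symm (x₀, f 0) = s 0 := by
    have : dividedChart (I := I) c A (s 0) = (x₀ + ψ 0, f (ψ 0)) :=
      hs.dividedChart_comp.self_of_nhds
    rw [hs.reparam.map_zero, add_zero] at this
    rw [← this]
    exact (dividedChart (I := I) c A).left_inv hs.mem_source
  have h1 : HasFDerivAt (G ∘ (dividedChart (I := I) c A).symm)
      (fderiv ℝ (G ∘ (dividedChart (I := I) c A).symm) (x₀, f 0)) (x₀ + ψ 0, f (ψ 0)) := by
    rw [hs.reparam.map_zero, add_zero]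
    have := MDifferentiableAt.comp (x₀, f 0) (g := G) (h0.symm ▸ hG)
      ((contMDiffAt_dividedChart_symm hs.mem).mdifferentiableAt (by simp))
    exact this.differentiableAt.hasFDerivAt
  have h2 := (hs.reparam.smooth.self.differentiableAt (by simp)).hasFDerivAt
  have h3 : HasFDerivAt f (fderiv ℝ f 0) (ψ 0) := by
    rw [hs.reparam.map_zero]
    exact (hs.smooth.self.differentiableAt (by simp)).hasFDerivAt
  have h4 := HasFDerivAt.comp (f := fun x => (x₀ + ψ x, f (ψ x))) 0 h1
    ((h2.const_add x₀).prodMk (h3.comp 0 h2))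
  have e : G ∘ s =ᶠ[𝓝 0] (G ∘ (dividedChart (I := I) c A).symm) ∘
      fun x => (x₀ + ψ x, f (ψ x)) := hs.eq.mono fun x hx => congrArg G hx
  rw [e.fderiv_eq, h4.fderiv]
  constructor
  · intro h u v huv
    obtain ⟨u, rfl⟩ := surjective_of_injective_endo hs.reparam.injective u
    obtain ⟨v, rfl⟩ := surjective_of_injective_endo hs.reparam.injective v
    rw [h huv]
  · exact fun h => h.comp hs.reparam.injective

variable {U : Type*} [NormedAddCommGroup U] [NormedSpace ℝ U] [FiniteDimensional ℝ U]
  {K : Type*} [TopologicalSpace K] {J : ModelWithCorners ℝ U K}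
  {N : Type*} [TopologicalSpace N] [ChartedSpace K N] [IsManifold J ∞ N] [J.Boundaryless]

theorem injective_mfderiv_iff_chart {m : Vec n → N} {x : Vec n} {y : N}
    (hc : m x ∈ (extChartAt J y).source) (hm : MDifferentiableAt 𝓘(ℝ, Vec n) J m x) :
    Injective (mfderiv 𝓘(ℝ, Vec n) J m x) ↔ Injective (fderiv ℝ (extChartAt J y ∘ m) x) :=
  ⟨injective_fderiv_chart_comp hc hm, injective_mfderiv_of_comp
    ((eventually_contMDiffAt_extChartAt hc).self_of_nhds.mdifferentiableAt (by simp)) hm⟩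

variable (I J n) in
/-- The first order jets of the submanifolds on which `g` is an immersion. -/
def immersedJets (g : F → N) : Set (Jet I F n 1) :=
  {θ | ∃ s : ImmGerm I F n, Jet.mk 1 s = θ ∧ Injective (mfderiv 𝓘(ℝ, Vec n) J (g ∘ s) 0)}

variable {g : F → N}

theorem ImmGerm.IsGraph.injective_mfderiv_iff (hg : ContMDiff I J ∞ g) {y : N}
    (hs : s.IsGraph c A x₀ f ψ) (hy : g (s 0) ∈ (extChartAt J y).source) :
    Injective (mfderiv 𝓘(ℝ, Vec n) J (g ∘ s) 0) ↔
      Injective ((fderiv ℝ ((extChartAt J y ∘ g) ∘ (dividedChart (I := I) c A).symm)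
        (jetCoord c A (Jet.mk 1 s)).1).comp
          ((ContinuousLinearMap.id ℝ (Vec n)).prod (jetCoord c A (Jet.mk 1 s)).2)) := by
  have hg' := (hg (s 0)).mdifferentiableAt (n := ∞) (by simp)
  rw [injective_mfderiv_iff_chart hy (hg'.comp 0
    (s.smooth.self_of_nhds.mdifferentiableAt (by simp)))]
  exact hs.injective_fderiv_iff (G := extChartAt J y ∘ g)
    (((eventually_contMDiffAt_extChartAt hy).self_of_nhds.mdifferentiableAt (by simp)).comp _ hg')

theorem mk_mem_immersedJets_iff (hg : ContMDiff I J ∞ g) :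
    Jet.mk 1 s ∈ immersedJets I n J g ↔ Injective (mfderiv 𝓘(ℝ, Vec n) J (g ∘ s) 0) := by
  refine ⟨?_, fun h => ⟨s, rfl, h⟩⟩
  rintro ⟨s', h, hi⟩
  obtain ⟨A, x₀, f, ψ, hs⟩ := s.exists_isGraph
  obtain ⟨x₀', f', ψ', hs'⟩ := ImmGerm.exists_isGraph_of_mem_source one_ne_zero
    (h.symm ▸ hs.mk_mem_source 1)
  have hb : s' 0 = s 0 := congrArg Jet.base h
  rw [hs'.injective_mfderiv_iff hg (y := g (s 0)) (by rw [hb]; exact mem_extChartAt_source _),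
    h] at hi
  exact (hs.injective_mfderiv_iff hg (mem_extChartAt_source _)).2 hi

theorem isOpen_immersedJets (hg : ContMDiff I J ∞ g) : IsOpen (immersedJets I n J g) := by
  rw [isOpen_iff_mem_nhds]
  intro θ₀ h₀
  obtain ⟨s, rfl⟩ := θ₀.exists_mk
  rw [mk_mem_immersedJets_iff hg] at h₀
  obtain ⟨A, x₀, f, ψ, hs⟩ := s.exists_isGraph
  rw [hs.injective_mfderiv_iff hg (mem_extChartAt_source _)] at h₀
  have hsrc := hs.mk_mem_source 1
  set G := (extChartAt J (g (s 0)) ∘ g) ∘ (dividedChart (I := I) (s 0) A).symm with hG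
  have hGc : ContinuousAt (fderiv ℝ G) (jetCoord (s 0) A (Jet.mk 1 s)).1 := by
    rw [jetCoord_fst hsrc]
    have h1 : (dividedChart (I := I) (s 0) A).symm (dividedChart (I := I) (s 0) A (s 0)) = s 0 :=
      (dividedChart (I := I) (s 0) A).left_inv hs.mem_source
    have h2 : ContMDiffAt 𝓘(ℝ, Vec n × Vec (Module.finrank ℝ V - n)) 𝓘(ℝ, U) ∞ G
        (dividedChart (I := I) (s 0) A (s 0)) := by
      refine ContMDiffAt.comp (I' := I) _ ?_ (contMDiffAt_dividedChart_symm
        ((dividedChart (I := I) (s 0) A).map_source hs.mem_source))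
      rw [h1]
      exact ContMDiffAt.comp (I' := J) _ contMDiffAt_extChartAt (hg (s 0))
    exact h2.contDiffAt.continuousAt_fderiv (by simp)
  have hJ := (contMDiffAt_jetCoord hsrc).continuousAt
  have hcont : ContinuousAt (fun θ : Jet I F n 1 => (fderiv ℝ G (jetCoord (s 0) A θ).1).comp
      ((ContinuousLinearMap.id ℝ (Vec n)).prod (jetCoord (s 0) A θ).2)) (Jet.mk 1 s) := by
    have h1 : ContinuousAt (fun θ : Jet I F n 1 => fderiv ℝ G (jetCoord (s 0) A θ).1)
        (Jet.mk 1 s) := ContinuousAt.comp (f := fun θ : Jet I F n 1 => (jetCoord (s 0) A θ).1)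
          hGc hJ.fst
    have h2 : Continuous fun P : Vec n →L[ℝ] Vec (Module.finrank ℝ V - n) =>
        (ContinuousLinearMap.id ℝ (Vec n)).prod P := by
      have : (fun P : Vec n →L[ℝ] Vec (Module.finrank ℝ V - n) =>
          (ContinuousLinearMap.id ℝ (Vec n)).prod P) = fun P =>
          ContinuousLinearMap.inl ℝ _ _ + (ContinuousLinearMap.inr ℝ _ _).comp P := by
        funext P
        ext1 v
        exact Prod.ext (add_zero v).symm (zero_add (P v)).symm
      rw [this]
      fun_prop
    exact h1.clm_comp (h2.continuousAt.comp hJ.snd)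
  have hbase : ContinuousAt (fun θ : Jet I F n 1 => g θ.base) (Jet.mk 1 s) :=
    (hg.continuous.comp (Jet.contMDiff_base (I := I) (r := 1)).continuous).continuousAt
  filter_upwards [hcont.eventually (ContinuousLinearMap.isOpen_injective.mem_nhds h₀),
    isOpen_jetChart_source.mem_nhds hsrc,
    hbase.eventually ((isOpen_extChartAt_source (I := J) (g (s 0))).mem_nhds
      (mem_extChartAt_source _))] with θ h1 h2 h3
  obtain ⟨s', rfl⟩ := θ.exists_mk
  obtain ⟨x₀', f', ψ', hs'⟩ := ImmGerm.exists_isGraph_of_mem_source one_ne_zero h2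
  exact ⟨s', rfl, (hs'.injective_mfderiv_iff hg h3).2 h1⟩

end Immersed

/-! ### Jets of sections -/

section Sections
variable {n : ℕ}
  {H : Type*} [TopologicalSpace H] {I : ModelWithCorners ℝ (Vec n) H}
  {M : Type*} [TopologicalSpace M] [ChartedSpace H M] [IsManifold I ∞ M]
  {V' : Type*} [NormedAddCommGroup V'] [NormedSpace ℝ V'] [FiniteDimensional ℝ V']
  {H' : Type*} [TopologicalSpace H'] {I' : ModelWithCorners ℝ V' H'}
  {E : Type*} [TopologicalSpace E] [ChartedSpace H' E] [IsManifold I' ∞ E]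
  [I.Boundaryless] [I'.Boundaryless]
  {s : ImmGerm (I.prod I') (M × E) n} {f : M → E} {r : ℕ}

theorem ImmGerm.mdifferentiableAt_fst (s : ImmGerm (I.prod I') (M × E) n) :
    MDifferentiableAt 𝓘(ℝ, Vec n) I (Prod.fst ∘ s) 0 :=
  (s.smooth.self_of_nhds.mdifferentiableAt (by simp)).fst

/-- The immersion `s` factors through `fst ∘ s`, by means of `x ↦ (x, f x)`. -/
theorem IsGraphOf.injective_fst (h : IsGraphOf n s f) :
    Injective (mfderiv 𝓘(ℝ, Vec n) I (Prod.fst ∘ s) 0) := by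
  have h1 : MDifferentiableAt I (I.prod I') (fun x => (x, f x)) (s 0).1 :=
    mdifferentiableAt_id.prodMk (h.1.self_of_nhds.mdifferentiableAt (by simp))
  have e : (s : Vec n → M × E) =ᶠ[𝓝 0] (fun x => (x, f x)) ∘ (Prod.fst ∘ s) :=
    h.2.mono fun x hx => Prod.ext rfl hx
  have hi := s.immersion
  rw [e.mfderiv_eq, mfderiv_comp (I' := I) 0 h1 s.mdifferentiableAt_fst] at hi
  exact Injective.of_comp hi

/-- As `dim M = n`, the derivative of `fst ∘ s` is invertible, and `snd ∘ s` is `f` after `fst ∘ s`.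
-/
theorem IsGraphOf.injective_mfderiv_iff (h : IsGraphOf n s f) :
    Injective (mfderiv I I' f (s 0).1) ↔
      Injective (mfderiv 𝓘(ℝ, Vec n) I' (Prod.snd ∘ s) 0) := by
  have e : Prod.snd ∘ (s : Vec n → M × E) =ᶠ[𝓝 0] f ∘ (Prod.fst ∘ s) := h.2
  have hc := mfderiv_comp (I' := I) (g := f) (f := Prod.fst ∘ s) 0
    (h.1.self_of_nhds.mdifferentiableAt (by simp)) s.mdifferentiableAt_fst
  rw [e.mfderiv_eq, hc]
  have hi := h.injective_fst
  constructor
  · exact fun h' => h'.comp hi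
  · intro h' u v huv
    obtain ⟨u, rfl⟩ := surjective_of_injective_endo hi u
    obtain ⟨v, rfl⟩ := surjective_of_injective_endo hi v
    exact congrArg _ (h' huv)

/-- As `dim M = n`, `fst ∘ s` is a local diffeomorphism; its local inverse followed by `snd ∘ s` is
the required map. -/
theorem exists_isGraphOf (h : Injective (mfderiv 𝓘(ℝ, Vec n) I (Prod.fst ∘ s) 0)) :
    ∃ f, IsGraphOf n s f := by
  set κ := extChartAt I (s 0).1 with hκ
  have hsrc : (s 0).1 ∈ κ.source := mem_extChartAt_source _
  have h1 : ∀ᶠ x in 𝓝 (0 : Vec n), ContMDiffAt 𝓘(ℝ, Vec n) I ∞ (Prod.fst ∘ s) x :=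
    s.smooth.mono fun x hx => hx.fst
  have h2 : SmoothNear (κ ∘ Prod.fst ∘ s) 0 := by
    filter_upwards [h1, h1.self_of_nhds.continuousAt.eventually
      (eventually_contMDiffAt_extChartAt hsrc)] with x h1 h2
    exact (h2.comp x h1).contDiffAt
  obtain ⟨χ, hχ, hχ0, -, hl, -⟩ := h2.exists_inverse rfl
    (injective_fderiv_chart_comp (c := (s 0).1) hsrc s.mdifferentiableAt_fst h)
  refine ⟨fun x => (s (χ (κ x))).2, ?_, ?_⟩
  · have hκc : ContinuousAt κ (s 0).1 := continuousAt_extChartAt _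
    have hχc : ContinuousAt (χ ∘ κ) (s 0).1 := 
      ContinuousAt.comp (f := κ) hχ.self.continuousAt hκc
    have hs' : ∀ᶠ x in 𝓝 (χ (κ (s 0).1)), ContMDiffAt 𝓘(ℝ, Vec n) (I.prod I') ∞ s x := by
      have : χ (κ (s 0).1) = 0 := hχ0
      rw [this]
      exact s.smooth
    filter_upwards [eventually_contMDiffAt_extChartAt hsrc, hκc.eventually hχ,
      hχc.eventually hs'] with x h3 h4 h5
    exact (ContMDiffAt.comp (I' := 𝓘(ℝ, Vec n)) (g := s) (f := χ ∘ κ) x h5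
      (ContMDiffAt.comp (I' := 𝓘(ℝ, Vec n)) x h4.contMDiffAt h3)).snd
  · filter_upwards [hl] with x hx
    have : χ (κ (s x).1) = x := hx
    rw [this]

/-- Transversality to the fibres of the projection to `M` is a first-order condition, so in every
positive order the jets of sections are pulled back from `J¹`. -/
theorem mem_sectionJets_iff (hr : 1 ≤ r) (θ : Jet (I.prod I') (M × E) n r) :
    θ ∈ sectionJets I M I' E n r ↔
      θ.proj hr ∈ immersedJets (I.prod I') n I (Prod.fst : M × E → M) := by
  obtain ⟨s, rfl⟩ := θ.exists_mk
  constructor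
  · rintro ⟨s', f, h, hf⟩
    rw [← h]
    exact ⟨s', rfl, hf.injective_fst⟩
  · intro h
    rw [Jet.proj_mk, mk_mem_immersedJets_iff contMDiff_fst] at h
    obtain ⟨f, hf⟩ := exists_isGraphOf h
    exact ⟨s, f, rfl, hf⟩

theorem mem_immersiveSectionJets_iff (hr : 1 ≤ r) (θ : Jet (I.prod I') (M × E) n r) :
    θ ∈ immersiveSectionJets I M I' E n r ↔
      θ.proj hr ∈ immersedJets (I.prod I') n I (Prod.fst : M × E → M) ∩
        immersedJets (I.prod I') n I' (Prod.snd : M × E → E) := by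
  obtain ⟨s, rfl⟩ := θ.exists_mk
  constructor
  · rintro ⟨s', f, h, hf, hi⟩
    rw [← h]
    exact ⟨⟨s', rfl, hf.injective_fst⟩, s', rfl, hf.injective_mfderiv_iff.1 hi⟩
  · rintro ⟨h, h'⟩
    rw [Jet.proj_mk, mk_mem_immersedJets_iff contMDiff_fst] at h
    rw [Jet.proj_mk, mk_mem_immersedJets_iff contMDiff_snd] at h'
    obtain ⟨f, hf⟩ := exists_isGraphOf h
    exact ⟨s, f, rfl, hf, hf.injective_mfderiv_iff.2 h'⟩

theorem isOpen_sectionJets : IsOpen (sectionJets I M I' E n 1) := by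
  convert isOpen_immersedJets (I := I.prod I') (J := I) (n := n)
    (contMDiff_fst : ContMDiff (I.prod I') I ∞ (Prod.fst : M × E → M)) using 1
  ext θ
  rw [mem_sectionJets_iff le_rfl, Jet.proj_self]

theorem isOpen_immersiveSectionJets : IsOpen (immersiveSectionJets I M I' E n 1) := by
  convert (isOpen_immersedJets (I := I.prod I') (J := I) (n := n)
    (contMDiff_fst : ContMDiff (I.prod I') I ∞ (Prod.fst : M × E → M))).inter
    (isOpen_immersedJets (I := I.prod I') (J := I') (n := n)
    (contMDiff_snd : ContMDiff (I.prod I') I' ∞ (Prod.snd : M × E → E))) using 1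
  ext θ
  rw [mem_immersiveSectionJets_iff le_rfl, Jet.proj_self]

theorem proj_mem_sectionJets_iff (θ : Jet (I.prod I') (M × E) n 2) :
    θ.proj (Nat.le_succ 1) ∈ sectionJets I M I' E n 1 ↔ θ ∈ sectionJets I M I' E n 2 := by
  rw [mem_sectionJets_iff le_rfl, Jet.proj_self, mem_sectionJets_iff (Nat.le_succ 1)]

theorem proj_mem_immersiveSectionJets_iff (θ : Jet (I.prod I') (M × E) n 2) :
    θ.proj (Nat.le_succ 1) ∈ immersiveSectionJets I M I' E n 1 ↔
      θ ∈ immersiveSectionJets I M I' E n 2 := by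
  rw [mem_immersiveSectionJets_iff le_rfl, Jet.proj_self,
    mem_immersiveSectionJets_iff (Nat.le_succ 1)]

end Sections

/-! ### Integrability -/

section Integrable
variable {V : Type*} [NormedAddCommGroup V] [NormedSpace ℝ V] [FiniteDimensional ℝ V]
  {H : Type*} [TopologicalSpace H] {I : ModelWithCorners ℝ V H}
  {F : Type*} [TopologicalSpace F] [ChartedSpace H F] {n : ℕ} [IsManifold I ∞ F] [I.Boundaryless]
  {cov : Connection I F} {U : Set (Jet I F n 1)} {O : Set (Jet I F n 2)}

/-- If the distribution of a connection is integrable on `U`, the prolongations of the totally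
geodesic equation over `U` are isomorphic to `U`. -/
theorem prolongationsIsomorphicTo_of_integrableOn (hcov : ∀ p, HasChristoffel cov p)
    (hU : IsOpen U) (hO : ∀ θ : Jet I F n 2, θ.proj (Nat.le_succ 1) ∈ U ↔ θ ∈ O)
    (hD : IntegrableOn (jetI V n 1) n (geodesicDistribution n cov) U) :
    ProlongationsIsomorphicTo (geodesicEquation n cov ∩ O) U (geodesicDistribution n cov) := by
  -- Over `U` the equation is the image of the section `Γ̈`, the form treated by
  -- `prolongationsIsomorphicTo_of_isSolution`.
  have h : geodesicEquation n cov ∩ O = {θ : Jet I F n 2 | θ.proj (Nat.le_succ 1) ∈ U ∧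
      grassmannStructure cov (θ.proj (Nat.le_succ 1)) = θ} := by
    ext θ
    rw [mem_inter_iff, mem_geodesicEquation_iff hcov, ← hO, and_comm]
    rfl
  rw [h]
  exact prolongationsIsomorphicTo_of_isSolution hU (contMDiff_grassmannStructure hcov).contMDiffOn
    fun θ hθ => exists_isSolution (grassmannStructure_proj hcov) hD hθ

end Integrable

end

end GrassmannJet

/-! ### The three cases of the theorem. -/

theorem mainTheorem6 (n m : ℕ)
    {E : Type*} [TopologicalSpace E] [T2Space E] [ChartedSpace (EuclideanSpace ℝ (Fin (n + m))) E]
    [IsManifold (𝓡 (n + m)) ∞ E]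
    (Γ : Connection (𝓡 (n + m)) E) [CovariantDerivative.ContMDiffCovariantDerivative Γ ∞] (hΓ : Γ.torsion = 0)
    {M : Type*} [TopologicalSpace M] [T2Space M] [ChartedSpace (EuclideanSpace ℝ (Fin n)) M]
    [IsManifold (𝓡 n) ∞ M]
    (Θ : Connection (𝓡 n) M) [CovariantDerivative.ContMDiffCovariantDerivative Θ ∞] (hΘ : Θ.torsion = 0) :
    -- the equation on `J²(E, n)`
    (IntegrableOn (jetI _ n 1) n (geodesicDistribution n Γ) univ →
      ProlongationsIsomorphicTo (geodesicEquation n Γ) univ (geodesicDistribution n Γ)) ∧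
    -- the equation on `J² pr_M`
    (IntegrableOn (jetI _ n 1) n (geodesicDistribution n (prodConnection (𝓡 n) (𝓡 (n + m)) Θ Γ))
        (sectionJets (𝓡 n) M (𝓡 (n + m)) E n 1) →
      ProlongationsIsomorphicTo
        (geodesicEquation n (prodConnection (𝓡 n) (𝓡 (n + m)) Θ Γ) ∩
          sectionJets (𝓡 n) M (𝓡 (n + m)) E n 2)
        (sectionJets (𝓡 n) M (𝓡 (n + m)) E n 1)
        (geodesicDistribution n (prodConnection (𝓡 n) (𝓡 (n + m)) Θ Γ))) ∧
    -- the equation on `Imm J² pr_M`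
    (IntegrableOn (jetI _ n 1) n (geodesicDistribution n (prodConnection (𝓡 n) (𝓡 (n + m)) Θ Γ))
        (immersiveSectionJets (𝓡 n) M (𝓡 (n + m)) E n 1) →
      ProlongationsIsomorphicTo
        (geodesicEquation n (prodConnection (𝓡 n) (𝓡 (n + m)) Θ Γ) ∩
          immersiveSectionJets (𝓡 n) M (𝓡 (n + m)) E n 2)
        (immersiveSectionJets (𝓡 n) M (𝓡 (n + m)) E n 1)
        (geodesicDistribution n (prodConnection (𝓡 n) (𝓡 (n + m)) Θ Γ))) := by
  have hE := hasChristoffel_of_torsion_eq_zero Γ hΓ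
  -- Apart from integrability, smooth symmetric Christoffel symbols are all that is needed of the
  -- product connection.
  have hP : ∀ p : M × E, HasChristoffel (prodConnection (𝓡 n) (𝓡 (n + m)) Θ Γ) p := fun p =>
    (hasChristoffel_of_torsion_eq_zero Θ hΘ p.1).prod (hE p.2)
  refine ⟨fun hD => ?_, fun hD => ?_, fun hD => ?_⟩
  · rw [← inter_univ (geodesicEquation n Γ)]
    exact prolongationsIsomorphicTo_of_integrableOn hE isOpen_univ (fun _ => Iff.rfl) hD
  · exact prolongationsIsomorphicTo_of_integrableOn hP isOpen_sectionJets
      proj_mem_sectionJets_iff hD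
  · exact prolongationsIsomorphicTo_of_integrableOn hP isOpen_immersiveSectionJets
      proj_mem_immersiveSectionJets_iff hD
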